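/- Let $\mathbb{K}$ be $\mathbb{R}$ or $\mathbb{C}$ and let $V = V_{\mathbf 0}\oplus V_{\mathbf 1}$ be a $\mathbb{Z}_2$-graded Hausdorff locally convex $\mathbb{K}$-vector space whose projections onto the even and odd part are continuous. Let $\Lambda\colon V\times V\to\mathbb{K}$ be a (jointly) continuous bilinear form that is even, i.e. $\Lambda(v,w)=0$ for homogeneous $v,w$ of different parity. Put $\Lambda_-(v,w)=\tfrac12\bigl(\Lambda(v,w)-(-1)^{vw}\Lambda(w,v)\bigr)$ for homogeneous $v,w$, extended bilinearly, and $v^\sharp=\Lambda_-(v,\cdot)\in V^*$. Let $\mathrm{S}^\bullet(V)=\bigoplus_n \mathrm{S}^n(V)$ be the ($\mathbb{Z}_2$-graded) symmetric tensors, that is the image of the symmetrizer $\mathscr{S}$ (with Koszul signs) in the tensor algebra, with the symmetric product $\mu(a\otimes b)=ab=\mathscr{S}(a\otimes b)$. Let $P_\Lambda$ be the operator on $\mathrm{S}^\bullet(V)\otimes\mathrm{S}^\bullet(V)$ with $$P_\Lambda(v_1\cdots v_n\otimes w_1\cdots w_m)=\sum_{k,\ell}(-1)^{v_k(v_{k+1}+\cdots+v_n)+w_\ell(w_1+\cdots+w_{\ell-1})}\Lambda(v_k,w_\ell)\,v_1\cdots\widehat{v_k}\cdots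 v_n\otimes w_1\cdots\widehat{w_\ell}\cdots w_m$$ for homogeneous $v_i,w_j\in V$, and for $z\in\mathbb{K}$ let $a\star b=\mu\circ e^{zP_\Lambda}(a\otimes b)$. Let $\tfrac12\le R<1$, $z\neq0$, and equip $\mathrm{S}^\bullet(V)$ with the locally convex topology of the seminorms $p_R(a)=\sum_n p^{\otimes n}(a_n)\,n!^R$, where $p$ runs through the continuous seminorms of $V$ and $p^{\otimes n}$ is the projective tensor power of $p$. Let $\widehat{\mathcal{W}}_R$ be the completion. Then: 1. The symmetric product and $\star$ extend to continuous bilinear products on $\widehat{\mathcal{W}}_R$. 2. For each $w\in V_{\mathbf 0}$ the star-exponential series $\mathrm{Exp}_\star(w)=\sum_n\frac1{n!}\,w\star\cdots\star w$ converges absolutely in $\widehat{\mathcal{W}}_R$, and $$\mathrm{Exp}_\star(w)=e^{\,w+\frac z2\Lambda(w,w)1},$$ where the right-hand side is the (absolutely convergent) exponential series for the symmetric product. 3. Let $\varphi\in V'$ be an even continuous linear functional in the image of $\sharp$. The unital homomorphism of the tensor algebra with $v\mapsto v+\varphi(v)1$ preserves $\mathrm{S}^\bullet(V)$, and its restriction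 $\tau_\varphi^*$ to $\mathrm{S}^\bullet(V)$ extends continuously to $\widehat{\mathcal{W}}_R$; the extension $\tau_\varphi^*$ is a continuous unital automorphism of $(\widehat{\mathcal{W}}_R,\star)$. It is inner: there is $w\in V_{\mathbf 0}$ with $2z\,w^\sharp=\varphi$, and for each such $w$ the element $\mathrm{Exp}_\star(w)$ is $\star$-invertible with inverse $\mathrm{Exp}_\star(-w)$, and for all $a\in\widehat{\mathcal{W}}_R$ $$\tau_\varphi^*(a)=\mathrm{Exp}_\star(w)\star a\star\mathrm{Exp}_\star(-w).$$ -/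

import Mathlib

open scoped TensorProduct DirectSum

noncomputable section

namespace Weyl

section Algebra

variable {𝕜 : Type*} [RCLike 𝕜] {V : Type*} [AddCommGroup V] [Module 𝕜 V]

/-! ### The graded vector space -/

/-- The projection of `V = 𝒱 0 ⊕ 𝒱 1` onto its part of parity `i`. -/
def parityProj (𝒱 : ZMod 2 → Submodule 𝕜 V) [DirectSum.Decomposition 𝒱] (i : ZMod 2) :
    V →ₗ[𝕜] V :=
  (𝒱 i).subtype ∘ₗ DirectSum.component 𝕜 (ZMod 2) (fun j => 𝒱 j) i ∘ₗ
    (DirectSum.decomposeLinearEquiv 𝒱).toLinearMap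

/-- The sign `(-1)^(i j)` of the Koszul rule for two parities. -/
def koszul (i j : ZMod 2) : 𝕜 := if i = 1 ∧ j = 1 then -1 else 1

/-- A bilinear form is even if it pairs vectors of different parity to zero. -/
def IsEvenForm (𝒱 : ZMod 2 → Submodule 𝕜 V) (Λ : V →ₗ[𝕜] V →ₗ[𝕜] 𝕜) : Prop :=
  ∀ i j, i ≠ j → ∀ v ∈ 𝒱 i, ∀ w ∈ 𝒱 j, Λ v w = 0

/-- The opposite form `Λ ∘ τ`, with `τ (v ⊗ w) = (-1)^(v w) w ⊗ v` on homogeneous vectors. -/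
def oppForm (𝒱 : ZMod 2 → Submodule 𝕜 V) [DirectSum.Decomposition 𝒱]
    (Λ : V →ₗ[𝕜] V →ₗ[𝕜] 𝕜) : V →ₗ[𝕜] V →ₗ[𝕜] 𝕜 :=
  ∑ i : ZMod 2, ∑ j : ZMod 2,
    koszul (𝕜 := 𝕜) i j • Λ.flip.compl₁₂ (parityProj 𝒱 i) (parityProj 𝒱 j)

/-- The antisymmetric part `Λ₋ = (Λ - Λ ∘ τ) / 2`. -/
def antisymmPart (𝒱 : ZMod 2 → Submodule 𝕜 V) [DirectSum.Decomposition 𝒱]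
    (Λ : V →ₗ[𝕜] V →ₗ[𝕜] 𝕜) : V →ₗ[𝕜] V →ₗ[𝕜] 𝕜 :=
  (2 : 𝕜)⁻¹ • (Λ - oppForm 𝒱 Λ)

/-- The musical map `v ↦ v^♯ = Λ₋(v, ·)` into the algebraic dual. -/
def sharp (𝒱 : ZMod 2 → Submodule 𝕜 V) [DirectSum.Decomposition 𝒱]
    (Λ : V →ₗ[𝕜] V →ₗ[𝕜] 𝕜) : V →ₗ[𝕜] Module.Dual 𝕜 V :=
  antisymmPart 𝒱 Λ

/-! ### The tensor algebra and its symmetric tensors -/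

variable (𝕜 V) in
/-- The tensor algebra as the direct sum of the tensor powers; its multiplication is the
tensor product. -/
abbrev Tens : Type _ := ⨁ n : ℕ, ⨂[𝕜]^n V

/-- The component of `V^{⊗n}` with the `i`-th factor of parity `ε i`. -/
def multiProj (𝒱 : ZMod 2 → Submodule 𝕜 V) [DirectSum.Decomposition 𝒱] {n : ℕ}
    (ε : Fin n → ZMod 2) : (⨂[𝕜]^n V) →ₗ[𝕜] ⨂[𝕜]^n V :=
  PiTensorProduct.map fun i => parityProj 𝒱 (ε i)

/-- The sign of the permutation `σ` of `n` vectors of parities `ε`: one factor `-1` for each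
inversion of two odd vectors. -/
def permSign {n : ℕ} (ε : Fin n → ZMod 2) (σ : Equiv.Perm (Fin n)) : 𝕜 :=
  ∏ i, ∏ j, if i < j ∧ σ j < σ i then koszul (ε (σ i)) (ε (σ j)) else 1

/-- The signed right action of a permutation on `V^{⊗n}`: on homogeneous vectors,
`v₁ ⊗ ⋯ ⊗ vₙ` goes to `± v_{σ(1)} ⊗ ⋯ ⊗ v_{σ(n)}`. -/
def permAct (𝒱 : ZMod 2 → Submodule 𝕜 V) [DirectSum.Decomposition 𝒱] {n : ℕ}
    (σ : Equiv.Perm (Fin n)) : (⨂[𝕜]^n V) →ₗ[𝕜] ⨂[𝕜]^n V :=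
  ∑ ε : Fin n → ZMod 2, permSign (𝕜 := 𝕜) ε σ •
    ((PiTensorProduct.reindex 𝕜 (fun _ : Fin n => V) σ.symm).toLinearMap ∘ₗ multiProj 𝒱 ε)

/-- The symmetrizer on `V^{⊗n}`. -/
def symmetrizerPow (𝒱 : ZMod 2 → Submodule 𝕜 V) [DirectSum.Decomposition 𝒱] (n : ℕ) :
    (⨂[𝕜]^n V) →ₗ[𝕜] ⨂[𝕜]^n V :=
  (n.factorial : 𝕜)⁻¹ • ∑ σ : Equiv.Perm (Fin n), permAct 𝒱 σ

/-- The symmetrizer on the tensor algebra. -/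
def symmetrizer (𝒱 : ZMod 2 → Submodule 𝕜 V) [DirectSum.Decomposition 𝒱] :
    Tens 𝕜 V →ₗ[𝕜] Tens 𝕜 V :=
  DirectSum.lmap fun n => symmetrizerPow 𝒱 n

/-- The underlying vector space of the symmetric algebra: the image of the symmetrizer. -/
def symTens (𝒱 : ZMod 2 → Submodule 𝕜 V) [DirectSum.Decomposition 𝒱] :
    Submodule 𝕜 (Tens 𝕜 V) :=
  LinearMap.range (symmetrizer 𝒱)

/-- A vector of `V` as a tensor of degree one. -/
def tensOf : V →ₗ[𝕜] Tens 𝕜 V :=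
  DirectSum.lof 𝕜 ℕ (fun n => ⨂[𝕜]^n V) 1 ∘ₗ
    (PiTensorProduct.subsingletonEquiv (0 : Fin 1) : (⨂[𝕜]^1 V) ≃ₗ[𝕜] V).symm.toLinearMap

theorem sum_parityProj (𝒱 : ZMod 2 → Submodule 𝕜 V) [DirectSum.Decomposition 𝒱] (v : V) :
    ∑ i, parityProj 𝒱 i v = v := by
  classical
  conv_rhs => rw [← DirectSum.sum_support_decompose 𝒱 v]
  refine (Finset.sum_subset (Finset.subset_univ _) fun i _ hi => ?_).symm
  have h : DirectSum.decompose 𝒱 v i = 0 := by simpa using hi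
  exact congrArg Subtype.val h

theorem symmetrizerPow_of_le_one (𝒱 : ZMod 2 → Submodule 𝕜 V) [DirectSum.Decomposition 𝒱]
    {n : ℕ} (hn : n ≤ 1) : symmetrizerPow 𝒱 n = LinearMap.id := by
  have : Subsingleton (Fin n) := Fin.subsingleton_iff_le_one.mpr hn
  have hf : n.factorial = 1 := Nat.factorial_eq_one.mpr hn
  have hu : (Finset.univ : Finset (Equiv.Perm (Fin n))) = {1} := by
    ext σ
    simp [Subsingleton.elim σ 1]
  refine PiTensorProduct.ext (MultilinearMap.ext fun v => ?_)
  have hs : ∀ ε : Fin n → ZMod 2, permSign (𝕜 := 𝕜) ε 1 = 1 := fun ε =>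
    Finset.prod_eq_one fun i _ => Finset.prod_eq_one fun j _ =>
      if_neg fun h => h.1.ne (Subsingleton.elim i j)
  have hr : ∀ ε : Fin n → ZMod 2,
      PiTensorProduct.reindex 𝕜 (fun _ : Fin n => V) (Equiv.symm 1)
        (multiProj 𝒱 ε (PiTensorProduct.tprod 𝕜 v)) =
      PiTensorProduct.tprod 𝕜 fun i => parityProj 𝒱 (ε i) (v i) := fun ε => by
    rw [multiProj, PiTensorProduct.map_tprod]
    exact PiTensorProduct.reindex_tprod _ _
  have key := (MultilinearMap.map_sum (PiTensorProduct.tprod 𝕜 (s := fun _ : Fin n => V))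
    (α := fun _ => ZMod 2) (fun i j => parityProj 𝒱 j (v i))).symm
  simp only [sum_parityProj] at key
  simpa [symmetrizerPow, permAct, hu, hf, hs, hr] using key

theorem symmetrizer_lof (𝒱 : ZMod 2 → Submodule 𝕜 V) [DirectSum.Decomposition 𝒱] {n : ℕ}
    (hn : n ≤ 1) (x : ⨂[𝕜]^n V) :
    symmetrizer 𝒱 (DirectSum.lof 𝕜 ℕ (fun n => ⨂[𝕜]^n V) n x) =
      DirectSum.lof 𝕜 ℕ (fun n => ⨂[𝕜]^n V) n x := by
  rw [symmetrizer, DirectSum.lmap_lof, symmetrizerPow_of_le_one 𝒱 hn, LinearMap.id_apply]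

theorem one_mem_symTens (𝒱 : ZMod 2 → Submodule 𝕜 V) [DirectSum.Decomposition 𝒱] :
    (1 : Tens 𝕜 V) ∈ symTens 𝒱 :=
  ⟨1, symmetrizer_lof 𝒱 zero_le_one _⟩

theorem tensOf_mem_symTens (𝒱 : ZMod 2 → Submodule 𝕜 V) [DirectSum.Decomposition 𝒱] (v : V) :
    tensOf v ∈ symTens 𝒱 :=
  ⟨tensOf v, symmetrizer_lof 𝒱 le_rfl _⟩

/-! ### The operator `P_Λ` and the star product on symmetric tensors -/

/-- The isomorphism `V^{⊗(n+1)} → V^{⊗n} ⊗ V` that moves the `k`-th factor to the last place,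
without a sign. -/
def extract (n : ℕ) (k : Fin (n + 1)) : (⨂[𝕜]^(n + 1) V) →ₗ[𝕜] (⨂[𝕜]^n V) ⊗[𝕜] V :=
  PiTensorProduct.lift <| LinearMap.uncurryMid k
    { toFun := fun v =>
        ((TensorProduct.mk 𝕜 (⨂[𝕜]^n V) V).flip v).compMultilinearMap
          (PiTensorProduct.tprod 𝕜 (s := fun _ : Fin n => V))
      map_add' := fun v w => by ext; simp
      map_smul' := fun c v => by ext; simp }

/-- On homogeneous vectors,
`v₁ ⋯ vₙ ↦ ∑ₖ (-1)^{vₖ (vₖ₊₁ + ⋯ + vₙ)} (v₁ ⋯ v̂ₖ ⋯ vₙ) ⊗ vₖ`. -/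
def pullRightPow (𝒱 : ZMod 2 → Submodule 𝕜 V) [DirectSum.Decomposition 𝒱] :
    (n : ℕ) → (⨂[𝕜]^n V) →ₗ[𝕜] Tens 𝕜 V ⊗[𝕜] V
  | 0 => 0
  | n + 1 => ∑ k : Fin (n + 1), ∑ ε : Fin (n + 1) → ZMod 2,
      (∏ j ∈ Finset.Ioi k, koszul (𝕜 := 𝕜) (ε k) (ε j)) •
        ((DirectSum.lof 𝕜 ℕ (fun n => ⨂[𝕜]^n V) n).rTensor V ∘ₗ extract n k ∘ₗ multiProj 𝒱 ε)

/-- On homogeneous vectors,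
`w₁ ⋯ wₘ ↦ ∑ₗ (-1)^{wₗ (w₁ + ⋯ + wₗ₋₁)} (w₁ ⋯ ŵₗ ⋯ wₘ) ⊗ wₗ`. -/
def pullLeftPow (𝒱 : ZMod 2 → Submodule 𝕜 V) [DirectSum.Decomposition 𝒱] :
    (m : ℕ) → (⨂[𝕜]^m V) →ₗ[𝕜] Tens 𝕜 V ⊗[𝕜] V
  | 0 => 0
  | m + 1 => ∑ l : Fin (m + 1), ∑ ε : Fin (m + 1) → ZMod 2,
      (∏ j ∈ Finset.Iio l, koszul (𝕜 := 𝕜) (ε l) (ε j)) •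
        ((DirectSum.lof 𝕜 ℕ (fun n => ⨂[𝕜]^n V) m).rTensor V ∘ₗ extract m l ∘ₗ multiProj 𝒱 ε)

/-- `pullRightPow` on all of the tensor algebra. -/
def pullRight (𝒱 : ZMod 2 → Submodule 𝕜 V) [DirectSum.Decomposition 𝒱] :
    Tens 𝕜 V →ₗ[𝕜] Tens 𝕜 V ⊗[𝕜] V :=
  DirectSum.toModule 𝕜 ℕ _ (pullRightPow 𝒱)

/-- `pullLeftPow` on all of the tensor algebra. -/
def pullLeft (𝒱 : ZMod 2 → Submodule 𝕜 V) [DirectSum.Decomposition 𝒱] :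
    Tens 𝕜 V →ₗ[𝕜] Tens 𝕜 V ⊗[𝕜] V :=
  DirectSum.toModule 𝕜 ℕ _ (pullLeftPow 𝒱)

/-- The operator `P_Λ`: on homogeneous vectors it sends `v₁ ⋯ vₙ ⊗ w₁ ⋯ wₘ` to
`∑ₖ ∑ₗ (-1)^{vₖ (vₖ₊₁ + ⋯ + vₙ) + wₗ (w₁ + ⋯ + wₗ₋₁)} Λ(vₖ, wₗ) v₁ ⋯ v̂ₖ ⋯ vₙ ⊗ w₁ ⋯ ŵₗ ⋯ wₘ`.
It is written down on all tensors. The formula is compatible with the signed permutations of the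
`vₖ` and of the `wₗ`, so on symmetric tensors it is the same formula with the symmetric products
`v₁ ⋯ vₙ` and `w₁ ⋯ wₘ`. -/
def P (𝒱 : ZMod 2 → Submodule 𝕜 V) [DirectSum.Decomposition 𝒱] (Λ : V →ₗ[𝕜] V →ₗ[𝕜] 𝕜) :
    Tens 𝕜 V ⊗[𝕜] Tens 𝕜 V →ₗ[𝕜] Tens 𝕜 V ⊗[𝕜] Tens 𝕜 V :=
  (TensorProduct.rid 𝕜 (Tens 𝕜 V ⊗[𝕜] Tens 𝕜 V)).toLinearMap ∘ₗ
    (TensorProduct.lift Λ).lTensor (Tens 𝕜 V ⊗[𝕜] Tens 𝕜 V) ∘ₗ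
    (TensorProduct.tensorTensorTensorComm 𝕜 (Tens 𝕜 V) V (Tens 𝕜 V) V).toLinearMap ∘ₗ
    TensorProduct.map (pullRight 𝒱) (pullLeft 𝒱)

theorem P_mem_range (𝒱 : ZMod 2 → Submodule 𝕜 V) [DirectSum.Decomposition 𝒱]
    (Λ : V →ₗ[𝕜] V →ₗ[𝕜] 𝕜) (n : ℕ) (a : ⨂[𝕜]^(n + 1) V) (b : Tens 𝕜 V) :
    P 𝒱 Λ (DirectSum.lof 𝕜 ℕ (fun n => ⨂[𝕜]^n V) (n + 1) a ⊗ₜ b) ∈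
      LinearMap.range ((DirectSum.lof 𝕜 ℕ (fun n => ⨂[𝕜]^n V) n).rTensor (Tens 𝕜 V)) := by
  have h : ∀ (y : (⨂[𝕜]^n V) ⊗[𝕜] V) (u : Tens 𝕜 V ⊗[𝕜] V),
      TensorProduct.rid 𝕜 (Tens 𝕜 V ⊗[𝕜] Tens 𝕜 V)
        ((TensorProduct.lift Λ).lTensor (Tens 𝕜 V ⊗[𝕜] Tens 𝕜 V)
          (TensorProduct.tensorTensorTensorComm 𝕜 (Tens 𝕜 V) V (Tens 𝕜 V) V
            ((DirectSum.lof 𝕜 ℕ (fun n => ⨂[𝕜]^n V) n).rTensor V y ⊗ₜ u))) ∈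
      LinearMap.range ((DirectSum.lof 𝕜 ℕ (fun n => ⨂[𝕜]^n V) n).rTensor (Tens 𝕜 V)) := by
    intro y u
    induction y with
    | zero => simp
    | add y y' hy hy' =>
      simp only [map_add, TensorProduct.add_tmul]
      exact add_mem hy hy'
    | tmul y v =>
      induction u with
      | zero => simp
      | add u u' hu hu' =>
        simp only [map_add, TensorProduct.tmul_add]
        exact add_mem hu hu'
      | tmul c w =>
        refine ⟨Λ v w • (y ⊗ₜ c), ?_⟩
        simp
  obtain ⟨y, hy⟩ : pullRightPow 𝒱 (n + 1) a ∈
      LinearMap.range ((DirectSum.lof 𝕜 ℕ (fun n => ⨂[𝕜]^n V) n).rTensor V) := by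
    simp only [pullRightPow, LinearMap.sum_apply, LinearMap.smul_apply]
    exact sum_mem fun k _ => sum_mem fun ε _ => Submodule.smul_mem _ _ ⟨_, rfl⟩
  have hp : pullRight 𝒱 (DirectSum.lof 𝕜 ℕ (fun n => ⨂[𝕜]^n V) (n + 1) a) =
      (DirectSum.lof 𝕜 ℕ (fun n => ⨂[𝕜]^n V) n).rTensor V y := by
    rw [hy]
    exact DirectSum.toModule_lof 𝕜 (M := fun n => ⨂[𝕜]^n V) (n + 1) a
  simpa only [P, LinearMap.comp_apply, LinearEquiv.coe_coe, TensorProduct.map_tmul, hp] using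
    h y (pullLeft 𝒱 b)

/-- `P_Λ` is locally nilpotent, as it lowers the tensor degree. -/
theorem exists_P_pow_eq_zero (𝒱 : ZMod 2 → Submodule 𝕜 V) [DirectSum.Decomposition 𝒱]
    (Λ : V →ₗ[𝕜] V →ₗ[𝕜] 𝕜) (x : Tens 𝕜 V ⊗[𝕜] Tens 𝕜 V) :
    ∃ N, ∀ k, N ≤ k → (P 𝒱 Λ ^ k) x = 0 := by
  have step : ∀ n k, n < k → ∀ y : (⨂[𝕜]^n V) ⊗[𝕜] Tens 𝕜 V, (P 𝒱 Λ ^ k)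
      ((DirectSum.lof 𝕜 ℕ (fun n => ⨂[𝕜]^n V) n).rTensor (Tens 𝕜 V) y) = 0 := by
    intro n
    induction n with
    | zero =>
      intro k hk y
      obtain ⟨k, rfl⟩ : ∃ j, k = j + 1 := ⟨k - 1, by omega⟩
      induction y with
      | zero => simp
      | add y y' hy hy' => rw [map_add, map_add, hy, hy', add_zero]
      | tmul a b =>
        have h0 : pullRight 𝒱 (DirectSum.lof 𝕜 ℕ (fun n => ⨂[𝕜]^n V) 0 a) = 0 :=
          DirectSum.toModule_lof 𝕜 (M := fun n => ⨂[𝕜]^n V) 0 a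
        have : P 𝒱 Λ (DirectSum.lof 𝕜 ℕ (fun n => ⨂[𝕜]^n V) 0 a ⊗ₜ b) = 0 := by
          simp only [P, LinearMap.comp_apply, TensorProduct.map_tmul, h0,
            TensorProduct.zero_tmul, map_zero]
        rw [pow_succ, Module.End.mul_apply, LinearMap.rTensor_tmul, this, map_zero]
    | succ n ih =>
      intro k hk y
      obtain ⟨k, rfl⟩ : ∃ j, k = j + 1 := ⟨k - 1, by omega⟩
      induction y with
      | zero => simp
      | add y y' hy hy' => rw [map_add, map_add, hy, hy', add_zero]
      | tmul a b =>
        obtain ⟨y, hy⟩ := P_mem_range 𝒱 Λ n a b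
        rw [pow_succ, Module.End.mul_apply, LinearMap.rTensor_tmul, ← hy]
        exact ih k (by omega) y
  induction x with
  | zero => exact ⟨0, fun k _ => map_zero _⟩
  | add x y hx hy =>
    obtain ⟨N, hN⟩ := hx
    obtain ⟨M, hM⟩ := hy
    exact ⟨max N M, fun k hk => by
      rw [map_add, hN k (le_of_max_le_left hk), hM k (le_of_max_le_right hk), add_zero]⟩
  | tmul a b =>
    induction a using DirectSum.induction_on with
    | zero => exact ⟨0, fun k _ => by rw [TensorProduct.zero_tmul, map_zero]⟩
    | of n a => exact ⟨n + 1, fun k hk => step n k hk (a ⊗ₜ b)⟩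
    | add x y hx hy =>
      obtain ⟨N, hN⟩ := hx
      obtain ⟨M, hM⟩ := hy
      exact ⟨max N M, fun k hk => by
        rw [TensorProduct.add_tmul, map_add, hN k (le_of_max_le_left hk),
          hM k (le_of_max_le_right hk), add_zero]⟩

theorem expP_support_finite (𝒱 : ZMod 2 → Submodule 𝕜 V) [DirectSum.Decomposition 𝒱]
    (Λ : V →ₗ[𝕜] V →ₗ[𝕜] 𝕜) (z : 𝕜) (x : Tens 𝕜 V ⊗[𝕜] Tens 𝕜 V) :
    (Function.support fun k : ℕ => (z ^ k / (k.factorial : 𝕜)) • (P 𝒱 Λ ^ k) x).Finite := by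
  obtain ⟨N, hN⟩ := exists_P_pow_eq_zero 𝒱 Λ x
  refine (Set.finite_lt_nat N).subset fun k hk => ?_
  by_contra h
  exact hk (by simp only [hN k (not_lt.mp h), smul_zero])

/-- The exponential `e^{z P_Λ}`; the sum is finite on every element. -/
def expP (𝒱 : ZMod 2 → Submodule 𝕜 V) [DirectSum.Decomposition 𝒱] (Λ : V →ₗ[𝕜] V →ₗ[𝕜] 𝕜)
    (z : 𝕜) : Tens 𝕜 V ⊗[𝕜] Tens 𝕜 V →ₗ[𝕜] Tens 𝕜 V ⊗[𝕜] Tens 𝕜 V where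
  toFun x := ∑ᶠ k : ℕ, (z ^ k / (k.factorial : 𝕜)) • (P 𝒱 Λ ^ k) x
  map_add' x y := by
    rw [← finsum_add_distrib (expP_support_finite 𝒱 Λ z x) (expP_support_finite 𝒱 Λ z y)]
    simp only [map_add, smul_add]
  map_smul' c x := by
    rw [RingHom.id_apply, smul_finsum' c (expP_support_finite 𝒱 Λ z x)]
    simp only [map_smul, smul_comm c]

/-- The symmetric tensor product `S (a ⊗ b)` as a linear map on `a ⊗ b`. -/
def symMul (𝒱 : ZMod 2 → Submodule 𝕜 V) [DirectSum.Decomposition 𝒱] :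
    Tens 𝕜 V ⊗[𝕜] Tens 𝕜 V →ₗ[𝕜] Tens 𝕜 V :=
  symmetrizer 𝒱 ∘ₗ LinearMap.mul' 𝕜 (Tens 𝕜 V)

theorem symMul_mem (𝒱 : ZMod 2 → Submodule 𝕜 V) [DirectSum.Decomposition 𝒱]
    (x : Tens 𝕜 V ⊗[𝕜] Tens 𝕜 V) : symMul 𝒱 x ∈ symTens 𝒱 :=
  ⟨_, rfl⟩

/-- The unital algebra homomorphism of the tensor algebra that sends `v` to `v + φ(v) 1`. -/
def translate (φ : V →ₗ[𝕜] 𝕜) : Tens 𝕜 V →ₐ[𝕜] Tens 𝕜 V :=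
  (TensorAlgebra.lift 𝕜 (tensOf + φ.smulRight (1 : Tens 𝕜 V))).comp
    (TensorAlgebra.equivDirectSum (R := 𝕜) (M := V)).symm.toAlgHom

end Algebra

/-! ### Seminorms on tensors -/

section Seminorms

variable {𝕜 : Type*} [RCLike 𝕜] {V : Type*} [AddCommGroup V] [Module 𝕜 V]

/-- The value `∑ᵢ |cᵢ| p(vᵢ⁽¹⁾) ⋯ p(vᵢ⁽ⁿ⁾)` of a formal linear combination of elementary
tensors. -/
def piCost (p : Seminorm 𝕜 V) {n : ℕ} (q : FreeAddMonoid (𝕜 × (Fin n → V))) : ℝ :=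
  (q.toList.map fun y => ‖y.1‖ * ∏ i, p (y.2 i)).sum

theorem piCost_nonneg (p : Seminorm 𝕜 V) {n : ℕ} (q : FreeAddMonoid (𝕜 × (Fin n → V))) :
    0 ≤ piCost p q := by
  refine List.sum_nonneg fun a ha => ?_
  obtain ⟨y, -, rfl⟩ := List.mem_map.mp ha
  exact mul_nonneg (norm_nonneg _) (Finset.prod_nonneg fun i _ => apply_nonneg p _)

theorem piCost_bddBelow (p : Seminorm 𝕜 V) {n : ℕ} (x : ⨂[𝕜]^n V) :
    BddBelow (Set.range fun q : PiTensorProduct.lifts x => piCost p q.1) :=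
  ⟨0, by rintro _ ⟨q, rfl⟩; exact piCost_nonneg p q.1⟩

/-- The seminorm `pⁿ = p ⊗ ⋯ ⊗ p` on `V^{⊗n}`: the infimum of `piCost` over all ways of writing
a tensor as a linear combination of elementary tensors. -/
def powSeminorm (p : Seminorm 𝕜 V) (n : ℕ) : Seminorm 𝕜 (⨂[𝕜]^n V) :=
  .ofSMulLE (fun x => ⨅ q : PiTensorProduct.lifts x, piCost p q.1)
    (le_antisymm
      (ciInf_le_of_le (piCost_bddBelow p _) ⟨0, PiTensorProduct.lifts_zero⟩ (by simp [piCost]))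
      (Real.iInf_nonneg fun q => piCost_nonneg p q.1))
    (fun x y => by
      have := (PiTensorProduct.nonempty_lifts x).to_subtype
      have := (PiTensorProduct.nonempty_lifts y).to_subtype
      exact le_ciInf_add_ciInf fun q r => ciInf_le_of_le (piCost_bddBelow p _)
        ⟨q.1 + r.1, PiTensorProduct.lifts_add q.2 r.2⟩ (by simp [piCost]))
    (fun a x => by
      have := (PiTensorProduct.nonempty_lifts x).to_subtype
      rw [Real.mul_iInf_of_nonneg (norm_nonneg _)]
      refine le_ciInf fun q => ciInf_le_of_le (piCost_bddBelow p _)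
        ⟨_, PiTensorProduct.lifts_smul q.2 a⟩ (le_of_eq ?_)
      simp [piCost, Function.comp_def, mul_assoc, List.sum_map_mul_left])

theorem summable_weighted (p : Seminorm 𝕜 V) (R : ℝ) (a : Tens 𝕜 V) :
    Summable fun n : ℕ => powSeminorm p n (a n) * (n.factorial : ℝ) ^ R := by
  classical
  refine summable_of_ne_finset_zero (s := DFinsupp.support a) fun n hn => ?_
  have : a n = 0 := by simpa using hn
  simp [this]

/-- The seminorm `p_R(a) = ∑ₙ pⁿ(aₙ) n!^R` on the tensor algebra. -/
def weightedSeminorm (p : Seminorm 𝕜 V) (R : ℝ) : Seminorm 𝕜 (Tens 𝕜 V) :=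
  .ofSMulLE (fun a => ∑' n : ℕ, powSeminorm p n (a n) * (n.factorial : ℝ) ^ R)
    (by simp)
    (fun a b => by
      rw [← (summable_weighted p R a).tsum_add (summable_weighted p R b)]
      refine (summable_weighted p R (a + b)).tsum_le_tsum (fun n => ?_)
        ((summable_weighted p R a).add (summable_weighted p R b))
      rw [← add_mul]
      exact mul_le_mul_of_nonneg_right (map_add_le_add (powSeminorm p n) (a n) (b n))
        (by positivity))
    (fun c a => by
      rw [← tsum_mul_left]
      refine le_of_eq (tsum_congr fun n => ?_)
      rw [show (c • a) n = c • a n from rfl, map_smul_eq_mul, mul_assoc])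

end Seminorms

/-! ### The Weyl algebra and its completion -/

section Topology

variable {𝕜 : Type*} [RCLike 𝕜] {V : Type*} [AddCommGroup V] [Module 𝕜 V]

/-- The vector space of symmetric tensors, to be equipped with the topology of the
seminorms `p_R`. -/
def WeylSpace (𝒱 : ZMod 2 → Submodule 𝕜 V) [DirectSum.Decomposition 𝒱] (_R : ℝ) : Type _ :=
  symTens 𝒱

variable (𝒱 : ZMod 2 → Submodule 𝕜 V) [DirectSum.Decomposition 𝒱] (R : ℝ)

instance : AddCommGroup (WeylSpace 𝒱 R) := inferInstanceAs (AddCommGroup (symTens 𝒱))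

instance : Module 𝕜 (WeylSpace 𝒱 R) := inferInstanceAs (Module 𝕜 (symTens 𝒱))

/-- The inclusion into the tensor algebra. -/
def WeylSpace.incl : WeylSpace 𝒱 R →ₗ[𝕜] Tens 𝕜 V := (symTens 𝒱).subtype

variable [TopologicalSpace V]

/-- The seminorms `p_R` on symmetric tensors, for all continuous seminorms `p` on `V`. -/
def WeylSpace.seminorms : SeminormFamily 𝕜 (WeylSpace 𝒱 R) {p : Seminorm 𝕜 V // Continuous p} :=
  fun p => (weightedSeminorm p.1 R).comp (WeylSpace.incl 𝒱 R)

instance : Nonempty {p : Seminorm 𝕜 V // Continuous p} := ⟨0, continuous_const⟩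

/-- The locally convex topology of the seminorms `p_R`. -/
@[reducible] def WeylSpace.topology : TopologicalSpace (WeylSpace 𝒱 R) :=
  (WeylSpace.seminorms 𝒱 R).moduleFilterBasis.topology

/-- The uniform structure of the topological group defined by the seminorms `p_R`. -/
instance : UniformSpace (WeylSpace 𝒱 R) :=
  letI := WeylSpace.topology 𝒱 R
  haveI : IsTopologicalAddGroup (WeylSpace 𝒱 R) :=
    (WithSeminorms.mk (p := WeylSpace.seminorms 𝒱 R) rfl).topologicalAddGroup
  IsTopologicalAddGroup.rightUniformSpace (WeylSpace 𝒱 R)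

theorem WeylSpace.withSeminorms : WithSeminorms (WeylSpace.seminorms 𝒱 R) := ⟨rfl⟩

instance : IsTopologicalAddGroup (WeylSpace 𝒱 R) :=
  (WeylSpace.withSeminorms 𝒱 R).topologicalAddGroup

instance : IsUniformAddGroup (WeylSpace 𝒱 R) :=
  letI := WeylSpace.topology 𝒱 R
  haveI : IsTopologicalAddGroup (WeylSpace 𝒱 R) :=
    (WithSeminorms.mk (p := WeylSpace.seminorms 𝒱 R) rfl).topologicalAddGroup
  isUniformAddGroup_of_addCommGroup

instance : ContinuousSMul 𝕜 (WeylSpace 𝒱 R) :=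
  (WeylSpace.withSeminorms 𝒱 R).continuousSMul

instance : UniformContinuousConstSMul 𝕜 (WeylSpace 𝒱 R) :=
  uniformContinuousConstSMul_of_continuousConstSMul 𝕜 (WeylSpace 𝒱 R)

/-- The completion of the locally convex space of symmetric tensors. -/
abbrev WeylCompletion : Type _ := UniformSpace.Completion (WeylSpace 𝒱 R)

variable {R}

/-- A symmetric tensor as an element of the space with the topology of index `R`. -/
def WeylSpace.mk (a : Tens 𝕜 V) (ha : a ∈ symTens 𝒱) : WeylSpace 𝒱 R := ⟨a, ha⟩

/-- The unit of the symmetric algebra. -/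
def WeylSpace.unit : WeylSpace 𝒱 R := WeylSpace.mk 𝒱 1 (one_mem_symTens 𝒱)

/-- A vector of `V` as an element of the symmetric algebra. -/
def WeylSpace.of (v : V) : WeylSpace 𝒱 R := WeylSpace.mk 𝒱 (tensOf v) (tensOf_mem_symTens 𝒱 v)

/-- The symmetric tensor product `a b = S (a ⊗ b)`. -/
def WeylSpace.sym (a b : WeylSpace 𝒱 R) : WeylSpace 𝒱 R :=
  WeylSpace.mk 𝒱 (symMul 𝒱 (WeylSpace.incl 𝒱 R a ⊗ₜ WeylSpace.incl 𝒱 R b)) (symMul_mem 𝒱 _)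

/-- The star product `a ⋆ b = μ (e^{z P_Λ} (a ⊗ b))`, where `μ` is the symmetric tensor
product. -/
def WeylSpace.star (Λ : V →ₗ[𝕜] V →ₗ[𝕜] 𝕜) (z : 𝕜) (a b : WeylSpace 𝒱 R) : WeylSpace 𝒱 R :=
  WeylSpace.mk 𝒱 (symMul 𝒱 (expP 𝒱 Λ z (WeylSpace.incl 𝒱 R a ⊗ₜ WeylSpace.incl 𝒱 R b)))
    (symMul_mem 𝒱 _)

/-- The translation on symmetric tensors. For an even `φ` the translation of a symmetric tensor is
symmetric, so that the symmetrizer in this formula does not change it. -/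
def WeylSpace.translate (φ : V →ₗ[𝕜] 𝕜) (a : WeylSpace 𝒱 R) : WeylSpace 𝒱 R :=
  WeylSpace.mk 𝒱 (symmetrizer 𝒱 (Weyl.translate φ (WeylSpace.incl 𝒱 R a))) ⟨_, rfl⟩

/-- The unit of the completed algebra. -/
def unit : WeylCompletion 𝒱 R := (WeylSpace.unit 𝒱 : WeylSpace 𝒱 R)

/-- A vector of `V` as an element of the completed algebra. -/
def of (v : V) : WeylCompletion 𝒱 R := (WeylSpace.of 𝒱 v : WeylSpace 𝒱 R)

variable {𝒱}

/-- The extension of a binary operation to the completion by continuity. -/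
def extendMul (m : WeylSpace 𝒱 R → WeylSpace 𝒱 R → WeylSpace 𝒱 R)
    (a b : WeylCompletion 𝒱 R) : WeylCompletion 𝒱 R :=
  (UniformSpace.Completion.isDenseInducing_coe.prodMap
    (UniformSpace.Completion.isDenseInducing_coe (α := WeylSpace 𝒱 R))).extend
    (fun x : WeylSpace 𝒱 R × WeylSpace 𝒱 R => (m x.1 x.2 : WeylCompletion 𝒱 R)) (a, b)

/-- `M` is a continuous bilinear extension of the operation `m` to the completion. -/
structure IsContinuousExtension (m : WeylSpace 𝒱 R → WeylSpace 𝒱 R → WeylSpace 𝒱 R)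
    (M : WeylCompletion 𝒱 R → WeylCompletion 𝒱 R → WeylCompletion 𝒱 R) : Prop where
  extends_mul : ∀ a b : WeylSpace 𝒱 R, M a b = (m a b : WeylCompletion 𝒱 R)
  continuous_mul : Continuous fun x : WeylCompletion 𝒱 R × WeylCompletion 𝒱 R => M x.1 x.2
  linear_left : ∀ b, IsLinearMap 𝕜 fun a => M a b
  linear_right : ∀ a, IsLinearMap 𝕜 fun b => M a b

variable (𝒱)

/-- The symmetric tensor product on the completion. -/
def symC : WeylCompletion 𝒱 R → WeylCompletion 𝒱 R → WeylCompletion 𝒱 R :=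
  extendMul (WeylSpace.sym 𝒱)

/-- The star product on the completion. -/
def starC (Λ : V →ₗ[𝕜] V →ₗ[𝕜] 𝕜) (z : 𝕜) :
    WeylCompletion 𝒱 R → WeylCompletion 𝒱 R → WeylCompletion 𝒱 R :=
  extendMul (WeylSpace.star 𝒱 Λ z)

/-- The translation on the completion. -/
def translateC (φ : V →ₗ[𝕜] 𝕜) : WeylCompletion 𝒱 R → WeylCompletion 𝒱 R :=
  UniformSpace.Completion.map (WeylSpace.translate 𝒱 φ)

variable {𝒱}

/-- The powers of `a` for a binary operation on the completion. -/
def powC (M : WeylCompletion 𝒱 R → WeylCompletion 𝒱 R → WeylCompletion 𝒱 R)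
    (a : WeylCompletion 𝒱 R) : ℕ → WeylCompletion 𝒱 R
  | 0 => unit 𝒱
  | n + 1 => M (powC M a n) a

/-- The terms `aⁿ / n!` of the exponential series. -/
def expTerm (M : WeylCompletion 𝒱 R → WeylCompletion 𝒱 R → WeylCompletion 𝒱 R)
    (a : WeylCompletion 𝒱 R) (n : ℕ) : WeylCompletion 𝒱 R :=
  (n.factorial : 𝕜)⁻¹ • powC M a n

/-- The exponential series for a binary operation on the completion. -/
def expC (M : WeylCompletion 𝒱 R → WeylCompletion 𝒱 R → WeylCompletion 𝒱 R)
    (a : WeylCompletion 𝒱 R) : WeylCompletion 𝒱 R :=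
  ∑' n, expTerm M a n

/-- The series `∑ₙ fₙ` converges absolutely to `s`: it converges to `s`, and `∑ₙ q(fₙ)` is finite
for each continuous seminorm `q`. -/
def ConvergesAbsolutely (f : ℕ → WeylCompletion 𝒱 R) (s : WeylCompletion 𝒱 R) : Prop :=
  HasSum f s ∧
    ∀ q : Seminorm 𝕜 (WeylCompletion 𝒱 R), Continuous q → Summable fun n => q (f n)

/-- `T` is a continuous automorphism of the completion with the product `M`. -/
structure IsContinuousAut (M : WeylCompletion 𝒱 R → WeylCompletion 𝒱 R → WeylCompletion 𝒱 R)
    (T : WeylCompletion 𝒱 R → WeylCompletion 𝒱 R) : Prop where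
  linear : IsLinearMap 𝕜 T
  map_unit : T (unit 𝒱) = unit 𝒱
  map_mul : ∀ a b, T (M a b) = M (T a) (T b)
  bijective : Function.Bijective T
  continuous : Continuous T

/-- `T` is the conjugation `a ↦ u a u'` by an invertible element `u` with inverse `u'`. -/
structure IsConjugation (M : WeylCompletion 𝒱 R → WeylCompletion 𝒱 R → WeylCompletion 𝒱 R)
    (u u' : WeylCompletion 𝒱 R) (T : WeylCompletion 𝒱 R → WeylCompletion 𝒱 R) : Prop where
  mul_inv : M u u' = unit 𝒱
  inv_mul : M u' u = unit 𝒱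
  conj : ∀ a, T a = M (M u a) u'
  conj' : ∀ a, T a = M u (M a u')

end Topology

end Weyl

end

/-!
The proof has an algebraic part, in which the star product is controlled by left multiplication
with vectors, and an analytic part, in which one estimate makes everything continuous.

*Symmetric tensors as a quotient.* The symmetrizer `S` satisfies a recursion: `S (v a)` is the
average of the insertions of `v` at the `N + 1` places of `S a`, for `a` of degree `N`
(`symmetrizer_mul`). It follows that the kernel of `S` is the two-sided ideal generated by the
graded commutators (`symmetrizer_eq_zero_iff`), so that the symmetric tensors are a quotient of the
tensor algebra, and identities between them can be checked modulo this ideal.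

*The star product on all tensors.* The formula `μ ∘ e^{z P_Λ}` makes sense on the whole tensor
algebra; call it `starT`. The commutator of `P_Λ` with left multiplication by a homogeneous vector
`v` on the first factor is `γ ⊗ ι_v`, where `γ` is the grading automorphism for odd `v` and the
identity for even `v`, and `ι_v` is the contraction with `Λ(v, ·)`; this operator commutes with
`P_Λ`. Hence `e^{z P_Λ}` can be moved past `v` (`expP_mulFst`), which gives `v ⋆ b = v b + z ι_v b`
(`tensOf_starT`). The tensor algebra is generated from `1` by these operators (`mem_of_starT_mem`),
which reduces associativity to the case of a vector on the left (`starT_assoc`), where it is the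
statement that contractions are graded derivations of `⋆`. The commutator ideal is also an ideal for
`⋆` (`starT_mem_symIdeal_left`, `starT_mem_symIdeal_right`), so the star product of symmetric
tensors is the quotient of `starT` (`WeylSpace.starHom_proj`) and inherits associativity and the
commutation relation `w ⋆ v - v ⋆ w = 2 z w^♯(v)` for even `w`.

*Continuity.* The topology is given already by the seminorms `p` of `V` that are adapted to the
grading and dominate `Λ` (`exists_isAdapted`). For such `p` the `k`-th power of `P_Λ` on elementary
tensors of degrees `n + k` and `m + k` is bounded by the number `(n + k)! (m + k)! / (n! m!)` of its
terms. Weighed against the factors `n!^R` this grows only exponentially in the degrees, because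
`R ≥ 1/2` (`factorial_growth`), and exponential factors are absorbed by a multiple of `p`
(`weightedSeminorm_starT_le`). So `⋆` is a bounded bilinear map (`isBoundedBilin_starHom`) and
extends to the completion (`IsBoundedBilin.isContinuousExtension`). The symmetric product is the
case `z = 0`.

*Exponentials.* For even `w` the recursion `w ⋆ wᵐ = wᵐ⁺¹ + m z Λ(w, w) wᵐ⁻¹` expresses the star
powers of `w` through the divided powers `wᵐ / m!` (`WeylSpace.starPow_eq_sum`), and the same is
done for the symmetric powers of `w + c` (`WeylSpace.symPow_eq_sum`). The divided powers are
absolutely summable because `R < 1` (`absSummable_dividedPow`). Therefore both exponential series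
are Cauchy products of the series of divided powers with a scalar series of sum
`exp (z Λ(w, w) / 2)`, and they agree (`expC_starC_eq_expC_symC`).

*Translations are inner.* The binomial theorem gives `Exp(w) ⋆ Exp(-w) = 1` (`expC_mul_expC_neg`),
and if `2 z w^♯ = φ`, the commutation relation gives `Exp(w) ⋆ v = (v + φ(v)) ⋆ Exp(w)`
(`expC_starC_of`). So conjugation by `Exp(w)` and the translation by `φ` satisfy the same recursion
under left multiplication by vectors and agree on symmetric tensors (`conj_coe_eq_translate`). The
translation is thus continuous, and by density its extension is the conjugation by `Exp(w)`
(`isConjugation_translateC`), which is an automorphism. An even functional in the image of `♯` is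
of the form `2 z w^♯` with `w` even, since `♯` preserves parity (`exists_even_sharp_eq`).
-/

noncomputable section

namespace Weyl

section TensorAlgebraPart

variable {𝕜 : Type*} [RCLike 𝕜] {V : Type*} [AddCommGroup V] [Module 𝕜 V]

/-! ### The tensor algebra and its elementary tensors -/

theorem Tens.mul_sub (a b c : Tens 𝕜 V) : a * (b - c) = a * b - a * c :=
  map_sub (LinearMap.mulLeft 𝕜 a) b c

/-- The elementary tensor `v₁ ⊗ ⋯ ⊗ vₙ` in the tensor algebra. -/
def elem {n : ℕ} (v : Fin n → V) : Tens 𝕜 V :=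
  DirectSum.lof 𝕜 ℕ (fun n => ⨂[𝕜]^n V) n (PiTensorProduct.tprod 𝕜 v)

theorem elem_def {n : ℕ} (v : Fin n → V) : (elem v : Tens 𝕜 V) =
    DirectSum.lof 𝕜 ℕ (fun n => ⨂[𝕜]^n V) n (PiTensorProduct.tprod 𝕜 v) := rfl

theorem elem_zero (v : Fin 0 → V) : (elem v : Tens 𝕜 V) = 1 := by
  rw [Subsingleton.elim v Fin.elim0]
  rfl

theorem tensOf_eq_elem (v : V) : (tensOf v : Tens 𝕜 V) = elem fun _ : Fin 1 => v := by
  simp [tensOf, elem]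

theorem elem_eq_toDirectSum {n : ℕ} (v : Fin n → V) :
    (elem v : Tens 𝕜 V) = TensorAlgebra.toDirectSum (TensorAlgebra.tprod 𝕜 V n v) :=
  (TensorAlgebra.toDirectSum_tensorPower_tprod v).symm

theorem toDirectSum_ι (v : V) :
    TensorAlgebra.toDirectSum (TensorAlgebra.ι 𝕜 v) = (tensOf v : Tens 𝕜 V) := by
  rw [tensOf_eq_elem, elem_def, TensorAlgebra.toDirectSum_ι]
  rfl

theorem elem_append {n m : ℕ} (v : Fin n → V) (w : Fin m → V) :
    (elem (Fin.append v w) : Tens 𝕜 V) = elem v * elem w := by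
  rw [elem, elem, elem, DirectSum.lof_eq_of, DirectSum.lof_eq_of, DirectSum.lof_eq_of,
    DirectSum.of_mul_of, TensorPower.tprod_mul_tprod]

theorem elem_cons {n : ℕ} (v : V) (w : Fin n → V) :
    (elem (Fin.cons v w : Fin (n + 1) → V) : Tens 𝕜 V) = tensOf v * elem w := by
  rw [elem_eq_toDirectSum, elem_eq_toDirectSum, ← toDirectSum_ι, ← map_mul,
    TensorAlgebra.tprod_apply, TensorAlgebra.tprod_apply, List.ofFn_succ, List.prod_cons]
  simp

/-- A subspace that contains `1` and is stable under left multiplication by homogeneous vectors is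
everything. -/
theorem Tens.induction (𝒱 : ZMod 2 → Submodule 𝕜 V) [DirectSum.Decomposition 𝒱]
    {C : Tens 𝕜 V → Prop} (add : ∀ a b, C a → C b → C (a + b))
    (smul : ∀ (c : 𝕜) a, C a → C (c • a)) (one : C 1)
    (mul : ∀ i, ∀ v ∈ 𝒱 i, ∀ a, C a → C (tensOf v * a)) (a : Tens 𝕜 V) : C a := by
  let A : Submodule 𝕜 (Tens 𝕜 V) :=
    { carrier := {x | C x}
      add_mem' := fun ha hb => add _ _ ha hb
      zero_mem' := by simpa using smul 0 1 one
      smul_mem' := fun c x hx => smul c x hx }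
  have hv : ∀ (v : V) (a), a ∈ A → tensOf v * a ∈ A := fun v a ha => by
    rw [← sum_parityProj 𝒱 v, map_sum, Finset.sum_mul]
    exact sum_mem fun i _ => mul i _ (Submodule.coe_mem _) a ha
  have key : ∀ x : TensorAlgebra 𝕜 V, ∀ a ∈ A, TensorAlgebra.toDirectSum x * a ∈ A := by
    intro x
    induction x using TensorAlgebra.induction with
    | algebraMap r =>
      intro a ha
      rw [AlgHom.commutes, ← Algebra.smul_def]
      exact A.smul_mem r ha
    | ι v =>
      intro a ha
      rw [toDirectSum_ι]
      exact hv v a ha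
    | mul x y hx hy =>
      intro a ha
      rw [map_mul, mul_assoc]
      exact hx _ (hy _ ha)
    | add x y hx hy =>
      intro a ha
      rw [map_add, add_mul]
      exact A.add_mem (hx _ ha) (hy _ ha)
  have := key (TensorAlgebra.ofDirectSum a) 1 one
  rwa [TensorAlgebra.toDirectSum_ofDirectSum, mul_one] at this

theorem Tens.ext_left (𝒱 : ZMod 2 → Submodule 𝕜 V) [DirectSum.Decomposition 𝒱]
    {M : Type*} [AddCommMonoid M] [Module 𝕜 M] {f g : Tens 𝕜 V →ₗ[𝕜] M} (one : f 1 = g 1)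
    (mul : ∀ i, ∀ v ∈ 𝒱 i, ∀ a, f a = g a → f (tensOf v * a) = g (tensOf v * a)) : f = g :=
  LinearMap.ext <| Tens.induction 𝒱 (fun a b ha hb => by rw [map_add, map_add, ha, hb])
    (fun c a ha => by rw [map_smul, map_smul, ha]) one mul

theorem Tens.map_mem_of_left (𝒱 : ZMod 2 → Submodule 𝕜 V) [DirectSum.Decomposition 𝒱]
    {M : Type*} [AddCommMonoid M] [Module 𝕜 M] (A : Submodule 𝕜 M) {f : Tens 𝕜 V →ₗ[𝕜] M}
    (one : f 1 ∈ A) (mul : ∀ i, ∀ v ∈ 𝒱 i, ∀ a, f a ∈ A → f (tensOf v * a) ∈ A)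
    (a : Tens 𝕜 V) : f a ∈ A :=
  Tens.induction 𝒱 (C := fun a => f a ∈ A)
    (fun a b ha hb => by rw [map_add]; exact A.add_mem ha hb)
    (fun c a ha => by rw [map_smul]; exact A.smul_mem c ha) one mul a

/-- The homogeneous elementary tensors span the tensor algebra. -/
theorem Tens.span_elem (𝒱 : ZMod 2 → Submodule 𝕜 V) [DirectSum.Decomposition 𝒱]
    {C : Tens 𝕜 V → Prop} (add : ∀ a b, C a → C b → C (a + b))
    (smul : ∀ (c : 𝕜) a, C a → C (c • a))
    (elem : ∀ (n : ℕ) (ε : Fin n → ZMod 2) (v : Fin n → V), (∀ i, v i ∈ 𝒱 (ε i)) → C (elem v))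
    (a : Tens 𝕜 V) : C a := by
  let A : Submodule 𝕜 (Tens 𝕜 V) :=
    Submodule.span 𝕜 {x | ∃ (n : ℕ) (ε : Fin n → ZMod 2) (v : Fin n → V),
      (∀ i, v i ∈ 𝒱 (ε i)) ∧ x = Weyl.elem v}
  have h : ∀ a, a ∈ A := by
    refine Tens.induction 𝒱 (fun _ _ => A.add_mem) (fun c _ => A.smul_mem c) ?_ ?_
    · exact Submodule.subset_span ⟨0, Fin.elim0, Fin.elim0, fun i => i.elim0, (elem_zero _).symm⟩
    · intro i v hv a ha
      induction ha using Submodule.span_induction with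
      | mem x hx =>
        obtain ⟨n, ε, w, hw, rfl⟩ := hx
        refine Submodule.subset_span ⟨n + 1, Fin.cons i ε, Fin.cons v w, ?_, (elem_cons v w).symm⟩
        exact Fin.cases (by simpa using hv) (by simpa using hw)
      | zero => rw [mul_zero]; exact A.zero_mem
      | add x y _ _ hx hy => rw [mul_add]; exact A.add_mem hx hy
      | smul c x _ hx => rw [mul_smul_comm]; exact A.smul_mem c hx
  induction h a using Submodule.span_induction with
  | mem x hx =>
    obtain ⟨n, ε, v, hv, rfl⟩ := hx
    exact elem n ε v hv
  | zero =>
    have := smul 0 _ (elem 0 Fin.elim0 Fin.elim0 fun i => i.elim0)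
    rwa [zero_smul] at this
  | add x y _ _ hx hy => exact add x y hx hy
  | smul c x _ hx => exact smul c x hx

/-! ### Signs and homogeneous tensors -/

theorem koszul_comm (i j : ZMod 2) : (koszul i j : 𝕜) = koszul j i := by
  simp only [koszul, and_comm]

theorem koszul_mul_self (i j : ZMod 2) : (koszul i j : 𝕜) * koszul i j = 1 := by
  unfold koszul; split_ifs <;> simp

@[simp] theorem koszul_zero_left (j : ZMod 2) : (koszul 0 j : 𝕜) = 1 := by
  simp [koszul]

@[simp] theorem koszul_zero_right (j : ZMod 2) : (koszul j 0 : 𝕜) = 1 := by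
  simp [koszul]

theorem norm_koszul (i j : ZMod 2) : ‖(koszul i j : 𝕜)‖ = 1 := by
  unfold koszul; split_ifs <;> simp

variable (𝒱 : ZMod 2 → Submodule 𝕜 V) [DirectSum.Decomposition 𝒱]

theorem parityProj_mem (i : ZMod 2) (v : V) : parityProj 𝒱 i v ∈ 𝒱 i := Submodule.coe_mem _

theorem parityProj_apply (i : ZMod 2) (v : V) :
    parityProj 𝒱 i v = (DirectSum.decompose 𝒱 v i : V) := rfl

variable {𝒱} in
theorem parityProj_of_mem {j : ZMod 2} {v : V} (hv : v ∈ 𝒱 j) (i : ZMod 2) :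
    parityProj 𝒱 i v = if i = j then v else 0 := by
  rw [parityProj_apply]
  split_ifs with h
  · subst h
    exact DirectSum.decompose_of_mem_same 𝒱 hv
  · exact DirectSum.decompose_of_mem_ne 𝒱 hv (Ne.symm h)

variable {𝒱} in
theorem multiProj_tprod {n : ℕ} {ε : Fin n → ZMod 2} {v : Fin n → V} (hv : ∀ i, v i ∈ 𝒱 (ε i))
    (η : Fin n → ZMod 2) :
    multiProj 𝒱 η (PiTensorProduct.tprod 𝕜 v) =
      if η = ε then PiTensorProduct.tprod 𝕜 v else 0 := by
  rw [multiProj, PiTensorProduct.map_tprod]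
  split_ifs with h
  · subst h
    congr 1
    funext i
    rw [parityProj_of_mem (hv i), if_pos rfl]
  · obtain ⟨i, hi⟩ := Function.ne_iff.mp h
    refine MultilinearMap.map_coord_zero _ i ?_
    rw [parityProj_of_mem (hv i), if_neg hi]

/-- The parity operator twisted by `i`: the linear map `v ↦ (-1)^{i v} v` on homogeneous `v`. -/
def signMap (i : ZMod 2) : V →ₗ[𝕜] V := ∑ j : ZMod 2, koszul (𝕜 := 𝕜) i j • parityProj 𝒱 j

variable {𝒱} in
theorem signMap_of_mem (i : ZMod 2) {j : ZMod 2} {v : V} (hv : v ∈ 𝒱 j) :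
    signMap 𝒱 i v = koszul (𝕜 := 𝕜) i j • v := by
  simp [signMap, parityProj_of_mem hv]

/-- The algebra automorphism of the tensor algebra with `v ↦ (-1)^{i v} v` on homogeneous `v`. -/
def gAut (i : ZMod 2) : Tens 𝕜 V →ₐ[𝕜] Tens 𝕜 V :=
  (TensorAlgebra.lift 𝕜 (tensOf ∘ₗ signMap 𝒱 i)).comp
    (TensorAlgebra.equivDirectSum (R := 𝕜) (M := V)).symm.toAlgHom

theorem equivDirectSum_symm_tensOf (v : V) :
    (TensorAlgebra.equivDirectSum (R := 𝕜) (M := V)).symm.toAlgHom (tensOf v) =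
      TensorAlgebra.ι 𝕜 v := by
  rw [← toDirectSum_ι]
  exact TensorAlgebra.ofDirectSum_toDirectSum _

variable {𝒱} in
theorem gAut_tensOf (i : ZMod 2) {j : ZMod 2} {v : V} (hv : v ∈ 𝒱 j) :
    gAut 𝒱 i (tensOf v) = koszul (𝕜 := 𝕜) i j • tensOf v := by
  rw [gAut, AlgHom.comp_apply, equivDirectSum_symm_tensOf, TensorAlgebra.lift_ι_apply,
    LinearMap.comp_apply, signMap_of_mem i hv, map_smul]

theorem translate_tensOf (φ : V →ₗ[𝕜] 𝕜) (v : V) :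
    translate φ (tensOf v) = tensOf v + φ v • (1 : Tens 𝕜 V) := by
  rw [translate, AlgHom.comp_apply, equivDirectSum_symm_tensOf, TensorAlgebra.lift_ι_apply]
  rfl

variable {𝒱} in
theorem gAut_elem (i : ZMod 2) {n : ℕ} {ε : Fin n → ZMod 2} {v : Fin n → V}
    (hv : ∀ i, v i ∈ 𝒱 (ε i)) :
    gAut 𝒱 i (elem v) = (∏ j, koszul (𝕜 := 𝕜) i (ε j)) • elem v := by
  induction n with
  | zero => rw [elem_zero]; simp
  | succ n ih =>
    rw [← Fin.cons_self_tail v, elem_cons, map_mul, gAut_tensOf i (hv 0),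
      ih (ε := Fin.tail ε) (v := Fin.tail v) (fun j => hv j.succ), Fin.prod_univ_succ,
      smul_mul_smul_comm]
    rfl

/-- The action of `V` on `T × T`, for `T` the tensor algebra, whose orbit of `(1, x)` consists of
the pairs `(a, F a)` for the operator `F` of `leftRec`. -/
def leftRecAction (r : V →ₗ[𝕜] Tens 𝕜 V) (g : V →ₗ[𝕜] V) :
    V →ₗ[𝕜] Module.End 𝕜 (Tens 𝕜 V × Tens 𝕜 V) :=
  LinearMap.mk₂ 𝕜 (fun w y => (tensOf w * y.1, r w * y.1 + tensOf (g w) * y.2))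
    (fun v w y => Prod.ext (by simp [add_mul]) (by
      simp only [map_add, add_mul, Prod.snd_add]
      abel))
    (fun c v y => Prod.ext (by simp) (by simp [smul_add]))
    (fun v y y' => Prod.ext (by simp [mul_add]) (by
      simp only [Prod.fst_add, mul_add, Prod.snd_add]
      abel))
    (fun c v y => Prod.ext (by simp) (by simp [smul_add]))

theorem leftRecAction_fst (r : V →ₗ[𝕜] Tens 𝕜 V) (g : V →ₗ[𝕜] V) (x : TensorAlgebra 𝕜 V)
    (y : Tens 𝕜 V × Tens 𝕜 V) :
    (TensorAlgebra.lift 𝕜 (leftRecAction r g) x y).1 = TensorAlgebra.toDirectSum x * y.1 := by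
  induction x using TensorAlgebra.induction generalizing y with
  | algebraMap c =>
    rw [AlgHom.commutes, AlgHom.commutes, ← Algebra.smul_def, Module.algebraMap_end_apply]
    rfl
  | ι v =>
    rw [TensorAlgebra.lift_ι_apply, toDirectSum_ι]
    rfl
  | mul x x' hx hx' => rw [map_mul, map_mul, Module.End.mul_apply, hx, hx', mul_assoc]
  | add x x' hx hx' =>
    rw [map_add, map_add, LinearMap.add_apply, Prod.fst_add, hx, hx', add_mul]

/-- The linear operator `F` on the tensor algebra with `F 1 = x` and
`F (w a) = r(w) a + g(w) F a` for `w` in `V`. -/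
def leftRec (x : Tens 𝕜 V) (r : V →ₗ[𝕜] Tens 𝕜 V) (g : V →ₗ[𝕜] V) :
    Tens 𝕜 V →ₗ[𝕜] Tens 𝕜 V where
  toFun a := (TensorAlgebra.lift 𝕜 (leftRecAction r g) (TensorAlgebra.ofDirectSum a) (1, x)).2
  map_add' a b := by simp
  map_smul' c a := by simp

theorem leftRec_one (x : Tens 𝕜 V) (r : V →ₗ[𝕜] Tens 𝕜 V) (g : V →ₗ[𝕜] V) :
    leftRec x r g 1 = x := by
  simp [leftRec]

theorem ofDirectSum_tensOf (v : V) :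
    TensorAlgebra.ofDirectSum (tensOf v : Tens 𝕜 V) = TensorAlgebra.ι 𝕜 v := by
  rw [← toDirectSum_ι, TensorAlgebra.ofDirectSum_toDirectSum]

theorem leftRec_mul (x : Tens 𝕜 V) (r : V →ₗ[𝕜] Tens 𝕜 V) (g : V →ₗ[𝕜] V) (w : V)
    (a : Tens 𝕜 V) :
    leftRec x r g (tensOf w * a) = r w * a + tensOf (g w) * leftRec x r g a := by
  have h := leftRecAction_fst r g (TensorAlgebra.ofDirectSum a) (1, x)
  rw [TensorAlgebra.toDirectSum_ofDirectSum, mul_one] at h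
  change (TensorAlgebra.lift 𝕜 (leftRecAction r g) _ _).2 =
    r w * a + tensOf (g w) * (TensorAlgebra.lift 𝕜 (leftRecAction r g) _ _).2
  rw [map_mul, map_mul, Module.End.mul_apply, ofDirectSum_tensOf, TensorAlgebra.lift_ι_apply]
  change r w * (TensorAlgebra.lift 𝕜 (leftRecAction r g) _ _).1 + _ = _
  rw [h]

end TensorAlgebraPart

section Symmetrizer

variable {𝕜 : Type*} [RCLike 𝕜] {V : Type*} [AddCommGroup V] [Module 𝕜 V]
variable (𝒱 : ZMod 2 → Submodule 𝕜 V) [DirectSum.Decomposition 𝒱]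

/-! ### Signed insertion of a vector -/

/-- The signed insertion of `v`, of parity `i`, at all places of a tensor: on homogeneous vectors,
`w₁ ⋯ wₙ ↦ ∑ₖ (-1)^{v (w₁ + ⋯ + wₖ)} w₁ ⋯ wₖ v wₖ₊₁ ⋯ wₙ`. -/
def insertion (i : ZMod 2) (v : V) : Tens 𝕜 V →ₗ[𝕜] Tens 𝕜 V :=
  leftRec (tensOf v) (LinearMap.mulLeft 𝕜 (tensOf v) ∘ₗ tensOf) (signMap 𝒱 i)

theorem insertion_one (i : ZMod 2) (v : V) : insertion 𝒱 i v 1 = tensOf v := leftRec_one _ _ _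

variable {𝒱}

theorem insertion_mul (i : ZMod 2) (v : V) {j : ZMod 2} {w : V} (hw : w ∈ 𝒱 j) (a : Tens 𝕜 V) :
    insertion 𝒱 i v (tensOf w * a) =
      tensOf v * (tensOf w * a) + koszul (𝕜 := 𝕜) i j • (tensOf w * insertion 𝒱 i v a) := by
  rw [insertion, leftRec_mul, signMap_of_mem i hw, map_smul, smul_mul_assoc, LinearMap.comp_apply,
    LinearMap.mulLeft_apply, mul_assoc]

theorem insertion_elem (i : ZMod 2) (v : V) {n : ℕ} {ε : Fin n → ZMod 2} {w : Fin n → V}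
    (hw : ∀ j, w j ∈ 𝒱 (ε j)) :
    insertion 𝒱 i v (elem w) = ∑ p : Fin (n + 1),
      (∏ j : Fin n, if p.succAbove j < p then koszul (𝕜 := 𝕜) i (ε j) else 1) •
        elem (p.insertNth v w : Fin (n + 1) → V) := by
  induction n with
  | zero =>
    rw [elem_zero, insertion_one, tensOf_eq_elem]
    refine Eq.symm ((Fin.sum_univ_one (M := Tens 𝕜 V) _).trans ?_)
    rw [Finset.univ_eq_empty, Finset.prod_empty, one_smul]
    congr 1
    funext j
    rw [show j = 0 from Fin.ext (by omega)]
    simp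
  | succ n ih =>
    have hcons : w = Fin.cons (w 0) (Fin.tail w) := (Fin.cons_self_tail w).symm
    conv_lhs => rw [hcons, elem_cons]
    rw [insertion_mul i v (hw 0), ih (ε := Fin.tail ε) (w := Fin.tail w) (fun j => hw j.succ)]
    conv_rhs => rw [Fin.sum_univ_succ]
    congr 1
    · rw [← elem_cons, ← hcons, ← elem_cons]
      simp
    · rw [Finset.mul_sum, Finset.smul_sum]
      refine Finset.sum_congr rfl fun p _ => ?_
      rw [mul_smul_comm, ← elem_cons, smul_smul, Fin.prod_univ_succ]
      congr 1
      · simp [Fin.tail]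
      · congr 1
        refine (Fin.insertNth_eq_iff.mpr ⟨by simp, ?_⟩).symm
        funext j
        refine Fin.cases ?_ (fun j => ?_) j
        · simp [Fin.removeNth]
        · simp [Fin.removeNth, Fin.tail]

/-! ### The recursion of the symmetrizer -/

theorem permAct_tprod {n : ℕ} {ε : Fin n → ZMod 2} {v : Fin n → V} (hv : ∀ i, v i ∈ 𝒱 (ε i))
    (σ : Equiv.Perm (Fin n)) :
    permAct 𝒱 σ (PiTensorProduct.tprod 𝕜 v) =
      permSign (𝕜 := 𝕜) ε σ • PiTensorProduct.tprod 𝕜 (v ∘ σ) := by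
  rw [permAct, LinearMap.sum_apply, Finset.sum_eq_single ε]
  · rw [LinearMap.smul_apply, LinearMap.comp_apply, multiProj_tprod hv, if_pos rfl,
      LinearEquiv.coe_coe]
    congr 1
    exact PiTensorProduct.reindex_tprod _ _
  · intro η _ hη
    rw [LinearMap.smul_apply, LinearMap.comp_apply, multiProj_tprod hv, if_neg hη, map_zero,
      smul_zero]
  · simp

theorem symmetrizer_elem {n : ℕ} {ε : Fin n → ZMod 2} {v : Fin n → V} (hv : ∀ i, v i ∈ 𝒱 (ε i)) :
    symmetrizer 𝒱 (elem v) = (n.factorial : 𝕜)⁻¹ • ∑ σ : Equiv.Perm (Fin n),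
      permSign (𝕜 := 𝕜) ε σ • (elem (v ∘ σ) : Tens 𝕜 V) := by
  rw [elem, symmetrizer, DirectSum.lmap_lof, symmetrizerPow, LinearMap.smul_apply, map_smul,
    LinearMap.sum_apply, map_sum]
  congr 1
  refine Finset.sum_congr rfl fun σ _ => ?_
  rw [permAct_tprod hv, map_smul, elem]

/-- The permutation of `n + 1` letters that sends `p` to `0` and is `σ` on the other letters. -/
def insertPerm {n : ℕ} (p : Fin (n + 1)) (σ : Equiv.Perm (Fin n)) : Equiv.Perm (Fin (n + 1)) :=
  (finSuccEquiv' p).trans ((Equiv.optionCongr σ).trans (finSuccEquiv' 0).symm)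

theorem insertPerm_same {n : ℕ} (p : Fin (n + 1)) (σ : Equiv.Perm (Fin n)) :
    insertPerm p σ p = 0 := by
  simp [insertPerm]

theorem insertPerm_succAbove {n : ℕ} (p : Fin (n + 1)) (σ : Equiv.Perm (Fin n)) (i : Fin n) :
    insertPerm p σ (p.succAbove i) = (σ i).succ := by
  simp [insertPerm]

theorem insertPerm_bijective (n : ℕ) :
    Function.Bijective fun x : Fin (n + 1) × Equiv.Perm (Fin n) => insertPerm x.1 x.2 := by
  rw [Fintype.bijective_iff_injective_and_card]
  refine ⟨?_, ?_⟩
  · rintro ⟨p, σ⟩ ⟨q, τ⟩ h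
    have h' : insertPerm p σ = insertPerm q τ := h
    have hpq : p = q := by
      apply (insertPerm q τ).injective
      rw [insertPerm_same, ← h', insertPerm_same]
    subst hpq
    refine Prod.ext rfl (Equiv.ext fun i => ?_)
    have := DFunLike.congr_fun h' (p.succAbove i)
    rw [insertPerm_succAbove, insertPerm_succAbove] at this
    exact Fin.succ_injective _ this
  · simp [Fintype.card_perm, Nat.factorial_succ]

theorem permSign_insertPerm {n : ℕ} (ε : Fin (n + 1) → ZMod 2) (p : Fin (n + 1))
    (σ : Equiv.Perm (Fin n)) :
    (permSign ε (insertPerm p σ) : 𝕜) =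
      (∏ j : Fin n, if p.succAbove j < p then koszul (𝕜 := 𝕜) (ε 0) (ε (σ j).succ) else 1) *
        permSign (𝕜 := 𝕜) (Fin.tail ε) σ := by
  rw [permSign, Fin.prod_univ_succAbove _ p]
  rw [Finset.prod_eq_one fun j _ => if_neg fun h => by
    rw [insertPerm_same] at h
    exact (Fin.not_lt_zero _) h.2, one_mul, permSign, ← Finset.prod_mul_distrib]
  refine Finset.prod_congr rfl fun i _ => ?_
  rw [Fin.prod_univ_succAbove _ p]
  congr 1
  · simp only [insertPerm_same, insertPerm_succAbove, Fin.succ_pos, and_true]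
    rw [koszul_comm]
  · refine Finset.prod_congr rfl fun j _ => ?_
    simp only [insertPerm_succAbove, Fin.succ_lt_succ_iff, Fin.succAbove_lt_succAbove_iff]
    rfl

omit [AddCommGroup V] in
theorem comp_insertPerm {n : ℕ} (v : V) (w : Fin n → V) (p : Fin (n + 1))
    (σ : Equiv.Perm (Fin n)) :
    (Fin.cons v w : Fin (n + 1) → V) ∘ insertPerm p σ =
      (p.insertNth v (w ∘ σ) : Fin (n + 1) → V) := by
  refine (Fin.insertNth_eq_iff.mpr ⟨?_, ?_⟩).symm
  · simp [insertPerm_same]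
  · funext j
    simp [Fin.removeNth, insertPerm_succAbove]

/-- The symmetrizer is determined by a recursion in the degree: up to the factor `n + 1`, the
symmetrization of `v a` for `a` of degree `n` is the insertion of `v` into the symmetrization
of `a`. It comes from sorting the permutations by the place of the first letter. -/
theorem symmetrizer_mul_elem {i : ZMod 2} {v : V} (hv : v ∈ 𝒱 i) {n : ℕ} {ε : Fin n → ZMod 2}
    {w : Fin n → V} (hw : ∀ j, w j ∈ 𝒱 (ε j)) :
    symmetrizer 𝒱 (tensOf v * elem w) =
      ((n + 1 : ℕ) : 𝕜)⁻¹ • insertion 𝒱 i v (symmetrizer 𝒱 (elem w)) := by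
  have hvw : ∀ j, (Fin.cons v w : Fin (n + 1) → V) j ∈
      𝒱 ((Fin.cons i ε : Fin (n + 1) → ZMod 2) j) :=
    Fin.cases (by simpa using hv) (by simpa using hw)
  rw [← elem_cons, symmetrizer_elem hvw, symmetrizer_elem hw, map_smul, smul_smul,
    Nat.factorial_succ, Nat.cast_mul, mul_inv]
  congr 1
  rw [← (insertPerm_bijective n).sum_comp, Fintype.sum_prod_type_right, map_sum]
  refine Finset.sum_congr rfl fun σ _ => ?_
  rw [map_smul, insertion_elem (ε := ε ∘ σ) (w := w ∘ σ) i v (fun j => hw (σ j)), Finset.smul_sum]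
  refine Finset.sum_congr rfl fun p _ => ?_
  rw [permSign_insertPerm, comp_insertPerm, smul_smul, mul_comm]
  rfl

end Symmetrizer

section SymIdeal

variable {𝕜 : Type*} [RCLike 𝕜] {V : Type*} [AddCommGroup V] [Module 𝕜 V]
variable (𝒱 : ZMod 2 → Submodule 𝕜 V) [DirectSum.Decomposition 𝒱]

/-! ### The ideal of the graded commutators -/

theorem lmap_smul_lof (c : ℕ → 𝕜) (n : ℕ) (x : ⨂[𝕜]^n V) :
    DirectSum.lmap (fun n => c n • (LinearMap.id : (⨂[𝕜]^n V) →ₗ[𝕜] _))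
      (DirectSum.lof 𝕜 ℕ (fun n => ⨂[𝕜]^n V) n x) =
      c n • DirectSum.lof 𝕜 ℕ (fun n => ⨂[𝕜]^n V) n x := by
  rw [DirectSum.lmap_lof, LinearMap.smul_apply, map_smul, LinearMap.id_apply]

/-- The operator `N + 1`, where `N` multiplies a tensor by its degree. -/
def degSucc : Tens 𝕜 V →ₗ[𝕜] Tens 𝕜 V :=
  DirectSum.lmap fun n => ((n + 1 : ℕ) : 𝕜) • LinearMap.id

/-- The inverse of the operator `N + 1`. -/
def degSuccInv : Tens 𝕜 V →ₗ[𝕜] Tens 𝕜 V :=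
  DirectSum.lmap fun n => ((n + 1 : ℕ) : 𝕜)⁻¹ • LinearMap.id

theorem degSucc_lof (n : ℕ) (x : ⨂[𝕜]^n V) :
    degSucc (DirectSum.lof 𝕜 ℕ (fun n => ⨂[𝕜]^n V) n x) =
      ((n + 1 : ℕ) : 𝕜) • DirectSum.lof 𝕜 ℕ (fun n => ⨂[𝕜]^n V) n x :=
  lmap_smul_lof (fun n => ((n + 1 : ℕ) : 𝕜)) n x

theorem degSuccInv_lof (n : ℕ) (x : ⨂[𝕜]^n V) :
    degSuccInv (DirectSum.lof 𝕜 ℕ (fun n => ⨂[𝕜]^n V) n x) =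
      ((n + 1 : ℕ) : 𝕜)⁻¹ • DirectSum.lof 𝕜 ℕ (fun n => ⨂[𝕜]^n V) n x :=
  lmap_smul_lof (fun n => ((n + 1 : ℕ) : 𝕜)⁻¹) n x

theorem degSucc_degSuccInv (a : Tens 𝕜 V) : degSucc (degSuccInv a) = a := by
  refine LinearMap.congr_fun (f := degSucc ∘ₗ degSuccInv) (g := LinearMap.id) ?_ a
  refine DirectSum.linearMap_ext _ fun n => LinearMap.ext fun x => ?_
  have : ((n + 1 : ℕ) : 𝕜) ≠ 0 := Nat.cast_ne_zero.mpr n.succ_ne_zero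
  rw [LinearMap.comp_apply, LinearMap.comp_apply, degSuccInv_lof, map_smul, degSucc_lof,
    inv_smul_smul₀ this]
  rfl

theorem degSuccInv_degSucc (a : Tens 𝕜 V) : degSuccInv (degSucc a) = a := by
  refine LinearMap.congr_fun (f := degSuccInv ∘ₗ degSucc) (g := LinearMap.id) ?_ a
  refine DirectSum.linearMap_ext _ fun n => LinearMap.ext fun x => ?_
  have : ((n + 1 : ℕ) : 𝕜) ≠ 0 := Nat.cast_ne_zero.mpr n.succ_ne_zero
  rw [LinearMap.comp_apply, LinearMap.comp_apply, degSucc_lof, map_smul, degSuccInv_lof,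
    smul_inv_smul₀ this]
  rfl

theorem symmetrizer_lof_eq (n : ℕ) (x : ⨂[𝕜]^n V) :
    symmetrizer 𝒱 (DirectSum.lof 𝕜 ℕ (fun n => ⨂[𝕜]^n V) n x) =
      DirectSum.lof 𝕜 ℕ (fun n => ⨂[𝕜]^n V) n (symmetrizerPow 𝒱 n x) := by
  rw [symmetrizer, DirectSum.lmap_lof]

theorem degSucc_symmetrizer (a : Tens 𝕜 V) :
    degSucc (symmetrizer 𝒱 a) = symmetrizer 𝒱 (degSucc a) := by
  refine LinearMap.congr_fun (f := degSucc ∘ₗ symmetrizer 𝒱) (g := symmetrizer 𝒱 ∘ₗ degSucc) ?_ a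
  refine DirectSum.linearMap_ext _ fun n => LinearMap.ext fun x => ?_
  simp only [LinearMap.comp_apply, symmetrizer_lof_eq, degSucc_lof, map_smul]

theorem degSucc_one : degSucc (1 : Tens 𝕜 V) = 1 := by
  have := degSucc_lof (𝕜 := 𝕜) (V := V) 0 (PiTensorProduct.tprod 𝕜 Fin.elim0)
  rw [← elem_def, elem_zero] at this
  simpa using this

theorem degSucc_elem {n : ℕ} (v : Fin n → V) :
    degSucc (elem v : Tens 𝕜 V) = ((n + 1 : ℕ) : 𝕜) • elem v := degSucc_lof _ _

variable {𝒱}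

theorem degSucc_mul (v : V) (a : Tens 𝕜 V) :
    degSucc (tensOf v * a) = tensOf v * degSucc a + tensOf v * a := by
  refine LinearMap.congr_fun (f := degSucc ∘ₗ LinearMap.mulLeft 𝕜 (tensOf v))
    (g := LinearMap.mulLeft 𝕜 (tensOf v) ∘ₗ degSucc + LinearMap.mulLeft 𝕜 (tensOf v)) ?_ a
  refine DirectSum.linearMap_ext _ fun n => PiTensorProduct.ext (MultilinearMap.ext fun w => ?_)
  change degSucc (tensOf v * elem w) = tensOf v * degSucc (elem w) + tensOf v * elem w
  rw [← elem_cons, degSucc_elem, degSucc_elem, mul_smul_comm, ← elem_cons]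
  push_cast
  module

/-- `S(v a)` is the average of the insertions of `v` at the `N + 1` places of `S(a)`, where `N` is
the degree of `a`. -/
theorem symmetrizer_mul {i : ZMod 2} {v : V} (hv : v ∈ 𝒱 i) (a : Tens 𝕜 V) :
    symmetrizer 𝒱 (tensOf v * a) = insertion 𝒱 i v (degSuccInv (symmetrizer 𝒱 a)) := by
  induction a using Tens.span_elem 𝒱 with
  | add a b ha hb => rw [mul_add, map_add, ha, hb, map_add, map_add, map_add]
  | smul c a ha => rw [mul_smul_comm, map_smul, ha, map_smul, map_smul, map_smul]
  | elem n ε w hw =>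
    rw [symmetrizer_mul_elem hv hw, elem_def, symmetrizer_lof_eq, degSuccInv_lof, map_smul]

theorem insertion_symmetrizer {i : ZMod 2} {v : V} (hv : v ∈ 𝒱 i) (a : Tens 𝕜 V) :
    insertion 𝒱 i v (symmetrizer 𝒱 a) = symmetrizer 𝒱 (tensOf v * degSucc a) := by
  rw [symmetrizer_mul hv, ← degSucc_symmetrizer, degSuccInv_degSucc]

theorem symmetrizer_one : symmetrizer 𝒱 (1 : Tens 𝕜 V) = 1 := symmetrizer_lof 𝒱 zero_le_one _

theorem symmetrizer_tensOf (v : V) : symmetrizer 𝒱 (tensOf v : Tens 𝕜 V) = tensOf v :=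
  symmetrizer_lof 𝒱 le_rfl _

/-- Insertions of homogeneous vectors commute up to the Koszul sign. -/
theorem insertion_insertion {i j : ZMod 2} {u w : V} (hu : u ∈ 𝒱 i) (hw : w ∈ 𝒱 j)
    (a : Tens 𝕜 V) :
    insertion 𝒱 i u (insertion 𝒱 j w a) =
      koszul (𝕜 := 𝕜) i j • insertion 𝒱 j w (insertion 𝒱 i u a) := by
  refine LinearMap.congr_fun (f := insertion 𝒱 i u ∘ₗ insertion 𝒱 j w)
    (g := koszul (𝕜 := 𝕜) i j • insertion 𝒱 j w ∘ₗ insertion 𝒱 i u)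
    (Tens.ext_left 𝒱 ?_ fun k x hx a h => ?_) a
  · simp only [LinearMap.comp_apply, LinearMap.smul_apply, insertion_one]
    rw [← mul_one (tensOf w), ← mul_one (tensOf u), insertion_mul _ _ hw, insertion_mul _ _ hu,
      insertion_one, insertion_one]
    rw [smul_add, smul_smul, koszul_comm j i, koszul_mul_self, one_smul, add_comm]
    simp only [mul_one]
  · simp only [LinearMap.comp_apply, LinearMap.smul_apply] at h ⊢
    simp only [insertion_mul _ _ hx, insertion_mul _ _ hu, insertion_mul _ _ hw, map_add, map_smul,
      h, mul_add, mul_smul_comm, koszul_comm j i]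
    have h1 := koszul_mul_self (𝕜 := 𝕜) i j
    linear_combination (norm := module) -(h1 • (tensOf u * (tensOf w * (tensOf x * a)))) -
      koszul (𝕜 := 𝕜) j k • h1 • (tensOf u * (tensOf x * insertion 𝒱 j w a))

/-- The graded commutator `u w - (-1)^{u w} w u` of two vectors of parity `i` and `j`, multiplied
from the right by `c`. -/
def gradedComm (i j : ZMod 2) (u w : V) (c : Tens 𝕜 V) : Tens 𝕜 V :=
  tensOf u * (tensOf w * c) - koszul (𝕜 := 𝕜) i j • (tensOf w * (tensOf u * c))

variable (𝒱) in
/-- The span of the graded commutators `(u w - (-1)^{u w} w u) c`. -/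
def commSpan : Submodule 𝕜 (Tens 𝕜 V) :=
  Submodule.span 𝕜 {x | ∃ i j, ∃ u ∈ 𝒱 i, ∃ w ∈ 𝒱 j, ∃ c, x = gradedComm i j u w c}

variable (𝒱) in
/-- The ideal of the tensor algebra generated by the graded commutators
`u w - (-1)^{u w} w u` of homogeneous vectors. -/
def symIdeal : Submodule 𝕜 (Tens 𝕜 V) :=
  Submodule.span 𝕜 {x | ∃ a, ∃ r ∈ commSpan 𝒱, x = a * r}

omit [DirectSum.Decomposition 𝒱] in
theorem gradedComm_mem_commSpan {i j : ZMod 2} {u w : V} (hu : u ∈ 𝒱 i) (hw : w ∈ 𝒱 j)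
    (c : Tens 𝕜 V) : gradedComm i j u w c ∈ commSpan 𝒱 :=
  Submodule.subset_span ⟨i, j, u, hu, w, hw, c, rfl⟩

omit [DirectSum.Decomposition 𝒱] in
theorem mul_mem_symIdeal (a : Tens 𝕜 V) {x : Tens 𝕜 V} (hx : x ∈ symIdeal 𝒱) :
    a * x ∈ symIdeal 𝒱 := by
  induction hx using Submodule.span_induction with
  | mem x hx =>
    obtain ⟨b, r, hr, rfl⟩ := hx
    exact Submodule.subset_span ⟨a * b, r, hr, (mul_assoc _ _ _).symm⟩
  | zero => rw [mul_zero]; exact zero_mem _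
  | add x y _ _ hx hy => rw [mul_add]; exact add_mem hx hy
  | smul c x _ hx => rw [mul_smul_comm]; exact Submodule.smul_mem _ c hx

omit [DirectSum.Decomposition 𝒱] in
theorem commSpan_le_symIdeal : commSpan 𝒱 ≤ symIdeal 𝒱 := fun r hr =>
  Submodule.subset_span ⟨1, r, hr, (one_mul r).symm⟩

omit [DirectSum.Decomposition 𝒱] in
theorem gradedComm_mem_symIdeal {i j : ZMod 2} {u w : V} (hu : u ∈ 𝒱 i) (hw : w ∈ 𝒱 j)
    (c : Tens 𝕜 V) : gradedComm i j u w c ∈ symIdeal 𝒱 :=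
  commSpan_le_symIdeal (gradedComm_mem_commSpan hu hw c)

theorem symmetrizer_gradedComm {i j : ZMod 2} {u w : V} (hu : u ∈ 𝒱 i) (hw : w ∈ 𝒱 j)
    (c : Tens 𝕜 V) : symmetrizer 𝒱 (gradedComm i j u w c) = 0 := by
  have key : ∀ {i j : ZMod 2} {u w : V}, u ∈ 𝒱 i → w ∈ 𝒱 j → ∀ (n : ℕ) (ε : Fin n → ZMod 2)
      (v : Fin n → V), (∀ k, v k ∈ 𝒱 (ε k)) →
      symmetrizer 𝒱 (tensOf u * (tensOf w * elem v)) =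
        (((n + 1 + 1 : ℕ) : 𝕜)⁻¹ * ((n + 1 : ℕ) : 𝕜)⁻¹) •
          insertion 𝒱 i u (insertion 𝒱 j w (symmetrizer 𝒱 (elem v))) := by
    intro i j u w hu hw n ε v hv
    have hwv : ∀ k, (Fin.cons w v : Fin (n + 1) → V) k ∈
        𝒱 ((Fin.cons j ε : Fin (n + 1) → ZMod 2) k) :=
      Fin.cases (by simpa using hw) (by simpa using hv)
    rw [← elem_cons, symmetrizer_mul_elem hu hwv, elem_cons, symmetrizer_mul_elem hw hv, map_smul,
      smul_smul]
  induction c using Tens.span_elem 𝒱 with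
  | add a b ha hb =>
    have : gradedComm i j u w (a + b) = gradedComm i j u w a + gradedComm i j u w b := by
      simp only [gradedComm, mul_add, smul_add]
      abel
    rw [this, map_add, ha, hb, add_zero]
  | smul c a ha =>
    have : gradedComm i j u w (c • a) = c • gradedComm i j u w a := by
      simp only [gradedComm, mul_smul_comm, smul_sub, smul_comm c]
    rw [this, map_smul, ha, smul_zero]
  | elem n ε v hv =>
    rw [gradedComm, map_sub, map_smul, key hu hw n ε v hv, key hw hu n ε v hv,
      insertion_insertion hu hw, smul_comm (koszul i j : 𝕜), sub_self]

theorem symmetrizer_eq_zero_of_mem {x : Tens 𝕜 V} (hx : x ∈ symIdeal 𝒱) :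
    symmetrizer 𝒱 x = 0 := by
  have h1 : commSpan 𝒱 ≤ LinearMap.ker (symmetrizer 𝒱) := by
    refine Submodule.span_le.mpr ?_
    rintro _ ⟨i, j, u, hu, w, hw, c, rfl⟩
    exact symmetrizer_gradedComm hu hw c
  have h2 : symIdeal 𝒱 ≤ LinearMap.ker (symmetrizer 𝒱) := by
    refine Submodule.span_le.mpr ?_
    rintro _ ⟨a, r, hr, rfl⟩
    change symmetrizer 𝒱 (a * r) = 0
    refine LinearMap.congr_fun (f := symmetrizer 𝒱 ∘ₗ LinearMap.mulRight 𝕜 r) (g := 0)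
      (Tens.ext_left 𝒱 ?_ fun i v hv a h => ?_) a
    · simpa using h1 hr
    · simp only [LinearMap.comp_apply, LinearMap.mulRight_apply, LinearMap.zero_apply] at h ⊢
      rw [mul_assoc, symmetrizer_mul hv, h, map_zero, map_zero]
  exact h2 hx

/-- Modulo the graded commutators, a vector can be moved to the front, so that its `N + 1`
insertions into a tensor of degree `N` all agree. -/
theorem insertion_sub_mem {i : ZMod 2} {v : V} (hv : v ∈ 𝒱 i) (a : Tens 𝕜 V) :
    insertion 𝒱 i v a - tensOf v * degSucc a ∈ symIdeal 𝒱 := by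
  refine Tens.map_mem_of_left 𝒱 (symIdeal 𝒱)
    (f := insertion 𝒱 i v - LinearMap.mulLeft 𝕜 (tensOf v) ∘ₗ degSucc) ?_ ?_ a
  · simp [insertion_one, degSucc_one]
  · intro j w hw a h
    simp only [LinearMap.sub_apply, LinearMap.comp_apply, LinearMap.mulLeft_apply] at h ⊢
    have h1 := Submodule.smul_mem _ (koszul (𝕜 := 𝕜) i j) (mul_mem_symIdeal (tensOf w) h)
    have h2 := sub_mem h1 (gradedComm_mem_symIdeal hv hw (degSucc a))
    convert h2 using 1
    rw [insertion_mul _ _ hw, degSucc_mul, gradedComm, Tens.mul_sub, mul_add]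
    module

/-- The symmetrizer is the identity modulo the graded commutators. -/
theorem symmetrizer_sub_mem (a : Tens 𝕜 V) : symmetrizer 𝒱 a - a ∈ symIdeal 𝒱 := by
  refine Tens.map_mem_of_left 𝒱 (symIdeal 𝒱) (f := symmetrizer 𝒱 - LinearMap.id) ?_ ?_ a
  · simp [symmetrizer_one]
  · intro j v hv a h
    simp only [LinearMap.sub_apply, LinearMap.id_apply] at h ⊢
    have h1 := insertion_sub_mem hv (degSuccInv (symmetrizer 𝒱 a))
    rw [degSucc_degSuccInv, ← symmetrizer_mul hv] at h1
    have h2 := add_mem h1 (mul_mem_symIdeal (tensOf v) h)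
    rwa [Tens.mul_sub, sub_add_sub_cancel] at h2

/-- The kernel of the symmetrizer is the ideal generated by the graded commutators: symmetric
tensors are a model of the free graded commutative algebra. -/
theorem symmetrizer_eq_zero_iff {x : Tens 𝕜 V} : symmetrizer 𝒱 x = 0 ↔ x ∈ symIdeal 𝒱 := by
  refine ⟨fun h => ?_, symmetrizer_eq_zero_of_mem⟩
  have := neg_mem (symmetrizer_sub_mem (𝒱 := 𝒱) x)
  rwa [h, zero_sub, neg_neg] at this

theorem symmetrizer_symmetrizer (a : Tens 𝕜 V) :
    symmetrizer 𝒱 (symmetrizer 𝒱 a) = symmetrizer 𝒱 a := by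
  rw [← sub_eq_zero, ← map_sub]
  exact symmetrizer_eq_zero_of_mem (symmetrizer_sub_mem a)

theorem symmetrizer_eq_iff {x y : Tens 𝕜 V} :
    symmetrizer 𝒱 x = symmetrizer 𝒱 y ↔ x - y ∈ symIdeal 𝒱 := by
  rw [← symmetrizer_eq_zero_iff, map_sub, sub_eq_zero]

theorem mem_symTens_iff {x : Tens 𝕜 V} : x ∈ symTens 𝒱 ↔ symmetrizer 𝒱 x = x := by
  refine ⟨?_, fun h => ⟨x, h⟩⟩
  rintro ⟨y, rfl⟩
  exact symmetrizer_symmetrizer y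

end SymIdeal

section Contraction

variable {𝕜 : Type*} [RCLike 𝕜] {V : Type*} [AddCommGroup V] [Module 𝕜 V]
variable (𝒱 : ZMod 2 → Submodule 𝕜 V) [DirectSum.Decomposition 𝒱]

/-! ### Contractions with functionals and the recursion of `P_Λ` -/

theorem extract_tprod (n : ℕ) (k : Fin (n + 1)) (v : Fin (n + 1) → V) :
    extract (𝕜 := 𝕜) n k (PiTensorProduct.tprod 𝕜 v) =
      PiTensorProduct.tprod 𝕜 (k.removeNth v) ⊗ₜ v k := by
  rw [extract, PiTensorProduct.lift.tprod, LinearMap.uncurryMid_apply]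
  rfl

theorem pullLeft_elem_zero (v : Fin 0 → V) : pullLeft 𝒱 (elem v : Tens 𝕜 V) = 0 := by
  rw [elem, pullLeft, DirectSum.toModule_lof]
  rfl

theorem pullRight_elem_zero (v : Fin 0 → V) : pullRight 𝒱 (elem v : Tens 𝕜 V) = 0 := by
  rw [elem, pullRight, DirectSum.toModule_lof]
  rfl

theorem pullLeft_elem_eq {n : ℕ} (v : Fin (n + 1) → V) :
    pullLeft 𝒱 (elem v : Tens 𝕜 V) = ∑ k : Fin (n + 1), ∑ η : Fin (n + 1) → ZMod 2,
      (∏ j ∈ Finset.Iio k, koszul (𝕜 := 𝕜) (η k) (η j)) •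
        (elem (k.removeNth fun j => parityProj 𝒱 (η j) (v j)) ⊗ₜ[𝕜] parityProj 𝒱 (η k) (v k)) := by
  rw [elem, pullLeft, DirectSum.toModule_lof, pullLeftPow]
  simp only [LinearMap.sum_apply, LinearMap.smul_apply, LinearMap.comp_apply, multiProj,
    PiTensorProduct.map_tprod, extract_tprod, LinearMap.rTensor_tmul, elem_def]

theorem pullRight_elem_eq {n : ℕ} (v : Fin (n + 1) → V) :
    pullRight 𝒱 (elem v : Tens 𝕜 V) = ∑ k : Fin (n + 1), ∑ η : Fin (n + 1) → ZMod 2,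
      (∏ j ∈ Finset.Ioi k, koszul (𝕜 := 𝕜) (η k) (η j)) •
        (elem (k.removeNth fun j => parityProj 𝒱 (η j) (v j)) ⊗ₜ[𝕜] parityProj 𝒱 (η k) (v k)) := by
  rw [elem, pullRight, DirectSum.toModule_lof, pullRightPow]
  simp only [LinearMap.sum_apply, LinearMap.smul_apply, LinearMap.comp_apply, multiProj,
    PiTensorProduct.map_tprod, extract_tprod, LinearMap.rTensor_tmul, elem_def]

variable {𝒱}

theorem sum_parity_eq_single {n : ℕ} {ε : Fin (n + 1) → ZMod 2} {v : Fin (n + 1) → V}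
    (hv : ∀ i, v i ∈ 𝒱 (ε i)) (c : (Fin (n + 1) → ZMod 2) → 𝕜) (k : Fin (n + 1)) :
    ∑ η : Fin (n + 1) → ZMod 2, c η •
      ((elem (k.removeNth fun j => parityProj 𝒱 (η j) (v j)) : Tens 𝕜 V) ⊗ₜ[𝕜]
        parityProj 𝒱 (η k) (v k)) = c ε • ((elem (k.removeNth v) : Tens 𝕜 V) ⊗ₜ[𝕜] v k) := by
  rw [Finset.sum_eq_single ε]
  · simp only [parityProj_of_mem (hv _), if_true]
  · intro η _ hη
    obtain ⟨i, hi⟩ := Function.ne_iff.mp hη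
    have h0 : parityProj 𝒱 (η i) (v i) = 0 := by rw [parityProj_of_mem (hv i), if_neg hi]
    rcases Fin.eq_self_or_eq_succAbove k i with rfl | ⟨j, rfl⟩
    · rw [h0, TensorProduct.tmul_zero, smul_zero]
    · have : (elem (k.removeNth fun j => parityProj 𝒱 (η j) (v j)) : Tens 𝕜 V) = 0 := by
        rw [elem, MultilinearMap.map_coord_zero _ j h0, map_zero]
      rw [this, TensorProduct.zero_tmul, smul_zero]
  · simp

theorem pullLeft_elem {n : ℕ} {ε : Fin (n + 1) → ZMod 2} {v : Fin (n + 1) → V}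
    (hv : ∀ i, v i ∈ 𝒱 (ε i)) :
    pullLeft 𝒱 (elem v : Tens 𝕜 V) = ∑ k : Fin (n + 1),
      (∏ j ∈ Finset.Iio k, koszul (𝕜 := 𝕜) (ε k) (ε j)) • (elem (k.removeNth v) ⊗ₜ[𝕜] v k) := by
  rw [pullLeft_elem_eq]
  exact Finset.sum_congr rfl fun k _ => sum_parity_eq_single hv _ k

theorem pullRight_elem {n : ℕ} {ε : Fin (n + 1) → ZMod 2} {v : Fin (n + 1) → V}
    (hv : ∀ i, v i ∈ 𝒱 (ε i)) :
    pullRight 𝒱 (elem v : Tens 𝕜 V) = ∑ k : Fin (n + 1),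
      (∏ j ∈ Finset.Ioi k, koszul (𝕜 := 𝕜) (ε k) (ε j)) • (elem (k.removeNth v) ⊗ₜ[𝕜] v k) := by
  rw [pullRight_elem_eq]
  exact Finset.sum_congr rfl fun k _ => sum_parity_eq_single hv _ k

theorem prod_Iio_eq {n : ℕ} (k : Fin n) (f : Fin n → 𝕜) :
    ∏ j ∈ Finset.Iio k, f j = ∏ j, if j < k then f j else 1 := by
  rw [← Finset.prod_filter]
  congr 1
  ext j
  simp

theorem prod_Ioi_eq {n : ℕ} (k : Fin n) (f : Fin n → 𝕜) :
    ∏ j ∈ Finset.Ioi k, f j = ∏ j, if k < j then f j else 1 := by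
  rw [← Finset.prod_filter]
  congr 1
  ext j
  simp

omit [AddCommGroup V] in
theorem removeNth_succ_cons {n : ℕ} (k : Fin (n + 1)) (v : V) (w : Fin (n + 1) → V) :
    k.succ.removeNth (Fin.cons v w : Fin (n + 2) → V) =
      (Fin.cons v (k.removeNth w) : Fin (n + 1) → V) := by
  funext j
  refine Fin.cases ?_ (fun j => ?_) j <;> simp [Fin.removeNth]

omit [AddCommGroup V] in
theorem removeNth_zero_cons {n : ℕ} (v : V) (w : Fin n → V) :
    (0 : Fin (n + 1)).removeNth (Fin.cons v w : Fin (n + 1) → V) = w := by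
  funext j
  simp [Fin.removeNth]

variable (𝒱) in
/-- The contraction with a functional, from the left: on homogeneous vectors,
`w₁ ⋯ wₘ ↦ ∑ₗ (-1)^{wₗ (w₁ + ⋯ + wₗ₋₁)} f(wₗ) w₁ ⋯ ŵₗ ⋯ wₘ`. -/
def contr (f : V →ₗ[𝕜] 𝕜) : Tens 𝕜 V →ₗ[𝕜] Tens 𝕜 V :=
  (TensorProduct.rid 𝕜 (Tens 𝕜 V)).toLinearMap ∘ₗ f.lTensor (Tens 𝕜 V) ∘ₗ pullLeft 𝒱

variable (𝒱) in
/-- A functional is homogeneous of parity `i` if it vanishes on the vectors of the other parity. -/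
def IsHomFunctional (f : V →ₗ[𝕜] 𝕜) (i : ZMod 2) : Prop := ∀ j, i ≠ j → ∀ v ∈ 𝒱 j, f v = 0

omit [DirectSum.Decomposition 𝒱] in
theorem IsEvenForm.isHomFunctional {Λ : V →ₗ[𝕜] V →ₗ[𝕜] 𝕜} (hΛ : IsEvenForm 𝒱 Λ) {i : ZMod 2}
    {v : V} (hv : v ∈ 𝒱 i) : IsHomFunctional 𝒱 (Λ v) i := fun j hij w hw => hΛ i j hij v hv w hw

theorem contr_one (f : V →ₗ[𝕜] 𝕜) : contr 𝒱 f 1 = 0 := by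
  rw [← elem_zero (𝕜 := 𝕜) (Fin.elim0 : Fin 0 → V), contr, LinearMap.comp_apply,
    LinearMap.comp_apply, pullLeft_elem_zero, map_zero, map_zero]

theorem contr_elem (f : V →ₗ[𝕜] 𝕜) {n : ℕ} {ε : Fin (n + 1) → ZMod 2} {v : Fin (n + 1) → V}
    (hv : ∀ i, v i ∈ 𝒱 (ε i)) :
    contr 𝒱 f (elem v) = ∑ k : Fin (n + 1),
      ((∏ j ∈ Finset.Iio k, koszul (𝕜 := 𝕜) (ε k) (ε j)) * f (v k)) • elem (k.removeNth v) := by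
  rw [contr, LinearMap.comp_apply, LinearMap.comp_apply, pullLeft_elem hv, map_sum, map_sum]
  refine Finset.sum_congr rfl fun k _ => ?_
  simp [smul_smul]

omit [DirectSum.Decomposition 𝒱] in
theorem IsHomFunctional.koszul_mul_apply {f : V →ₗ[𝕜] 𝕜} {i j : ZMod 2} (hf : IsHomFunctional 𝒱 f i)
    {v : V} (hv : v ∈ 𝒱 j) (k : ZMod 2) :
    (koszul j k : 𝕜) * f v = koszul i k * f v := by
  by_cases h : i = j
  · rw [h]
  · rw [hf j h v hv, mul_zero, mul_zero]

theorem contr_tensOf_mul {f : V →ₗ[𝕜] 𝕜} {i j : ZMod 2} (hf : IsHomFunctional 𝒱 f i) {w : V}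
    (hw : w ∈ 𝒱 j) (a : Tens 𝕜 V) :
    contr 𝒱 f (tensOf w * a) = f w • a + koszul (𝕜 := 𝕜) i j • (tensOf w * contr 𝒱 f a) := by
  induction a using Tens.span_elem 𝒱 with
  | add a b ha hb =>
    rw [mul_add, map_add, ha, hb, map_add, mul_add]
    module
  | smul c a ha =>
    rw [mul_smul_comm, map_smul, ha, map_smul, mul_smul_comm]
    module
  | elem n ε v hv =>
    have hwv : ∀ k, (Fin.cons w v : Fin (n + 1) → V) k ∈
        𝒱 ((Fin.cons j ε : Fin (n + 1) → ZMod 2) k) :=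
      Fin.cases (by simpa using hw) (by simpa using hv)
    rw [← elem_cons, contr_elem f hwv, Fin.sum_univ_succ]
    congr 1
    · rw [removeNth_zero_cons, prod_Iio_eq]
      simp
    · cases n with
      | zero => rw [elem_zero, contr_one]; simp
      | succ n =>
        rw [contr_elem f hv, Finset.mul_sum, Finset.smul_sum]
        refine Finset.sum_congr rfl fun k _ => ?_
        rw [removeNth_succ_cons, elem_cons, mul_smul_comm, smul_smul, prod_Iio_eq, prod_Iio_eq,
          Fin.prod_univ_succ]
        congr 1
        simp only [Fin.cons_zero, Fin.cons_succ, Fin.succ_pos, if_true, Fin.succ_lt_succ_iff]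
        have := hf.koszul_mul_apply (hv k) j
        linear_combination (∏ x, if x < k then koszul (𝕜 := 𝕜) (ε k) (ε x) else 1) * this

theorem pullRight_one : pullRight 𝒱 (1 : Tens 𝕜 V) = 0 := by
  rw [← elem_zero (𝕜 := 𝕜) (Fin.elim0 : Fin 0 → V), pullRight_elem_zero]

theorem pullLeft_one : pullLeft 𝒱 (1 : Tens 𝕜 V) = 0 := by
  rw [← elem_zero (𝕜 := 𝕜) (Fin.elim0 : Fin 0 → V), pullLeft_elem_zero]

theorem pullRight_mul {i : ZMod 2} {v : V} (hv : v ∈ 𝒱 i) (a : Tens 𝕜 V) :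
    pullRight 𝒱 (tensOf v * a) = gAut 𝒱 i a ⊗ₜ v +
      (LinearMap.mulLeft 𝕜 (tensOf v)).rTensor V (pullRight 𝒱 a) := by
  induction a using Tens.span_elem 𝒱 with
  | add a b ha hb =>
    rw [mul_add, map_add, ha, hb, map_add, map_add, map_add, TensorProduct.add_tmul]
    abel
  | smul c a ha =>
    rw [mul_smul_comm, map_smul, ha, map_smul, map_smul, map_smul, ← TensorProduct.smul_tmul',
      smul_add]
  | elem n ε w hw =>
    have hvw : ∀ k, (Fin.cons v w : Fin (n + 1) → V) k ∈
        𝒱 ((Fin.cons i ε : Fin (n + 1) → ZMod 2) k) :=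
      Fin.cases (by simpa using hv) (by simpa using hw)
    rw [← elem_cons, pullRight_elem hvw, Fin.sum_univ_succ]
    congr 1
    · rw [removeNth_zero_cons, prod_Ioi_eq, gAut_elem i hw, Fin.prod_univ_succ]
      simp [TensorProduct.smul_tmul']
    · cases n with
      | zero => rw [pullRight_elem_zero]; simp
      | succ n =>
        rw [pullRight_elem hw, map_sum]
        refine Finset.sum_congr rfl fun k _ => ?_
        rw [removeNth_succ_cons, elem_cons, map_smul, LinearMap.rTensor_tmul, prod_Ioi_eq,
          prod_Ioi_eq, Fin.prod_univ_succ]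
        simp

variable {Λ : V →ₗ[𝕜] V →ₗ[𝕜] 𝕜}

theorem P_one_tmul (b : Tens 𝕜 V) : P 𝒱 Λ (1 ⊗ₜ b) = 0 := by
  simp [P, pullRight_one]

theorem P_tmul_one (a : Tens 𝕜 V) : P 𝒱 Λ (a ⊗ₜ 1) = 0 := by
  simp [P, pullLeft_one]

theorem P_mul_tmul {i : ZMod 2} {v : V} (hv : v ∈ 𝒱 i) (a b : Tens 𝕜 V) :
    P 𝒱 Λ ((tensOf v * a) ⊗ₜ b) = (LinearMap.mulLeft 𝕜 (tensOf v)).rTensor (Tens 𝕜 V)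
      (P 𝒱 Λ (a ⊗ₜ b)) + gAut 𝒱 i a ⊗ₜ contr 𝒱 (Λ v) b := by
  simp only [P, contr, LinearMap.comp_apply, TensorProduct.map_tmul, pullRight_mul hv,
    TensorProduct.add_tmul, map_add]
  rw [add_comm]
  congr 1
  · generalize pullRight 𝒱 a = x
    generalize pullLeft 𝒱 b = y
    induction x with
    | zero => simp
    | add x x' hx hx' => simp only [map_add, TensorProduct.add_tmul, hx, hx']
    | tmul x u =>
      induction y with
      | zero => simp
      | add y y' hy hy' => simp only [map_add, TensorProduct.tmul_add, hy, hy']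
      | tmul y w => simp
  · generalize pullLeft 𝒱 b = y
    induction y with
    | zero => simp
    | add y y' hy hy' => simp only [map_add, TensorProduct.tmul_add, hy, hy']
    | tmul y w => simp

end Contraction

section StarTens

variable {𝕜 : Type*} [RCLike 𝕜] {V : Type*} [AddCommGroup V] [Module 𝕜 V]
variable {𝒱 : ZMod 2 → Submodule 𝕜 V} [DirectSum.Decomposition 𝒱]

/-! ### Contractions as graded derivations -/

theorem contr_gAut {f : V →ₗ[𝕜] 𝕜} {i : ZMod 2} (hf : IsHomFunctional 𝒱 f i) (j : ZMod 2)
    (a : Tens 𝕜 V) :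
    contr 𝒱 f (gAut 𝒱 j a) = koszul (𝕜 := 𝕜) i j • gAut 𝒱 j (contr 𝒱 f a) := by
  refine LinearMap.congr_fun (f := contr 𝒱 f ∘ₗ (gAut 𝒱 j).toLinearMap)
    (g := koszul (𝕜 := 𝕜) i j • (gAut 𝒱 j).toLinearMap ∘ₗ contr 𝒱 f)
    (Tens.ext_left 𝒱 ?_ fun k w hw a h => ?_) a
  · simp [contr_one]
  · simp only [LinearMap.comp_apply, LinearMap.smul_apply, AlgHom.toLinearMap_apply] at h ⊢
    rw [map_mul, gAut_tensOf j hw, smul_mul_assoc, map_smul, contr_tensOf_mul hf hw,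
      contr_tensOf_mul hf hw, h,
      map_add, map_smul, map_smul, map_mul, gAut_tensOf j hw]
    simp only [mul_smul_comm, smul_mul_assoc]
    have h1 := hf.koszul_mul_apply hw j
    rw [koszul_comm k j] at h1
    linear_combination (norm := module) h1 • gAut 𝒱 j a

theorem contr_contr {f g : V →ₗ[𝕜] 𝕜} {i j : ZMod 2} (hf : IsHomFunctional 𝒱 f i)
    (hg : IsHomFunctional 𝒱 g j) (a : Tens 𝕜 V) :
    contr 𝒱 f (contr 𝒱 g a) = koszul (𝕜 := 𝕜) i j • contr 𝒱 g (contr 𝒱 f a) := by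
  refine LinearMap.congr_fun (f := contr 𝒱 f ∘ₗ contr 𝒱 g)
    (g := koszul (𝕜 := 𝕜) i j • contr 𝒱 g ∘ₗ contr 𝒱 f)
    (Tens.ext_left 𝒱 ?_ fun k w hw a h => ?_) a
  · simp [contr_one]
  · simp only [LinearMap.comp_apply, LinearMap.smul_apply] at h ⊢
    simp only [contr_tensOf_mul hf hw, contr_tensOf_mul hg hw, map_add, map_smul, h, mul_smul_comm]
    have h1 := hf.koszul_mul_apply hw j
    have h2 := hg.koszul_mul_apply hw i
    have h3 := koszul_mul_self (𝕜 := 𝕜) i j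
    rw [koszul_comm k j] at h1
    rw [koszul_comm k i, koszul_comm j i] at h2
    linear_combination (norm := module) (h1) • contr 𝒱 g a -
      (koszul (𝕜 := 𝕜) i j • h2) • contr 𝒱 f a - (g w • h3) • contr 𝒱 f a

/-- The contraction with a homogeneous functional is a graded derivation. -/
theorem contr_mul {f : V →ₗ[𝕜] 𝕜} {i : ZMod 2} (hf : IsHomFunctional 𝒱 f i)
    (a b : Tens 𝕜 V) :
    contr 𝒱 f (a * b) = contr 𝒱 f a * b + gAut 𝒱 i a * contr 𝒱 f b := by
  refine LinearMap.congr_fun (f := contr 𝒱 f ∘ₗ LinearMap.mulRight 𝕜 b)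
    (g := LinearMap.mulRight 𝕜 b ∘ₗ contr 𝒱 f +
      LinearMap.mulRight 𝕜 (contr 𝒱 f b) ∘ₗ (gAut 𝒱 i).toLinearMap)
    (Tens.ext_left 𝒱 ?_ fun k w hw a h => ?_) a
  · simp [contr_one]
  · simp only [LinearMap.comp_apply, LinearMap.add_apply, AlgHom.toLinearMap_apply,
      LinearMap.mulRight_apply] at h ⊢
    rw [mul_assoc, contr_tensOf_mul hf hw, contr_tensOf_mul hf hw, h, map_mul, gAut_tensOf i hw]
    simp only [mul_add, add_mul, smul_mul_assoc, mul_assoc]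
    module

theorem gAut_gAut_comm (i j : ZMod 2) (a : Tens 𝕜 V) :
    gAut 𝒱 i (gAut 𝒱 j a) = gAut 𝒱 j (gAut 𝒱 i a) := by
  refine LinearMap.congr_fun (f := (gAut 𝒱 i).toLinearMap ∘ₗ (gAut 𝒱 j).toLinearMap)
    (g := (gAut 𝒱 j).toLinearMap ∘ₗ (gAut 𝒱 i).toLinearMap)
    (Tens.ext_left 𝒱 ?_ fun k w hw a h => ?_) a
  · simp
  · simp only [LinearMap.comp_apply, AlgHom.toLinearMap_apply] at h ⊢
    simp only [map_mul, gAut_tensOf _ hw, map_smul, smul_mul_assoc, h]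
    rw [smul_comm]

/-! ### The exponential `e^{z P_Λ}` and left multiplication by a vector -/

variable {Λ : V →ₗ[𝕜] V →ₗ[𝕜] 𝕜}

variable (𝒱) in
/-- The operator `γⁱ ⊗ ι_f` on `T ⊗ T`: it contracts in the second factor, with the sign for
passing the first factor. -/
def contrSnd (i : ZMod 2) (f : V →ₗ[𝕜] 𝕜) :
    Tens 𝕜 V ⊗[𝕜] Tens 𝕜 V →ₗ[𝕜] Tens 𝕜 V ⊗[𝕜] Tens 𝕜 V :=
  TensorProduct.map (gAut 𝒱 i).toLinearMap (contr 𝒱 f)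

variable (𝒱) in
/-- The operator `ι_f ⊗ 1` on `T ⊗ T`. -/
def contrFst (f : V →ₗ[𝕜] 𝕜) : Tens 𝕜 V ⊗[𝕜] Tens 𝕜 V →ₗ[𝕜] Tens 𝕜 V ⊗[𝕜] Tens 𝕜 V :=
  (contr 𝒱 f).rTensor (Tens 𝕜 V)

/-- The operator `v ⊗ 1` on `T ⊗ T`. -/
def mulFst (v : V) : Tens 𝕜 V ⊗[𝕜] Tens 𝕜 V →ₗ[𝕜] Tens 𝕜 V ⊗[𝕜] Tens 𝕜 V :=
  (LinearMap.mulLeft 𝕜 (tensOf v)).rTensor (Tens 𝕜 V)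

theorem contrSnd_tmul (i : ZMod 2) (f : V →ₗ[𝕜] 𝕜) (a b : Tens 𝕜 V) :
    contrSnd 𝒱 i f (a ⊗ₜ b) = gAut 𝒱 i a ⊗ₜ contr 𝒱 f b := rfl

theorem contrFst_tmul (f : V →ₗ[𝕜] 𝕜) (a b : Tens 𝕜 V) :
    contrFst 𝒱 f (a ⊗ₜ b) = contr 𝒱 f a ⊗ₜ b := rfl

theorem mulFst_tmul (v : V) (a b : Tens 𝕜 V) :
    mulFst v (a ⊗ₜ[𝕜] b) = (tensOf v * a) ⊗ₜ b := rfl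

theorem P_mulFst {i : ZMod 2} {v : V} (hv : v ∈ 𝒱 i) (x : Tens 𝕜 V ⊗[𝕜] Tens 𝕜 V) :
    P 𝒱 Λ (mulFst v x) = mulFst v (P 𝒱 Λ x) + contrSnd 𝒱 i (Λ v) x := by
  induction x with
  | zero => simp
  | add x y hx hy =>
    simp only [map_add, hx, hy]
    abel
  | tmul a b => exact P_mul_tmul hv a b

theorem contrFst_mulFst {f : V →ₗ[𝕜] 𝕜} {i j : ZMod 2} (hf : IsHomFunctional 𝒱 f i) {v : V}
    (hv : v ∈ 𝒱 j) (x : Tens 𝕜 V ⊗[𝕜] Tens 𝕜 V) :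
    contrFst 𝒱 f (mulFst v x) = f v • x + koszul (𝕜 := 𝕜) i j • mulFst v (contrFst 𝒱 f x) := by
  induction x with
  | zero => simp
  | add x y hx hy =>
    simp only [map_add, hx, hy]
    module
  | tmul a b =>
    simp only [contrFst_tmul, mulFst_tmul, contr_tensOf_mul hf hv, TensorProduct.add_tmul,
      TensorProduct.smul_tmul']

theorem contrSnd_mulFst (f : V →ₗ[𝕜] 𝕜) (i : ZMod 2) {j : ZMod 2} {v : V}
    (hv : v ∈ 𝒱 j) (x : Tens 𝕜 V ⊗[𝕜] Tens 𝕜 V) :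
    contrSnd 𝒱 i f (mulFst v x) = koszul (𝕜 := 𝕜) i j • mulFst v (contrSnd 𝒱 i f x) := by
  induction x with
  | zero => simp
  | add x y hx hy =>
    simp only [map_add, hx, hy, smul_add]
  | tmul a b =>
    simp only [contrSnd_tmul, mulFst_tmul, map_mul, gAut_tensOf i hv, smul_mul_assoc,
      TensorProduct.smul_tmul']

theorem contrFst_contrSnd {f g : V →ₗ[𝕜] 𝕜} {i : ZMod 2} (hf : IsHomFunctional 𝒱 f i)
    (j : ZMod 2) (x : Tens 𝕜 V ⊗[𝕜] Tens 𝕜 V) :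
    contrFst 𝒱 f (contrSnd 𝒱 j g x) =
      koszul (𝕜 := 𝕜) i j • contrSnd 𝒱 j g (contrFst 𝒱 f x) := by
  induction x with
  | zero => simp
  | add x y hx hy =>
    simp only [map_add, hx, hy, smul_add]
  | tmul a b =>
    simp only [contrSnd_tmul, contrFst_tmul, contr_gAut hf, TensorProduct.smul_tmul']

theorem contrSnd_contrSnd {f g : V →ₗ[𝕜] 𝕜} {i j : ZMod 2} (hf : IsHomFunctional 𝒱 f i)
    (hg : IsHomFunctional 𝒱 g j) (x : Tens 𝕜 V ⊗[𝕜] Tens 𝕜 V) :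
    contrSnd 𝒱 i f (contrSnd 𝒱 j g x) =
      koszul (𝕜 := 𝕜) i j • contrSnd 𝒱 j g (contrSnd 𝒱 i f x) := by
  induction x with
  | zero => simp
  | add x y hx hy =>
    simp only [map_add, hx, hy, smul_add]
  | tmul a b =>
    rw [contrSnd_tmul, contrSnd_tmul, contrSnd_tmul, contrSnd_tmul, contr_contr hf hg,
      gAut_gAut_comm, TensorProduct.tmul_smul]

/-- Two linear maps on `T ⊗ T` agree if they agree on `1 ⊗ T` and their difference is compatible
with multiplication by vectors in the first factor. -/
theorem tensTens_ext {F G : Tens 𝕜 V ⊗[𝕜] Tens 𝕜 V →ₗ[𝕜] Tens 𝕜 V ⊗[𝕜] Tens 𝕜 V}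
    (one : ∀ b, F (1 ⊗ₜ b) = G (1 ⊗ₜ b))
    (mul : ∀ i, ∀ v ∈ 𝒱 i, ∀ x, F x = G x → F (mulFst v x) = G (mulFst v x)) : F = G := by
  refine TensorProduct.ext' fun a b => ?_
  refine LinearMap.congr_fun (f := F ∘ₗ (TensorProduct.mk 𝕜 _ _).flip b)
    (g := G ∘ₗ (TensorProduct.mk 𝕜 _ _).flip b) (Tens.ext_left 𝒱 ?_ fun i v hv a h => ?_) a
  · exact one b
  · exact mul i v hv _ h

theorem P_contrFst {f : V →ₗ[𝕜] 𝕜} {i : ZMod 2}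
    (hf : IsHomFunctional 𝒱 f i) (x : Tens 𝕜 V ⊗[𝕜] Tens 𝕜 V) :
    P 𝒱 Λ (contrFst 𝒱 f x) = contrFst 𝒱 f (P 𝒱 Λ x) := by
  refine LinearMap.congr_fun (f := P 𝒱 Λ ∘ₗ contrFst 𝒱 f) (g := contrFst 𝒱 f ∘ₗ P 𝒱 Λ)
    (tensTens_ext (𝒱 := 𝒱) ?_ fun j v hv x h => ?_) x
  · intro b
    simp [contrFst_tmul, contr_one, P_one_tmul]
  · simp only [LinearMap.comp_apply] at h ⊢
    rw [contrFst_mulFst hf hv, P_mulFst hv, map_add, map_add, map_smul, map_smul, P_mulFst hv,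
      contrFst_mulFst hf hv, contrFst_contrSnd hf, h]
    module

theorem P_contrSnd (hΛ : IsEvenForm 𝒱 Λ) {f : V →ₗ[𝕜] 𝕜} {i : ZMod 2}
    (hf : IsHomFunctional 𝒱 f i) (x : Tens 𝕜 V ⊗[𝕜] Tens 𝕜 V) :
    P 𝒱 Λ (contrSnd 𝒱 i f x) = contrSnd 𝒱 i f (P 𝒱 Λ x) := by
  refine LinearMap.congr_fun (f := P 𝒱 Λ ∘ₗ contrSnd 𝒱 i f) (g := contrSnd 𝒱 i f ∘ₗ P 𝒱 Λ)
    (tensTens_ext (𝒱 := 𝒱) ?_ fun j v hv x h => ?_) x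
  · intro b
    simp [contrSnd_tmul, P_one_tmul]
  · simp only [LinearMap.comp_apply] at h ⊢
    rw [contrSnd_mulFst f i hv, P_mulFst hv, map_smul, P_mulFst hv, map_add,
      contrSnd_mulFst f i hv, contrSnd_contrSnd hf (hΛ.isHomFunctional hv), h]
    module

theorem expP_eq_sum {z : 𝕜} {x : Tens 𝕜 V ⊗[𝕜] Tens 𝕜 V} {N : ℕ}
    (hN : ∀ k, N ≤ k → (P 𝒱 Λ ^ k) x = 0) :
    expP 𝒱 Λ z x = ∑ k ∈ Finset.range N, (z ^ k / (k.factorial : 𝕜)) • (P 𝒱 Λ ^ k) x := by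
  refine finsum_eq_sum_of_support_subset _ fun k hk => ?_
  by_contra h
  refine hk ?_
  simp only [hN k (by simpa using h), smul_zero]

theorem expP_of_P_eq_zero {z : 𝕜} {x : Tens 𝕜 V ⊗[𝕜] Tens 𝕜 V} (hx : P 𝒱 Λ x = 0) :
    expP 𝒱 Λ z x = x := by
  rw [expP_eq_sum (N := 1)]
  · simp
  · intro k hk
    obtain ⟨k, rfl⟩ : ∃ j, k = j + 1 := ⟨k - 1, by omega⟩
    rw [pow_succ, Module.End.mul_apply, hx, map_zero]

theorem expP_comm {A : Tens 𝕜 V ⊗[𝕜] Tens 𝕜 V →ₗ[𝕜] Tens 𝕜 V ⊗[𝕜] Tens 𝕜 V}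
    (hA : ∀ x, P 𝒱 Λ (A x) = A (P 𝒱 Λ x)) (z : 𝕜) (x : Tens 𝕜 V ⊗[𝕜] Tens 𝕜 V) :
    expP 𝒱 Λ z (A x) = A (expP 𝒱 Λ z x) := by
  have hk : ∀ k x, (P 𝒱 Λ ^ k) (A x) = A ((P 𝒱 Λ ^ k) x) := by
    intro k
    induction k with
    | zero => simp
    | succ k ih =>
      intro x
      rw [pow_succ, Module.End.mul_apply, hA, ih, Module.End.mul_apply]
  obtain ⟨N, hN⟩ := exists_P_pow_eq_zero 𝒱 Λ x
  rw [expP_eq_sum hN, expP_eq_sum (N := N) fun k h => by rw [hk, hN k h, map_zero], map_sum]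
  simp only [hk, map_smul]

/-- `e^{z P} (v a ⊗ b) = v e^{z P} (a ⊗ b) + z (γ ⊗ ι_v) e^{z P} (a ⊗ b)`: the commutator of `P`
with the multiplication by `v` commutes with `P`. -/
theorem expP_mulFst (hΛ : IsEvenForm 𝒱 Λ) (z : 𝕜) {i : ZMod 2} {v : V} (hv : v ∈ 𝒱 i)
    (x : Tens 𝕜 V ⊗[𝕜] Tens 𝕜 V) :
    expP 𝒱 Λ z (mulFst v x) =
      mulFst v (expP 𝒱 Λ z x) + z • contrSnd 𝒱 i (Λ v) (expP 𝒱 Λ z x) := by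
  have hk : ∀ k, (P 𝒱 Λ ^ (k + 1)) (mulFst v x) = mulFst v ((P 𝒱 Λ ^ (k + 1)) x) +
      ((k + 1 : ℕ) : 𝕜) • contrSnd 𝒱 i (Λ v) ((P 𝒱 Λ ^ k) x) := by
    intro k
    have hP : ∀ k y, P 𝒱 Λ ((P 𝒱 Λ ^ k) y) = (P 𝒱 Λ ^ (k + 1)) y := fun k y => by
      rw [pow_succ', Module.End.mul_apply]
    induction k with
    | zero => simp [P_mulFst hv]
    | succ k ih =>
      rw [← hP, ih, map_add, map_smul, P_mulFst hv, P_contrSnd hΛ (hΛ.isHomFunctional hv), hP, hP,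
        Nat.cast_succ (k + 1)]
      module
  obtain ⟨N, hN⟩ := exists_P_pow_eq_zero 𝒱 Λ x
  have hN' : ∀ k, N + 1 ≤ k → (P 𝒱 Λ ^ k) (mulFst v x) = 0 := by
    intro k hk'
    obtain ⟨k, rfl⟩ : ∃ j, k = j + 1 := ⟨k - 1, by omega⟩
    rw [hk, hN _ (by omega), hN _ (by omega), map_zero, map_zero, smul_zero, add_zero]
  have h1 : expP 𝒱 Λ z x = ∑ k ∈ Finset.range (N + 1), (z ^ k / (k.factorial : 𝕜)) •
      (P 𝒱 Λ ^ k) x := expP_eq_sum fun k h => hN k (by omega)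
  have h2 : mulFst v (expP 𝒱 Λ z x) = mulFst v x + ∑ k ∈ Finset.range N,
      (z ^ (k + 1) / ((k + 1).factorial : 𝕜)) • mulFst v ((P 𝒱 Λ ^ (k + 1)) x) := by
    rw [h1, map_sum, Finset.sum_range_succ']
    simp [add_comm]
  have h3 : contrSnd 𝒱 i (Λ v) (expP 𝒱 Λ z x) = ∑ k ∈ Finset.range N,
      (z ^ k / (k.factorial : 𝕜)) • contrSnd 𝒱 i (Λ v) ((P 𝒱 Λ ^ k) x) := by
    rw [expP_eq_sum hN, map_sum]
    simp only [map_smul]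
  rw [expP_eq_sum hN', Finset.sum_range_succ', h2, h3, Finset.smul_sum, add_assoc,
    ← Finset.sum_add_distrib, add_comm]
  congr 1
  · simp
  · refine Finset.sum_congr rfl fun k _ => ?_
    rw [hk, smul_add, smul_smul, smul_smul]
    congr 2
    have h4 : ((k + 1 : ℕ) : 𝕜) ≠ 0 := Nat.cast_ne_zero.mpr k.succ_ne_zero
    have h5 : (k.factorial : 𝕜) ≠ 0 := Nat.cast_ne_zero.mpr k.factorial_ne_zero
    rw [Nat.factorial_succ, Nat.cast_mul]
    field_simp
    ring

/-! ### The star product of tensors -/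

variable (𝒱 Λ) in
/-- The star product before symmetrization: `a ⊗ b ↦ μ (e^{z P_Λ} (a ⊗ b))` with the tensor
product `μ`. -/
def starT (z : 𝕜) : Tens 𝕜 V →ₗ[𝕜] Tens 𝕜 V →ₗ[𝕜] Tens 𝕜 V :=
  TensorProduct.curry (LinearMap.mul' 𝕜 (Tens 𝕜 V) ∘ₗ expP 𝒱 Λ z)

theorem starT_apply (z : 𝕜) (a b : Tens 𝕜 V) :
    starT 𝒱 Λ z a b = LinearMap.mul' 𝕜 (Tens 𝕜 V) (expP 𝒱 Λ z (a ⊗ₜ b)) := rfl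

theorem one_starT (z : 𝕜) (b : Tens 𝕜 V) : starT 𝒱 Λ z 1 b = b := by
  rw [starT_apply, expP_of_P_eq_zero (P_one_tmul b), LinearMap.mul'_apply, one_mul]

theorem starT_one (z : 𝕜) (a : Tens 𝕜 V) : starT 𝒱 Λ z a 1 = a := by
  rw [starT_apply, expP_of_P_eq_zero (P_tmul_one a), LinearMap.mul'_apply, mul_one]

/-- `v ⋆ b = v b + z ι_{Λ(v, ·)} b`: this determines the star product. -/
theorem tensOf_starT (hΛ : IsEvenForm 𝒱 Λ) (z : 𝕜) {i : ZMod 2} {v : V} (hv : v ∈ 𝒱 i)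
    (b : Tens 𝕜 V) : starT 𝒱 Λ z (tensOf v) b = tensOf v * b + z • contr 𝒱 (Λ v) b := by
  have h := expP_mulFst hΛ z hv (1 ⊗ₜ b)
  rw [mulFst_tmul, mul_one, expP_of_P_eq_zero (P_one_tmul b), contrSnd_tmul, mulFst_tmul, map_one,
    mul_one] at h
  rw [starT_apply, h, map_add, map_smul, LinearMap.mul'_apply, LinearMap.mul'_apply, one_mul]

/-- The tensor product `μ` intertwines `ι_f ⊗ 1 + γ ⊗ ι_f` with `ι_f`. -/
theorem mul'_contr {f : V →ₗ[𝕜] 𝕜} {i : ZMod 2} (hf : IsHomFunctional 𝒱 f i)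
    (x : Tens 𝕜 V ⊗[𝕜] Tens 𝕜 V) :
    contr 𝒱 f (LinearMap.mul' 𝕜 (Tens 𝕜 V) x) = LinearMap.mul' 𝕜 (Tens 𝕜 V) (contrFst 𝒱 f x) +
      LinearMap.mul' 𝕜 (Tens 𝕜 V) (contrSnd 𝒱 i f x) := by
  induction x with
  | zero => simp
  | add x y hx hy =>
    simp only [map_add, hx, hy]
    abel
  | tmul a b => exact contr_mul hf a b

theorem starT_assoc_tensOf (hΛ : IsEvenForm 𝒱 Λ) (z : 𝕜) {i : ZMod 2} {v : V} (hv : v ∈ 𝒱 i)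
    (a b : Tens 𝕜 V) :
    starT 𝒱 Λ z (starT 𝒱 Λ z (tensOf v) a) b = starT 𝒱 Λ z (tensOf v) (starT 𝒱 Λ z a b) := by
  have hf := hΛ.isHomFunctional hv
  rw [tensOf_starT hΛ z hv, tensOf_starT hΛ z hv, map_add, map_smul, LinearMap.add_apply,
    LinearMap.smul_apply]
  simp only [starT_apply]
  rw [← mulFst_tmul, expP_mulFst hΛ z hv, ← contrFst_tmul, expP_comm (P_contrFst hf),
    mul'_contr hf, map_add, map_smul]
  have hX : ∀ x : Tens 𝕜 V ⊗[𝕜] Tens 𝕜 V, LinearMap.mul' 𝕜 (Tens 𝕜 V) (mulFst v x) =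
      tensOf v * LinearMap.mul' 𝕜 (Tens 𝕜 V) x := by
    intro x
    induction x with
    | zero => simp
    | add x y hx hy => simp only [map_add, hx, hy, mul_add]
    | tmul a b => exact mul_assoc (tensOf v) a b
  rw [hX]
  module

/-- If `G` is stable under contractions and `J` contains `G` and is stable under star
multiplication by vectors from the left, then `J` contains the left ideal of the tensor algebra
generated by `G`. -/
theorem mul_mem_of_starT_mem (hΛ : IsEvenForm 𝒱 Λ) (z : 𝕜) {G J : Submodule 𝕜 (Tens 𝕜 V)}
    (hG : ∀ i, ∀ v ∈ 𝒱 i, ∀ x ∈ G, contr 𝒱 (Λ v) x ∈ G) (hGJ : G ≤ J)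
    (hJ : ∀ i, ∀ v ∈ 𝒱 i, ∀ x ∈ J, starT 𝒱 Λ z (tensOf v) x ∈ J) (a : Tens 𝕜 V) {x : Tens 𝕜 V}
    (hx : x ∈ G) : a * x ∈ J := by
  -- the smallest subspace that contains `G` and is stable under star multiplication by vectors
  let K : Submodule 𝕜 (Tens 𝕜 V) := sInf {J' | G ≤ J' ∧
    ∀ i, ∀ v ∈ 𝒱 i, ∀ x ∈ J', starT 𝒱 Λ z (tensOf v) x ∈ J'}
  have hGK : G ≤ K := le_sInf fun J' hJ' => hJ'.1
  have hK : ∀ i, ∀ v ∈ 𝒱 i, ∀ x ∈ K, starT 𝒱 Λ z (tensOf v) x ∈ K := fun i v hv x hx =>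
    Submodule.mem_sInf.mpr fun J' hJ' => hJ'.2 i v hv x (Submodule.mem_sInf.mp hx J' hJ')
  have hKc : ∀ i, ∀ v ∈ 𝒱 i, ∀ x ∈ K, contr 𝒱 (Λ v) x ∈ K := by
    intro i v hv x hx
    have hf := hΛ.isHomFunctional hv
    refine (Submodule.mem_sInf.mp hx (K ⊓ K.comap (contr 𝒱 (Λ v)))
      ⟨le_inf hGK fun y hy => hGK (hG i v hv y hy), ?_⟩).2
    rintro j w hw y ⟨hy, hy'⟩
    refine ⟨hK j w hw y hy, ?_⟩
    have h : contr 𝒱 (Λ v) (starT 𝒱 Λ z (tensOf w) y) =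
        Λ v w • y + koszul (𝕜 := 𝕜) i j • starT 𝒱 Λ z (tensOf w) (contr 𝒱 (Λ v) y) := by
      rw [tensOf_starT hΛ z hw, tensOf_starT hΛ z hw, map_add, map_smul, contr_tensOf_mul hf hw,
        contr_contr hf (hΛ.isHomFunctional hw)]
      module
    change contr 𝒱 (Λ v) _ ∈ K
    rw [h]
    exact add_mem (K.smul_mem _ hy) (K.smul_mem _ (hK j w hw _ hy'))
  have hKJ : K ≤ J := sInf_le ⟨hGJ, hJ⟩
  refine hKJ (Tens.map_mem_of_left 𝒱 K (f := LinearMap.mulRight 𝕜 x) ?_ ?_ a)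
  · simpa using hGK hx
  · intro i v hv b hb
    simp only [LinearMap.mulRight_apply] at hb ⊢
    have h := hK i v hv _ hb
    rw [tensOf_starT hΛ z hv, ← mul_assoc] at h
    exact (Submodule.add_mem_iff_left K (K.smul_mem z (hKc i v hv _ hb))).mp h

/-- A subspace that contains `1` and is stable under star multiplication by homogeneous vectors
from the left is everything. -/
theorem mem_of_starT_mem (hΛ : IsEvenForm 𝒱 Λ) (z : 𝕜) {J : Submodule 𝕜 (Tens 𝕜 V)}
    (one : 1 ∈ J) (hJ : ∀ i, ∀ v ∈ 𝒱 i, ∀ x ∈ J, starT 𝒱 Λ z (tensOf v) x ∈ J)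
    (a : Tens 𝕜 V) : a ∈ J := by
  have := mul_mem_of_starT_mem (G := 𝕜 ∙ (1 : Tens 𝕜 V)) hΛ z ?_ ?_ hJ a
    (Submodule.mem_span_singleton_self _)
  · rwa [mul_one] at this
  · intro i v hv x hx
    obtain ⟨c, rfl⟩ := Submodule.mem_span_singleton.mp hx
    rw [map_smul, contr_one, smul_zero]
    exact zero_mem _
  · exact (Submodule.span_singleton_le_iff_mem _ _).mpr one

/-- The star product is associative already on the tensor algebra: for `a = v ⋆ a'` this follows
from the case of a vector `v` on the left, and every tensor is generated by such products. -/
theorem starT_assoc (hΛ : IsEvenForm 𝒱 Λ) (z : 𝕜) (a b c : Tens 𝕜 V) :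
    starT 𝒱 Λ z (starT 𝒱 Λ z a b) c = starT 𝒱 Λ z a (starT 𝒱 Λ z b c) := by
  let J : Submodule 𝕜 (Tens 𝕜 V) := LinearMap.eqLocus
    ((starT 𝒱 Λ z).flip c ∘ₗ (starT 𝒱 Λ z).flip b) ((starT 𝒱 Λ z).flip (starT 𝒱 Λ z b c))
  refine mem_of_starT_mem (J := J) hΛ z ?_ ?_ a
  · change starT 𝒱 Λ z (starT 𝒱 Λ z 1 b) c = starT 𝒱 Λ z 1 (starT 𝒱 Λ z b c)
    rw [one_starT, one_starT]
  · intro i v hv x hx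
    change starT 𝒱 Λ z (starT 𝒱 Λ z x b) c = starT 𝒱 Λ z x (starT 𝒱 Λ z b c) at hx
    change starT 𝒱 Λ z (starT 𝒱 Λ z (starT 𝒱 Λ z (tensOf v) x) b) c =
      starT 𝒱 Λ z (starT 𝒱 Λ z (tensOf v) x) (starT 𝒱 Λ z b c)
    rw [starT_assoc_tensOf hΛ z hv, starT_assoc_tensOf hΛ z hv, starT_assoc_tensOf hΛ z hv, hx]

/-! ### The ideal of the graded commutators and the star product -/

theorem contr_gradedComm {f : V →ₗ[𝕜] 𝕜} {i j k : ZMod 2} (hf : IsHomFunctional 𝒱 f i) {u w : V}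
    (hu : u ∈ 𝒱 j) (hw : w ∈ 𝒱 k) (c : Tens 𝕜 V) :
    contr 𝒱 f (gradedComm j k u w c) =
      (koszul (𝕜 := 𝕜) i j * koszul (𝕜 := 𝕜) i k) • gradedComm j k u w (contr 𝒱 f c) := by
  simp only [gradedComm, map_sub, map_smul, contr_tensOf_mul hf hu, contr_tensOf_mul hf hw, mul_add,
    mul_smul_comm]
  have h1 := hf.koszul_mul_apply hu k
  have h2 := hf.koszul_mul_apply hw j
  have h4 := koszul_mul_self (𝕜 := 𝕜) i k
  rw [koszul_comm k j] at h2
  linear_combination (norm := module) -(h2 • (tensOf u * c)) -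
    (koszul (𝕜 := 𝕜) i k • h1) • (tensOf w * c) - (f u • h4) • (tensOf w * c)

theorem contr_mem_commSpan {f : V →ₗ[𝕜] 𝕜} {i : ZMod 2} (hf : IsHomFunctional 𝒱 f i)
    {x : Tens 𝕜 V} (hx : x ∈ commSpan 𝒱) : contr 𝒱 f x ∈ commSpan 𝒱 := by
  have : commSpan 𝒱 ≤ (commSpan 𝒱).comap (contr 𝒱 f) := by
    refine Submodule.span_le.mpr ?_
    rintro _ ⟨j, k, u, hu, w, hw, c, rfl⟩
    change contr 𝒱 f _ ∈ commSpan 𝒱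
    rw [contr_gradedComm hf hu hw]
    exact Submodule.smul_mem _ _ (gradedComm_mem_commSpan hu hw _)
  exact this hx

theorem contr_mem_symIdeal {f : V →ₗ[𝕜] 𝕜} {i : ZMod 2} (hf : IsHomFunctional 𝒱 f i)
    {x : Tens 𝕜 V} (hx : x ∈ symIdeal 𝒱) : contr 𝒱 f x ∈ symIdeal 𝒱 := by
  have : symIdeal 𝒱 ≤ (symIdeal 𝒱).comap (contr 𝒱 f) := by
    refine Submodule.span_le.mpr ?_
    rintro _ ⟨a, r, hr, rfl⟩
    change contr 𝒱 f _ ∈ symIdeal 𝒱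
    rw [contr_mul hf]
    exact add_mem (mul_mem_symIdeal _ (commSpan_le_symIdeal hr))
      (mul_mem_symIdeal _ (commSpan_le_symIdeal (contr_mem_commSpan hf hr)))
  exact this hx

theorem tensOf_starT_mem_symIdeal (hΛ : IsEvenForm 𝒱 Λ) (z : 𝕜) {i : ZMod 2} {v : V}
    (hv : v ∈ 𝒱 i) {x : Tens 𝕜 V} (hx : x ∈ symIdeal 𝒱) :
    starT 𝒱 Λ z (tensOf v) x ∈ symIdeal 𝒱 := by
  rw [tensOf_starT hΛ z hv]
  exact add_mem (mul_mem_symIdeal _ hx)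
    (Submodule.smul_mem _ _ (contr_mem_symIdeal (hΛ.isHomFunctional hv) hx))

theorem starT_mem_symIdeal_right (hΛ : IsEvenForm 𝒱 Λ) (z : 𝕜) (a : Tens 𝕜 V) {x : Tens 𝕜 V}
    (hx : x ∈ symIdeal 𝒱) : starT 𝒱 Λ z a x ∈ symIdeal 𝒱 := by
  refine mem_of_starT_mem (J := (symIdeal 𝒱).comap ((starT 𝒱 Λ z).flip x)) hΛ z ?_ ?_ a
  · change starT 𝒱 Λ z 1 x ∈ symIdeal 𝒱
    rwa [one_starT]
  · intro i v hv b hb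
    change starT 𝒱 Λ z (starT 𝒱 Λ z (tensOf v) b) x ∈ symIdeal 𝒱
    rw [starT_assoc_tensOf hΛ z hv]
    exact tensOf_starT_mem_symIdeal hΛ z hv hb

/-- A graded commutator differs from a graded star commutator by a scalar. -/
theorem gradedComm_eq_starT (hΛ : IsEvenForm 𝒱 Λ) (z : 𝕜) {i j : ZMod 2} {u w : V}
    (hu : u ∈ 𝒱 i) (hw : w ∈ 𝒱 j) (c : Tens 𝕜 V) :
    gradedComm i j u w c = starT 𝒱 Λ z (tensOf u) (starT 𝒱 Λ z (tensOf w) c) -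
      koszul (𝕜 := 𝕜) i j • starT 𝒱 Λ z (tensOf w) (starT 𝒱 Λ z (tensOf u) c) -
      (z * (Λ u w - koszul (𝕜 := 𝕜) i j * Λ w u)) • c := by
  have hfu := hΛ.isHomFunctional hu
  have hfw := hΛ.isHomFunctional hw
  simp only [tensOf_starT hΛ z hu, tensOf_starT hΛ z hw, map_add, map_smul, mul_add,
    contr_tensOf_mul hfu hw, contr_tensOf_mul hfw hu, contr_contr hfu hfw, gradedComm,
    mul_smul_comm, koszul_comm j i]
  have h := koszul_mul_self (𝕜 := 𝕜) i j
  linear_combination (norm := module) (z • h) • (tensOf u * contr 𝒱 (Λ w) c)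

/-- By `gradedComm_eq_starT`, the map `c ↦ [u, w] c` is a combination of left multiplications
for `⋆`, so that associativity gives `([u, w] c) ⋆ a = [u, w] (c ⋆ a)`. -/
theorem starT_mem_symIdeal_left (hΛ : IsEvenForm 𝒱 Λ) (z : 𝕜) {x : Tens 𝕜 V}
    (hx : x ∈ symIdeal 𝒱) (a : Tens 𝕜 V) : starT 𝒱 Λ z x a ∈ symIdeal 𝒱 := by
  have hJ : commSpan 𝒱 ≤ (symIdeal 𝒱).comap ((starT 𝒱 Λ z).flip a) := by
    refine Submodule.span_le.mpr ?_
    rintro _ ⟨i, j, u, hu, w, hw, c, rfl⟩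
    change starT 𝒱 Λ z _ a ∈ symIdeal 𝒱
    have h : starT 𝒱 Λ z (gradedComm i j u w c) a = gradedComm i j u w (starT 𝒱 Λ z c a) := by
      rw [gradedComm_eq_starT hΛ z hu hw, gradedComm_eq_starT hΛ z hu hw]
      simp only [map_sub, map_smul, LinearMap.sub_apply, LinearMap.smul_apply, starT_assoc hΛ]
    rw [h]
    exact gradedComm_mem_symIdeal hu hw _
  have : symIdeal 𝒱 ≤ (symIdeal 𝒱).comap ((starT 𝒱 Λ z).flip a) := by
    refine Submodule.span_le.mpr ?_
    rintro _ ⟨b, r, hr, rfl⟩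
    refine mul_mem_of_starT_mem (G := commSpan 𝒱)
      (J := (symIdeal 𝒱).comap ((starT 𝒱 Λ z).flip a)) hΛ z
      (fun i v hv x hx => contr_mem_commSpan (hΛ.isHomFunctional hv) hx) hJ ?_ b hr
    intro i v hv x hx
    change starT 𝒱 Λ z (starT 𝒱 Λ z (tensOf v) x) a ∈ symIdeal 𝒱
    rw [starT_assoc_tensOf hΛ z hv]
    exact tensOf_starT_mem_symIdeal hΛ z hv hx
  exact this hx

end StarTens

section Translate

variable {𝕜 : Type*} [RCLike 𝕜] {V : Type*} [AddCommGroup V] [Module 𝕜 V]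
variable {𝒱 : ZMod 2 → Submodule 𝕜 V} [DirectSum.Decomposition 𝒱]

/-! ### Translations -/

theorem translate_contr {f φ : V →ₗ[𝕜] 𝕜} {i : ZMod 2} (hf : IsHomFunctional 𝒱 f i)
    (hφ : IsHomFunctional 𝒱 φ 0) (a : Tens 𝕜 V) :
    translate φ (contr 𝒱 f a) = contr 𝒱 f (translate φ a) := by
  refine LinearMap.congr_fun (f := (translate φ).toLinearMap ∘ₗ contr 𝒱 f)
    (g := contr 𝒱 f ∘ₗ (translate φ).toLinearMap)
    (Tens.ext_left 𝒱 ?_ fun k w hw a h => ?_) a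
  · simp [contr_one]
  · simp only [LinearMap.comp_apply, AlgHom.toLinearMap_apply] at h ⊢
    rw [contr_tensOf_mul hf hw, map_add, map_smul, map_smul, map_mul, map_mul, translate_tensOf, h,
      add_mul, add_mul, map_add, contr_tensOf_mul hf hw, smul_mul_assoc, smul_mul_assoc, one_mul,
      one_mul, map_smul]
    have h1 := hφ.koszul_mul_apply hw i
    rw [koszul_zero_left, koszul_comm k i] at h1
    linear_combination (norm := module) h1 • contr 𝒱 f (translate φ a)

omit [DirectSum.Decomposition 𝒱] in
theorem translate_mem_symIdeal {φ : V →ₗ[𝕜] 𝕜} (hφ : IsHomFunctional 𝒱 φ 0) {x : Tens 𝕜 V}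
    (hx : x ∈ symIdeal 𝒱) : translate φ x ∈ symIdeal 𝒱 := by
  have h1 : commSpan 𝒱 ≤ (symIdeal 𝒱).comap (translate φ).toLinearMap := by
    refine Submodule.span_le.mpr ?_
    rintro _ ⟨i, j, u, hu, w, hw, c, rfl⟩
    change translate φ _ ∈ symIdeal 𝒱
    have h : translate φ (gradedComm i j u w c) = gradedComm i j u w (translate φ c) := by
      simp only [gradedComm, map_sub, map_smul, map_mul, translate_tensOf, add_mul, mul_add,
        smul_mul_assoc, one_mul, mul_smul_comm]
      have h1 := hφ.koszul_mul_apply hw i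
      have h2 := hφ.koszul_mul_apply hu j
      rw [koszul_zero_left, koszul_comm j i] at h1
      rw [koszul_zero_left] at h2
      linear_combination (norm := module) -(h1 • (tensOf u * translate φ c)) -
        h2 • (tensOf w * translate φ c) - (φ u • h1) • translate φ c
    rw [h]
    exact gradedComm_mem_symIdeal hu hw _
  have h2 : symIdeal 𝒱 ≤ (symIdeal 𝒱).comap (translate φ).toLinearMap := by
    refine Submodule.span_le.mpr ?_
    rintro _ ⟨a, r, hr, rfl⟩
    change translate φ _ ∈ symIdeal 𝒱
    rw [map_mul]
    exact mul_mem_symIdeal _ (h1 hr)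
  exact h2 hx

theorem translate_tensOf_starT {Λ : V →ₗ[𝕜] V →ₗ[𝕜] 𝕜} (hΛ : IsEvenForm 𝒱 Λ) (z : 𝕜)
    {φ : V →ₗ[𝕜] 𝕜} (hφ : IsHomFunctional 𝒱 φ 0) {i : ZMod 2} {v : V} (hv : v ∈ 𝒱 i)
    (a : Tens 𝕜 V) :
    translate φ (starT 𝒱 Λ z (tensOf v) a) =
      starT 𝒱 Λ z (tensOf v) (translate φ a) + φ v • translate φ a := by
  rw [tensOf_starT hΛ z hv, tensOf_starT hΛ z hv, map_add, map_mul, map_smul, translate_tensOf,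
    translate_contr (hΛ.isHomFunctional hv) hφ, add_mul, smul_mul_assoc, one_mul]
  abel

/-! ### Translations preserve symmetric tensors -/

theorem symmetrizer_mem (a : Tens 𝕜 V) : symmetrizer 𝒱 a ∈ symTens 𝒱 := ⟨a, rfl⟩

theorem insertion_mem_symTens {i : ZMod 2} {v : V} (hv : v ∈ 𝒱 i) {x : Tens 𝕜 V}
    (hx : x ∈ symTens 𝒱) : insertion 𝒱 i v x ∈ symTens 𝒱 := by
  obtain ⟨a, rfl⟩ := hx
  rw [insertion_symmetrizer hv]
  exact symmetrizer_mem _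

theorem degSucc_mem_symTens {x : Tens 𝕜 V} (hx : x ∈ symTens 𝒱) : degSucc x ∈ symTens 𝒱 := by
  obtain ⟨a, rfl⟩ := hx
  rw [degSucc_symmetrizer]
  exact symmetrizer_mem _

/-- The symmetric tensors are obtained from `1` by insertions of vectors. -/
theorem symTens_le_of_insertion {B : Submodule 𝕜 (Tens 𝕜 V)} (one : 1 ∈ B)
    (ins : ∀ i, ∀ v ∈ 𝒱 i, ∀ x ∈ symTens 𝒱, x ∈ B → insertion 𝒱 i v x ∈ B) : symTens 𝒱 ≤ B := by
  have h : ∀ (n : ℕ) (ε : Fin n → ZMod 2) (v : Fin n → V), (∀ i, v i ∈ 𝒱 (ε i)) →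
      symmetrizer 𝒱 (elem v) ∈ B := by
    intro n
    induction n with
    | zero =>
      intro ε v _
      rwa [elem_zero, symmetrizer_one]
    | succ n ih =>
      intro ε v hv
      rw [← Fin.cons_self_tail v, elem_cons, symmetrizer_mul_elem (hv 0)
        (ε := Fin.tail ε) (w := Fin.tail v) fun j => hv j.succ]
      exact B.smul_mem _ (ins _ _ (hv 0) _ (symmetrizer_mem _)
        (ih (Fin.tail ε) (Fin.tail v) fun j => hv j.succ))
  rintro _ ⟨a, rfl⟩
  induction a using Tens.span_elem 𝒱 with
  | add a b ha hb => rw [map_add]; exact B.add_mem ha hb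
  | smul c a ha => rw [map_smul]; exact B.smul_mem c ha
  | elem n ε v hv => exact h n ε v hv

variable (𝒱) in
/-- The signed replacement by `v`, of parity `i`, of one factor, which an even functional `φ`
turns into a scalar: `w₁ ⋯ wₙ ↦ ∑ₖ (-1)^{v (w₁ + ⋯ + wₖ₋₁)} φ(wₖ) w₁ ⋯ v ⋯ wₙ`, with `v` at
place `k`. -/
def replacement (φ : V →ₗ[𝕜] 𝕜) (i : ZMod 2) (v : V) : Tens 𝕜 V →ₗ[𝕜] Tens 𝕜 V :=
  leftRec 0 (φ.smulRight (tensOf v)) (signMap 𝒱 i)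

theorem replacement_one (φ : V →ₗ[𝕜] 𝕜) (i : ZMod 2) (v : V) :
    replacement 𝒱 φ i v 1 = 0 := leftRec_one _ _ _

theorem replacement_mul (φ : V →ₗ[𝕜] 𝕜) (i : ZMod 2) (v : V) {j : ZMod 2} {w : V} (hw : w ∈ 𝒱 j)
    (a : Tens 𝕜 V) :
    replacement 𝒱 φ i v (tensOf w * a) =
      φ w • (tensOf v * a) + koszul (𝕜 := 𝕜) i j • (tensOf w * replacement 𝒱 φ i v a) := by
  rw [replacement, leftRec_mul, signMap_of_mem i hw, map_smul, smul_mul_assoc,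
    LinearMap.smulRight_apply, smul_mul_assoc]

theorem replacement_insertion {φ : V →ₗ[𝕜] 𝕜} (hφ : IsHomFunctional 𝒱 φ 0) {i j : ZMod 2}
    {u v : V} (hv : v ∈ 𝒱 i) (hu : u ∈ 𝒱 j) (a : Tens 𝕜 V) :
    replacement 𝒱 φ i v (insertion 𝒱 j u a) =
      koszul (𝕜 := 𝕜) i j • insertion 𝒱 j u (replacement 𝒱 φ i v a) +
        φ u • insertion 𝒱 i v a := by
  refine LinearMap.congr_fun (f := replacement 𝒱 φ i v ∘ₗ insertion 𝒱 j u)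
    (g := koszul (𝕜 := 𝕜) i j • insertion 𝒱 j u ∘ₗ replacement 𝒱 φ i v + φ u • insertion 𝒱 i v)
    (Tens.ext_left 𝒱 ?_ fun k x hx a h => ?_) a
  · simp only [LinearMap.comp_apply, LinearMap.add_apply, LinearMap.smul_apply, insertion_one,
      replacement_one]
    rw [← mul_one (tensOf u), replacement_mul _ _ _ hu, replacement_one]
    simp
  · simp only [LinearMap.comp_apply, LinearMap.add_apply, LinearMap.smul_apply] at h ⊢
    simp only [insertion_mul _ _ hx, replacement_mul _ _ _ hx, replacement_mul _ _ _ hu, map_add,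
      map_smul, h, insertion_mul _ _ hv, mul_add, mul_smul_comm, koszul_comm j i]
    have h1 := hφ.koszul_mul_apply hx j
    have h2 := hφ.koszul_mul_apply hu k
    have h3 := koszul_mul_self (𝕜 := 𝕜) i j
    rw [koszul_zero_left, koszul_comm k j] at h1
    rw [koszul_zero_left] at h2
    linear_combination (norm := module) h1 • (tensOf v * insertion 𝒱 j u a) -
      (φ x • h3) • (tensOf v * insertion 𝒱 j u a) +
      (koszul (𝕜 := 𝕜) i k • h2) • (tensOf x * insertion 𝒱 i v a)

theorem contr_insertion {φ : V →ₗ[𝕜] 𝕜} (hφ : IsHomFunctional 𝒱 φ 0) {i : ZMod 2} {v : V}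
    (hv : v ∈ 𝒱 i) (a : Tens 𝕜 V) :
    contr 𝒱 φ (insertion 𝒱 i v a) =
      insertion 𝒱 i v (contr 𝒱 φ a) + φ v • degSucc a + replacement 𝒱 φ i v a := by
  refine LinearMap.congr_fun (f := contr 𝒱 φ ∘ₗ insertion 𝒱 i v)
    (g := insertion 𝒱 i v ∘ₗ contr 𝒱 φ + φ v • degSucc + replacement 𝒱 φ i v)
    (Tens.ext_left 𝒱 ?_ fun k x hx a h => ?_) a
  · simp only [LinearMap.comp_apply, LinearMap.add_apply, LinearMap.smul_apply, insertion_one,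
      replacement_one, contr_one, map_zero, degSucc_one]
    rw [← mul_one (tensOf v), contr_tensOf_mul hφ hv, contr_one]
    simp
  · simp only [LinearMap.comp_apply, LinearMap.add_apply, LinearMap.smul_apply] at h ⊢
    simp only [insertion_mul _ _ hx, replacement_mul _ _ _ hx, contr_tensOf_mul hφ hv,
      contr_tensOf_mul hφ hx,
      map_add, map_smul, h, degSucc_mul, mul_add, mul_smul_comm, koszul_zero_left]
    have h1 := hφ.koszul_mul_apply hx i
    have h2 := hφ.koszul_mul_apply hv k
    rw [koszul_zero_left, koszul_comm k i] at h1
    rw [koszul_zero_left] at h2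
    linear_combination (norm := module) h1 • insertion 𝒱 i v a + h2 • (tensOf x * degSucc a)

/-- The terms by which translation fails to commute with the insertion of `v` are again built from
operations that preserve symmetric tensors; this is why translations preserve them. -/
theorem translate_insertion {φ : V →ₗ[𝕜] 𝕜} (hφ : IsHomFunctional 𝒱 φ 0) {i : ZMod 2} {v : V}
    (hv : v ∈ 𝒱 i) (a : Tens 𝕜 V) :
    translate φ (insertion 𝒱 i v a) =
      insertion 𝒱 i v (translate φ a) + φ v • degSucc (translate φ a) +
        replacement 𝒱 φ i v (translate φ a) + φ v • contr 𝒱 φ (translate φ a) := by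
  refine LinearMap.congr_fun (f := (translate φ).toLinearMap ∘ₗ insertion 𝒱 i v)
    (g := (insertion 𝒱 i v + φ v • degSucc + replacement 𝒱 φ i v + φ v • contr 𝒱 φ) ∘ₗ
      (translate φ).toLinearMap)
    (Tens.ext_left 𝒱 ?_ fun k x hx a h => ?_) a
  · simp only [LinearMap.comp_apply, LinearMap.add_apply, LinearMap.smul_apply, insertion_one,
      replacement_one, contr_one, degSucc_one, AlgHom.toLinearMap_apply, map_one, translate_tensOf]
    simp
  · simp only [LinearMap.comp_apply, LinearMap.add_apply, LinearMap.smul_apply,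
      AlgHom.toLinearMap_apply] at h ⊢
    simp only [insertion_mul _ _ hx, replacement_mul _ _ _ hx, contr_tensOf_mul hφ hx,
      translate_tensOf,
      map_add, map_smul, map_mul, h, degSucc_mul, mul_add, add_mul, smul_mul_assoc, one_mul,
      mul_smul_comm, koszul_zero_left]
    have h1 := hφ.koszul_mul_apply hx i
    have h2 := hφ.koszul_mul_apply hv k
    rw [koszul_zero_left, koszul_comm k i] at h1
    rw [koszul_zero_left] at h2
    generalize translate φ a = b
    linear_combination (norm := module) h1 • insertion 𝒱 i v b + h2 • (tensOf x * degSucc b) +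
      (φ x • h2) • degSucc b + h1 • replacement 𝒱 φ i v b + h2 • (tensOf x * contr 𝒱 φ b) +
      (φ x • h2) • contr 𝒱 φ b

theorem replacement_mem_symTens {φ : V →ₗ[𝕜] 𝕜} (hφ : IsHomFunctional 𝒱 φ 0) {i : ZMod 2} {v : V}
    (hv : v ∈ 𝒱 i) {x : Tens 𝕜 V} (hx : x ∈ symTens 𝒱) : replacement 𝒱 φ i v x ∈ symTens 𝒱 := by
  refine symTens_le_of_insertion (B := (symTens 𝒱).comap (replacement 𝒱 φ i v)) ?_ ?_ hx
  · change replacement 𝒱 φ i v 1 ∈ symTens 𝒱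
    rw [replacement_one]
    exact zero_mem _
  · intro j u hu y hy h
    change replacement 𝒱 φ i v _ ∈ symTens 𝒱
    rw [replacement_insertion hφ hv hu]
    exact add_mem (Submodule.smul_mem _ _ (insertion_mem_symTens hu h))
      (Submodule.smul_mem _ _ (insertion_mem_symTens hv hy))

theorem contr_mem_symTens {φ : V →ₗ[𝕜] 𝕜} (hφ : IsHomFunctional 𝒱 φ 0) {x : Tens 𝕜 V}
    (hx : x ∈ symTens 𝒱) : contr 𝒱 φ x ∈ symTens 𝒱 := by
  refine symTens_le_of_insertion (B := (symTens 𝒱).comap (contr 𝒱 φ)) ?_ ?_ hx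
  · change contr 𝒱 φ 1 ∈ symTens 𝒱
    rw [contr_one]
    exact zero_mem _
  · intro j u hu y hy h
    change contr 𝒱 φ _ ∈ symTens 𝒱
    rw [contr_insertion hφ hu]
    exact add_mem (add_mem (insertion_mem_symTens hu h)
      (Submodule.smul_mem _ _ (degSucc_mem_symTens hy))) (replacement_mem_symTens hφ hu hy)

/-- Translations by even functionals preserve the symmetric tensors. -/
theorem translate_mem_symTens {φ : V →ₗ[𝕜] 𝕜} (hφ : IsHomFunctional 𝒱 φ 0) {x : Tens 𝕜 V}
    (hx : x ∈ symTens 𝒱) : translate φ x ∈ symTens 𝒱 := by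
  refine symTens_le_of_insertion (B := (symTens 𝒱).comap (translate φ).toLinearMap) ?_ ?_ hx
  · change translate φ 1 ∈ symTens 𝒱
    rw [map_one]
    exact one_mem_symTens 𝒱
  · intro i v hv y _ h
    change translate φ _ ∈ symTens 𝒱
    change translate φ y ∈ symTens 𝒱 at h
    rw [translate_insertion hφ hv]
    exact add_mem (add_mem (add_mem (insertion_mem_symTens hv h)
      (Submodule.smul_mem _ _ (degSucc_mem_symTens h))) (replacement_mem_symTens hφ hv h))
      (Submodule.smul_mem _ _ (contr_mem_symTens hφ h))

/-! ### Powers of an even vector -/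

theorem contr_tensOf_pow {f : V →ₗ[𝕜] 𝕜} (hf : IsHomFunctional 𝒱 f 0) {w : V} (hw : w ∈ 𝒱 0)
    (n : ℕ) : contr 𝒱 f ((tensOf w : Tens 𝕜 V) ^ (n + 1)) =
      (((n + 1 : ℕ) : 𝕜) * f w) • (tensOf w : Tens 𝕜 V) ^ n := by
  induction n with
  | zero =>
    rw [pow_succ', contr_tensOf_mul hf hw, pow_zero, contr_one]
    simp
  | succ n ih =>
    rw [pow_succ', contr_tensOf_mul hf hw, ih, koszul_zero_left, mul_smul_comm, ← pow_succ',
      Nat.cast_succ (n + 1)]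
    module

theorem tensOf_pow_eq_elem (w : V) (n : ℕ) :
    (tensOf w : Tens 𝕜 V) ^ n = elem fun _ : Fin n => w := by
  induction n with
  | zero => rw [pow_zero, elem_zero]
  | succ n ih =>
    rw [pow_succ', ih, ← elem_cons]
    congr 1
    funext j
    refine Fin.cases ?_ (fun j => ?_) j <;> simp

theorem tensOf_pow_mem_symTens {w : V} (hw : w ∈ 𝒱 0) (n : ℕ) :
    (tensOf w : Tens 𝕜 V) ^ n ∈ symTens 𝒱 := by
  have key : ∀ n : ℕ, insertion 𝒱 0 w ((tensOf w : Tens 𝕜 V) ^ n) =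
      ((n + 1 : ℕ) : 𝕜) • (tensOf w : Tens 𝕜 V) ^ (n + 1) := by
    intro n
    induction n with
    | zero => simp [insertion_one]
    | succ n ih =>
      rw [pow_succ', insertion_mul _ _ hw, ih, koszul_zero_left, mul_smul_comm, ← pow_succ',
        ← pow_succ', Nat.cast_succ (n + 1)]
      module
  induction n with
  | zero => rw [pow_zero]; exact one_mem_symTens 𝒱
  | succ n ih =>
    have := insertion_mem_symTens hw ih
    rw [key] at this
    exact (Submodule.smul_mem_iff _ (Nat.cast_ne_zero.mpr n.succ_ne_zero)).mp this

end Translate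

section Estimates

variable {𝕜 : Type*} [RCLike 𝕜] {V : Type*} [AddCommGroup V] [Module 𝕜 V]

/-! ### Estimates for the projective seminorms -/

theorem seminorm_sum_le {E ι : Type*} [AddCommGroup E] [Module 𝕜 E] (q : Seminorm 𝕜 E)
    (s : Finset ι) (f : ι → E) : q (∑ i ∈ s, f i) ≤ ∑ i ∈ s, q (f i) :=
  Finset.le_sum_of_subadditive q (map_zero q).le (map_add_le_add q) s f

theorem powSeminorm_apply (p : Seminorm 𝕜 V) {n : ℕ} (x : ⨂[𝕜]^n V) :
    powSeminorm p n x = ⨅ q : PiTensorProduct.lifts x, piCost p q.1 := rfl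

theorem powSeminorm_tprod_le (p : Seminorm 𝕜 V) {n : ℕ} (v : Fin n → V) :
    powSeminorm p n (PiTensorProduct.tprod 𝕜 v) ≤ ∏ i, p (v i) := by
  refine ciInf_le_of_le (piCost_bddBelow p _) ⟨FreeAddMonoid.of (1, v), ?_⟩ ?_
  · rw [PiTensorProduct.mem_lifts_iff]
    simp
  · simp [piCost]

/-- The projective seminorm is the largest seminorm that is bounded by `p ⋯ p` on elementary
tensors. -/
theorem le_powSeminorm {p : Seminorm 𝕜 V} {n : ℕ} {q : Seminorm 𝕜 (⨂[𝕜]^n V)} {C : ℝ}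
    (hC : 0 ≤ C) (h : ∀ v : Fin n → V, q (PiTensorProduct.tprod 𝕜 v) ≤ C * ∏ i, p (v i))
    (x : ⨂[𝕜]^n V) : q x ≤ C * powSeminorm p n x := by
  have := (PiTensorProduct.nonempty_lifts x).to_subtype
  rw [powSeminorm_apply, Real.mul_iInf_of_nonneg hC]
  refine le_ciInf fun l => ?_
  have hl := (PiTensorProduct.mem_lifts_iff x l.1).mp l.2
  rw [piCost]
  have hq := congrArg q hl.symm
  rw [hq]
  clear hq hl
  generalize FreeAddMonoid.toList l.1 = L
  induction L with
  | nil => simp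
  | cons y L ih =>
    rw [List.map_cons, List.sum_cons, List.map_cons, List.sum_cons, mul_add]
    refine (map_add_le_add q _ _).trans (add_le_add ?_ ih)
    rw [map_smul_eq_mul]
    refine (mul_le_mul_of_nonneg_left (h y.2) (norm_nonneg _)).trans (le_of_eq ?_)
    ring

theorem weightedSeminorm_apply (p : Seminorm 𝕜 V) (R : ℝ) (a : Tens 𝕜 V) :
    weightedSeminorm p R a = ∑' n : ℕ, powSeminorm p n (a n) * (n.factorial : ℝ) ^ R := rfl

theorem weightedSeminorm_lof (p : Seminorm 𝕜 V) (R : ℝ) (n : ℕ) (x : ⨂[𝕜]^n V) :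
    weightedSeminorm p R (DirectSum.lof 𝕜 ℕ (fun n => ⨂[𝕜]^n V) n x) =
      powSeminorm p n x * (n.factorial : ℝ) ^ R := by
  rw [weightedSeminorm_apply, tsum_eq_single n]
  · rw [DirectSum.lof_apply]
  · intro m hm
    have : DirectSum.lof 𝕜 ℕ (fun n => ⨂[𝕜]^n V) n x m = 0 :=
      DirectSum.of_eq_of_ne _ _ _ hm
    rw [this, map_zero, zero_mul]

theorem weightedSeminorm_elem_le (p : Seminorm 𝕜 V) (R : ℝ) {n : ℕ} (v : Fin n → V) :
    weightedSeminorm p R (elem v : Tens 𝕜 V) ≤ (n.factorial : ℝ) ^ R * ∏ i, p (v i) := by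
  rw [elem, weightedSeminorm_lof, mul_comm]
  exact mul_le_mul_of_nonneg_left (powSeminorm_tprod_le p v) (by positivity)

/-- A seminorm on the tensor algebra is bounded by `p_R` if it is on elementary tensors. -/
theorem le_weightedSeminorm {p : Seminorm 𝕜 V} {R : ℝ} {q : Seminorm 𝕜 (Tens 𝕜 V)} {C : ℝ}
    (hC : 0 ≤ C)
    (h : ∀ (n : ℕ) (v : Fin n → V), q (elem v) ≤ C * ((n.factorial : ℝ) ^ R * ∏ i, p (v i)))
    (a : Tens 𝕜 V) : q a ≤ C * weightedSeminorm p R a := by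
  classical
  have hn : ∀ n (x : ⨂[𝕜]^n V), q (DirectSum.lof 𝕜 ℕ (fun n => ⨂[𝕜]^n V) n x) ≤
      C * (powSeminorm p n x * (n.factorial : ℝ) ^ R) := by
    intro n x
    have := le_powSeminorm (p := p) (C := C * (n.factorial : ℝ) ^ R)
      (q := q.comp (DirectSum.lof 𝕜 ℕ (fun n => ⨂[𝕜]^n V) n)) (by positivity)
      (fun v => (h n v).trans_eq (by ring)) x
    exact this.trans_eq (by ring)
  have hs : weightedSeminorm p R a = ∑ n ∈ DFinsupp.support a,
      powSeminorm p n (a n) * (n.factorial : ℝ) ^ R := by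
    rw [weightedSeminorm_apply]
    refine tsum_eq_sum fun n hn => ?_
    have : a n = 0 := by simpa using hn
    simp [this]
  conv_lhs => rw [← DirectSum.sum_support_of a]
  rw [hs, Finset.mul_sum]
  refine (seminorm_sum_le q _ _).trans (Finset.sum_le_sum fun n _ => ?_)
  exact hn n (a n)

/-- A bilinear map on the tensor algebra is bounded for `p_R` if it is on elementary tensors. -/
theorem bilin_le_weightedSeminorm {p : Seminorm 𝕜 V} {R : ℝ} {q : Seminorm 𝕜 (Tens 𝕜 V)}
    {B : Tens 𝕜 V →ₗ[𝕜] Tens 𝕜 V →ₗ[𝕜] Tens 𝕜 V}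
    (h : ∀ (n m : ℕ) (v : Fin n → V) (w : Fin m → V), q (B (elem v) (elem w)) ≤
      ((n.factorial : ℝ) ^ R * ∏ i, p (v i)) * ((m.factorial : ℝ) ^ R * ∏ j, p (w j)))
    (a b : Tens 𝕜 V) : q (B a b) ≤ weightedSeminorm p R a * weightedSeminorm p R b := by
  have hp : ∀ (n : ℕ) (v : Fin n → V), 0 ≤ ∏ i, p (v i) := fun n v =>
    Finset.prod_nonneg fun i _ => apply_nonneg p _
  have h1 : ∀ (n : ℕ) (v : Fin n → V), q (B (elem v) b) ≤
      ((n.factorial : ℝ) ^ R * ∏ i, p (v i)) * weightedSeminorm p R b := fun n v =>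
    le_weightedSeminorm (q := q.comp (B (elem v))) (mul_nonneg (by positivity) (hp n v))
      (fun m w => h n m v w) b
  have h2 := le_weightedSeminorm (p := p) (R := R) (q := q.comp (B.flip b))
    (apply_nonneg (weightedSeminorm p R) b) (fun n v => (h1 n v).trans_eq (mul_comm _ _)) a
  exact h2.trans_eq (mul_comm _ _)

variable {𝒱 : ZMod 2 → Submodule 𝕜 V} [DirectSum.Decomposition 𝒱]

/-! ### Adapted seminorms and the powers of `P_Λ` -/

variable (𝒱) in
/-- A seminorm is adapted to the grading if `p(v) = p(v₀) + p(v₁)`. -/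
def IsAdapted (p : Seminorm 𝕜 V) : Prop := ∀ v, ∑ i, p (parityProj 𝒱 i v) = p v

theorem IsAdapted.sum_prod {p : Seminorm 𝕜 V} (hp : IsAdapted 𝒱 p) {n : ℕ} (v : Fin n → V) :
    ∑ η : Fin n → ZMod 2, ∏ i, p (parityProj 𝒱 (η i) (v i)) = ∏ i, p (v i) := by
  simp only [← hp (v _)]
  rw [Finset.prod_univ_sum, Fintype.piFinset_univ]

theorem norm_permSign {n : ℕ} (ε : Fin n → ZMod 2) (σ : Equiv.Perm (Fin n)) :
    ‖(permSign ε σ : 𝕜)‖ = 1 := by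
  rw [permSign, norm_prod]
  refine Finset.prod_eq_one fun i _ => ?_
  rw [norm_prod]
  refine Finset.prod_eq_one fun j _ => ?_
  split_ifs
  · exact norm_koszul _ _
  · exact norm_one

theorem IsAdapted.powSeminorm_symmetrizerPow_le {p : Seminorm 𝕜 V} (hp : IsAdapted 𝒱 p) {n : ℕ}
    (v : Fin n → V) :
    powSeminorm p n (symmetrizerPow 𝒱 n (PiTensorProduct.tprod 𝕜 v)) ≤ ∏ i, p (v i) := by
  have h : ∀ σ : Equiv.Perm (Fin n),
      powSeminorm p n (permAct 𝒱 σ (PiTensorProduct.tprod 𝕜 v)) ≤ ∏ i, p (v i) := by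
    intro σ
    rw [permAct, LinearMap.sum_apply]
    refine (seminorm_sum_le _ _ _).trans ?_
    rw [← hp.sum_prod v]
    refine Finset.sum_le_sum fun η _ => ?_
    rw [LinearMap.smul_apply, map_smul_eq_mul, norm_permSign, one_mul, LinearMap.comp_apply,
      multiProj, PiTensorProduct.map_tprod, LinearEquiv.coe_coe]
    have hr : PiTensorProduct.reindex 𝕜 (fun _ : Fin n => V) σ.symm
        (PiTensorProduct.tprod 𝕜 fun i => parityProj 𝒱 (η i) (v i)) =
        PiTensorProduct.tprod 𝕜 fun i => parityProj 𝒱 (η (σ i)) (v (σ i)) :=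
      PiTensorProduct.reindex_tprod _ _
    rw [hr]
    refine (powSeminorm_tprod_le p _).trans (le_of_eq ?_)
    exact Equiv.prod_comp σ fun i => p (parityProj 𝒱 (η i) (v i))
  rw [symmetrizerPow, LinearMap.smul_apply, map_smul_eq_mul, LinearMap.sum_apply]
  have h1 : powSeminorm p n (∑ σ : Equiv.Perm (Fin n), permAct 𝒱 σ (PiTensorProduct.tprod 𝕜 v)) ≤
      n.factorial * ∏ i, p (v i) := by
    refine (seminorm_sum_le _ _ _).trans ((Finset.sum_le_sum fun σ _ => h σ).trans_eq ?_)
    simp [Fintype.card_perm]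
  refine (mul_le_mul_of_nonneg_left h1 (norm_nonneg _)).trans_eq ?_
  have h2 : (n.factorial : ℝ) ≠ 0 := Nat.cast_ne_zero.mpr n.factorial_ne_zero
  rw [norm_inv, RCLike.norm_natCast, inv_mul_cancel_left₀ h2]

theorem IsAdapted.weightedSeminorm_symmetrizer_elem_le {p : Seminorm 𝕜 V} (hp : IsAdapted 𝒱 p)
    (R : ℝ) {n : ℕ} (v : Fin n → V) :
    weightedSeminorm p R (symmetrizer 𝒱 (elem v)) ≤ (n.factorial : ℝ) ^ R * ∏ i, p (v i) := by
  rw [elem, symmetrizer_lof_eq, weightedSeminorm_lof, mul_comm]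
  exact mul_le_mul_of_nonneg_left (hp.powSeminorm_symmetrizerPow_le v) (by positivity)

omit [AddCommGroup V] in
theorem prod_removeNth (f : V → ℝ) {n : ℕ} (v : Fin (n + 1) → V) (k : Fin (n + 1)) :
    f (v k) * ∏ j, f (k.removeNth v j) = ∏ j, f (v j) := by
  rw [Fin.prod_univ_succAbove _ k]
  rfl

variable {Λ : V →ₗ[𝕜] V →ₗ[𝕜] 𝕜}

theorem P_elem_tmul_elem {n m : ℕ} (v : Fin (n + 1) → V) (w : Fin (m + 1) → V) :
    P 𝒱 Λ (elem v ⊗ₜ elem w) = ∑ l, ∑ θ : Fin (m + 1) → ZMod 2, ∑ k, ∑ η : Fin (n + 1) → ZMod 2,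
      ((∏ j ∈ Finset.Iio l, koszul (𝕜 := 𝕜) (θ l) (θ j)) *
        (∏ j ∈ Finset.Ioi k, koszul (𝕜 := 𝕜) (η k) (η j)) *
        Λ (parityProj 𝒱 (η k) (v k)) (parityProj 𝒱 (θ l) (w l))) •
      ((elem (k.removeNth fun j => parityProj 𝒱 (η j) (v j)) : Tens 𝕜 V) ⊗ₜ[𝕜]
        (elem (l.removeNth fun j => parityProj 𝒱 (θ j) (w j)) : Tens 𝕜 V)) := by
  simp only [P, LinearMap.comp_apply, TensorProduct.map_tmul, pullRight_elem_eq, pullLeft_elem_eq,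
    TensorProduct.sum_tmul, TensorProduct.tmul_sum, map_sum]
  refine Finset.sum_congr rfl fun l _ => Finset.sum_congr rfl fun θ _ =>
    Finset.sum_congr rfl fun k _ => Finset.sum_congr rfl fun η _ => ?_
  simp [smul_smul, ← TensorProduct.smul_tmul', TensorProduct.tmul_smul]

theorem seminorm_P_elem_le {p : Seminorm 𝕜 V} (hp : IsAdapted 𝒱 p)
    (hΛp : ∀ v w, ‖Λ v w‖ ≤ p v * p w) {q : Seminorm 𝕜 (Tens 𝕜 V ⊗[𝕜] Tens 𝕜 V)} {n m : ℕ} {C : ℝ}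
    (h : ∀ (v : Fin n → V) (w : Fin m → V),
      q (elem v ⊗ₜ elem w) ≤ C * ((∏ i, p (v i)) * ∏ j, p (w j)))
    (v : Fin (n + 1) → V) (w : Fin (m + 1) → V) :
    q (P 𝒱 Λ (elem v ⊗ₜ elem w)) ≤
      ((n + 1 : ℕ) * (m + 1 : ℕ) * C) * ((∏ i, p (v i)) * ∏ j, p (w j)) := by
  have key : ∀ (k : Fin (n + 1)) (η : Fin (n + 1) → ZMod 2) (l : Fin (m + 1))
      (θ : Fin (m + 1) → ZMod 2),
      q (((∏ j ∈ Finset.Iio l, koszul (𝕜 := 𝕜) (θ l) (θ j)) *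
        (∏ j ∈ Finset.Ioi k, koszul (𝕜 := 𝕜) (η k) (η j)) *
        Λ (parityProj 𝒱 (η k) (v k)) (parityProj 𝒱 (θ l) (w l))) •
      ((elem (k.removeNth fun j => parityProj 𝒱 (η j) (v j)) : Tens 𝕜 V) ⊗ₜ[𝕜]
        (elem (l.removeNth fun j => parityProj 𝒱 (θ j) (w j)) : Tens 𝕜 V))) ≤
      C * ((∏ i, p (parityProj 𝒱 (η i) (v i))) * ∏ j, p (parityProj 𝒱 (θ j) (w j))) := by
    intro k η l θ
    rw [map_smul_eq_mul, norm_mul, norm_mul, norm_prod, norm_prod]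
    simp only [norm_koszul, Finset.prod_const_one, one_mul]
    refine (mul_le_mul (hΛp _ _) (h _ _) (apply_nonneg q _)
      (mul_nonneg (apply_nonneg p _) (apply_nonneg p _))).trans (le_of_eq ?_)
    rw [← prod_removeNth p (fun j => parityProj 𝒱 (η j) (v j)) k,
      ← prod_removeNth p (fun j => parityProj 𝒱 (θ j) (w j)) l]
    ring
  rw [P_elem_tmul_elem]
  calc q _ ≤ ∑ l : Fin (m + 1), ∑ θ : Fin (m + 1) → ZMod 2, ∑ k : Fin (n + 1),
        ∑ η : Fin (n + 1) → ZMod 2,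
        C * ((∏ i, p (parityProj 𝒱 (η i) (v i))) * ∏ j, p (parityProj 𝒱 (θ j) (w j))) := by
        refine (seminorm_sum_le _ _ _).trans (Finset.sum_le_sum fun l _ => ?_)
        refine (seminorm_sum_le _ _ _).trans (Finset.sum_le_sum fun θ _ => ?_)
        refine (seminorm_sum_le _ _ _).trans (Finset.sum_le_sum fun k _ => ?_)
        exact (seminorm_sum_le _ _ _).trans (Finset.sum_le_sum fun η _ => key k η l θ)
    _ = _ := by
        simp only [← Finset.mul_sum, hp.sum_prod, ← Finset.sum_mul, Finset.sum_const,
          Finset.card_univ, Fintype.card_fin, nsmul_eq_mul]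
        ring

theorem seminorm_P_pow_elem_le {p : Seminorm 𝕜 V} (hp : IsAdapted 𝒱 p)
    (hΛp : ∀ v w, ‖Λ v w‖ ≤ p v * p w) {q : Seminorm 𝕜 (Tens 𝕜 V ⊗[𝕜] Tens 𝕜 V)} {n m : ℕ} {C : ℝ}
    (h : ∀ (v : Fin n → V) (w : Fin m → V),
      q (elem v ⊗ₜ elem w) ≤ C * ((∏ i, p (v i)) * ∏ j, p (w j)))
    (k : ℕ) (v : Fin (n + k) → V) (w : Fin (m + k) → V) :
    q ((P 𝒱 Λ ^ k) (elem v ⊗ₜ elem w)) ≤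
      (((n + 1).ascFactorial k * (m + 1).ascFactorial k : ℕ) * C) *
        ((∏ i, p (v i)) * ∏ j, p (w j)) := by
  induction k with
  | zero => simpa using h v w
  | succ k ih =>
    rw [pow_succ, Module.End.mul_apply]
    refine (seminorm_P_elem_le hp hΛp (q := q.comp (P 𝒱 Λ ^ k))
      (C := ((n + 1).ascFactorial k * (m + 1).ascFactorial k : ℕ) * C)
      ih v w).trans_eq ?_
    change _ * ((∏ i : Fin (n + (k + 1)), p (v i)) * ∏ j : Fin (m + (k + 1)), p (w j)) = _
    congr 1
    rw [Nat.ascFactorial_succ, Nat.ascFactorial_succ]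
    push_cast
    ring

theorem P_pow_elem_eq_zero {n m k : ℕ} (v : Fin n → V) (w : Fin m → V) (hk : min n m < k) :
    (P 𝒱 Λ ^ k) (elem v ⊗ₜ elem w) = 0 := by
  induction k generalizing n m with
  | zero => exact absurd hk (Nat.not_lt_zero _)
  | succ k ih =>
    rw [pow_succ, Module.End.mul_apply]
    rcases n with _ | n
    · rw [elem_zero, P_one_tmul, map_zero]
    rcases m with _ | m
    · rw [elem_zero w, P_tmul_one, map_zero]
    rw [P_elem_tmul_elem]
    simp only [map_sum, map_smul]
    refine Finset.sum_eq_zero fun _ _ => Finset.sum_eq_zero fun _ _ =>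
      Finset.sum_eq_zero fun _ _ => Finset.sum_eq_zero fun _ _ => ?_
    rw [ih _ _ (by omega), smul_zero]

end Estimates

section StarEstimate

/-! ### Continuity of the star product -/

/-- The growth estimate behind the continuity of the star product. It is here that `R ≥ 1/2` is
needed: the `k`-th term of `e^{z P}` has `A = (n + k)! (m + k)! / (n! m!)` summands, and
`A^{1 - R} ≤ A^{1 / 2}` is at most `k!` up to exponential factors. -/
theorem factorial_growth {R : ℝ} (hR : 1 / 2 ≤ R) (hR1 : R < 1) (n m k : ℕ) :
    (k.factorial : ℝ)⁻¹ * (((n + 1).ascFactorial k * (m + 1).ascFactorial k : ℕ) *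
      ((n + m).factorial : ℝ) ^ R) ≤
      4 ^ (n + k + (m + k)) * (((n + k).factorial : ℝ) ^ R * ((m + k).factorial : ℝ) ^ R) := by
  set A : ℕ := (n + 1).ascFactorial k * (m + 1).ascFactorial k with hA
  have hA1 : (1 : ℝ) ≤ A := by
    have : 0 < A := Nat.mul_pos (Nat.ascFactorial_pos _ _) (Nat.ascFactorial_pos _ _)
    exact_mod_cast this
  have hA0 : (0 : ℝ) < A := by linarith
  have hAmul : (A : ℝ) * (n.factorial * m.factorial) = (n + k).factorial * (m + k).factorial := by
    have : A * (n.factorial * m.factorial) = (n + k).factorial * (m + k).factorial := by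
      rw [hA, ← Nat.factorial_mul_ascFactorial, ← Nat.factorial_mul_ascFactorial]
      ring
    exact_mod_cast this
  have hnm : ((n + m).factorial : ℝ) ≤ 2 ^ (n + m) * (n.factorial * m.factorial) := by
    have h1 : (n + m).factorial ≤ 2 ^ (n + m) * (n.factorial * m.factorial) := by
      rw [← Nat.add_choose_mul_factorial_mul_factorial n m, mul_assoc]
      exact Nat.mul_le_mul_right _ (Nat.choose_le_two_pow _ _)
    exact_mod_cast h1
  have hAk : (A : ℝ) ≤ (2 ^ (n + k + (m + k)) * k.factorial) ^ 2 := by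
    have h1 : A ≤ 2 ^ (n + k) * 2 ^ (m + k) * (k.factorial * k.factorial) := by
      rw [hA, Nat.ascFactorial_eq_factorial_mul_choose, Nat.ascFactorial_eq_factorial_mul_choose]
      calc _ = ((n + k).choose k * (m + k).choose k) * (k.factorial * k.factorial) := by ring
        _ ≤ _ := Nat.mul_le_mul_right _
          (Nat.mul_le_mul (Nat.choose_le_two_pow _ _) (Nat.choose_le_two_pow _ _))
    have h2 : (A : ℝ) ≤ 2 ^ (n + k) * 2 ^ (m + k) * (k.factorial * k.factorial) := by
      exact_mod_cast h1
    refine h2.trans ?_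
    rw [← pow_add, mul_pow, sq (k.factorial : ℝ)]
    refine mul_le_mul_of_nonneg_right ?_ (by positivity)
    exact le_self_pow₀ (one_le_pow₀ one_le_two) two_ne_zero
  have hAR : (A : ℝ) ^ (1 - R) ≤ 2 ^ (n + k + (m + k)) * k.factorial := by
    calc (A : ℝ) ^ (1 - R) ≤ (A : ℝ) ^ (1 / 2 : ℝ) :=
          Real.rpow_le_rpow_of_exponent_le hA1 (by linarith)
      _ = Real.sqrt A := (Real.sqrt_eq_rpow _).symm
      _ ≤ _ := Real.sqrt_le_iff.mpr ⟨by positivity, hAk⟩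
  have h1 : ((n + m).factorial : ℝ) ^ R ≤
      2 ^ (n + k + (m + k)) * ((n.factorial * m.factorial : ℝ) ^ R) := by
    calc ((n + m).factorial : ℝ) ^ R ≤ (2 ^ (n + m) * (n.factorial * m.factorial : ℝ)) ^ R :=
          Real.rpow_le_rpow (by positivity) hnm (by linarith)
      _ = (2 ^ (n + m) : ℝ) ^ R * (n.factorial * m.factorial : ℝ) ^ R :=
          Real.mul_rpow (by positivity) (by positivity)
      _ ≤ _ := by
          refine mul_le_mul_of_nonneg_right ?_ (by positivity)
          calc (2 ^ (n + m) : ℝ) ^ R ≤ (2 ^ (n + m) : ℝ) ^ (1 : ℝ) :=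
                Real.rpow_le_rpow_of_exponent_le (one_le_pow₀ one_le_two) hR1.le
            _ = 2 ^ (n + m) := Real.rpow_one _
            _ ≤ _ := pow_le_pow_right₀ one_le_two (by omega)
  have h2 : (A : ℝ) * (n.factorial * m.factorial : ℝ) ^ R =
      (A : ℝ) ^ (1 - R) * (((n + k).factorial : ℝ) ^ R * ((m + k).factorial : ℝ) ^ R) := by
    rw [← Real.mul_rpow (by positivity) (by positivity), ← hAmul,
      Real.mul_rpow hA0.le (by positivity), ← mul_assoc, ← Real.rpow_add hA0, sub_add_cancel,
      Real.rpow_one]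
  have hk : (k.factorial : ℝ) ≠ 0 := Nat.cast_ne_zero.mpr k.factorial_ne_zero
  set F : ℝ := ((n + k).factorial : ℝ) ^ R * ((m + k).factorial : ℝ) ^ R with hF
  have hF0 : 0 ≤ F := by positivity
  calc (k.factorial : ℝ)⁻¹ * (A * ((n + m).factorial : ℝ) ^ R)
      ≤ (k.factorial : ℝ)⁻¹ * (A * (2 ^ (n + k + (m + k)) *
          ((n.factorial * m.factorial : ℝ) ^ R))) := by gcongr
    _ = (k.factorial : ℝ)⁻¹ * (2 ^ (n + k + (m + k)) * ((A : ℝ) ^ (1 - R) * F)) := by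
        rw [← h2]; ring
    _ ≤ (k.factorial : ℝ)⁻¹ * (2 ^ (n + k + (m + k)) *
          ((2 ^ (n + k + (m + k)) * k.factorial) * F)) := by gcongr
    _ = 4 ^ (n + k + (m + k)) * F := by
        rw [show (4 : ℝ) = 2 * 2 by norm_num, mul_pow]
        field_simp

theorem sum_pow_le_one_add_pow {x : ℝ} (hx : 0 ≤ x) (n : ℕ) :
    ∑ k ∈ Finset.range (n + 1), x ^ k ≤ (1 + x) ^ n := by
  rw [add_comm 1 x, add_pow]
  refine Finset.sum_le_sum fun k hk => ?_
  have h : (1 : ℝ) ≤ n.choose k := by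
    exact_mod_cast Nat.choose_pos (Nat.lt_succ_iff.mp (Finset.mem_range.mp hk))
  rw [one_pow, mul_one]
  exact le_mul_of_one_le_right (pow_nonneg hx k) h

variable {𝕜 : Type*} [RCLike 𝕜] {V : Type*} [AddCommGroup V] [Module 𝕜 V]
variable {𝒱 : ZMod 2 → Submodule 𝕜 V} [DirectSum.Decomposition 𝒱]
variable {Λ : V →ₗ[𝕜] V →ₗ[𝕜] 𝕜}

theorem weightedSeminorm_starT_elem_le {R : ℝ} (hR : 1 / 2 ≤ R) (hR1 : R < 1) (z : 𝕜)
    {p : Seminorm 𝕜 V} (hp : IsAdapted 𝒱 p) (hΛp : ∀ v w, ‖Λ v w‖ ≤ p v * p w) {n m : ℕ}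
    (v : Fin n → V) (w : Fin m → V) :
    weightedSeminorm p R (symmetrizer 𝒱 (starT 𝒱 Λ z (elem v) (elem w))) ≤
      (4 * (1 + ‖z‖)) ^ (n + m) *
        (((n.factorial : ℝ) ^ R * ∏ i, p (v i)) * ((m.factorial : ℝ) ^ R * ∏ j, p (w j))) := by
  set q : Seminorm 𝕜 (Tens 𝕜 V ⊗[𝕜] Tens 𝕜 V) :=
    (weightedSeminorm p R).comp (symmetrizer 𝒱 ∘ₗ LinearMap.mul' 𝕜 (Tens 𝕜 V)) with hq
  have hqe : ∀ (n m : ℕ) (v : Fin n → V) (w : Fin m → V),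
      q (elem v ⊗ₜ elem w) ≤ ((n + m).factorial : ℝ) ^ R * ((∏ i, p (v i)) * ∏ j, p (w j)) := by
    intro n m v w
    have : q (elem v ⊗ₜ elem w) = weightedSeminorm p R (symmetrizer 𝒱 (elem (Fin.append v w))) := by
      rw [elem_append]
      rfl
    rw [this]
    refine (hp.weightedSeminorm_symmetrizer_elem_le R _).trans_eq ?_
    simp [Fin.prod_univ_add]
  set F : ℝ := ((n.factorial : ℝ) ^ R * ∏ i, p (v i)) * ((m.factorial : ℝ) ^ R * ∏ j, p (w j))
    with hF
  have hF0 : 0 ≤ F := by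
    have h1 : 0 ≤ ∏ i, p (v i) := Finset.prod_nonneg fun i _ => apply_nonneg p _
    have h2 : 0 ≤ ∏ i, p (w i) := Finset.prod_nonneg fun i _ => apply_nonneg p _
    positivity
  have hterm : ∀ k ∈ Finset.range (min n m + 1),
      q ((z ^ k / (k.factorial : 𝕜)) • (P 𝒱 Λ ^ k) (elem v ⊗ₜ elem w)) ≤
        ‖z‖ ^ k * (4 ^ (n + m) * F) := by
    intro k hk
    have hk' : k ≤ min n m := Nat.lt_succ_iff.mp (Finset.mem_range.mp hk)
    obtain ⟨n', rfl⟩ : ∃ n', n = n' + k := ⟨n - k, by omega⟩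
    obtain ⟨m', rfl⟩ : ∃ m', m = m' + k := ⟨m - k, by omega⟩
    have h1 := seminorm_P_pow_elem_le hp hΛp (hqe n' m') k v w
    have h2 : 0 ≤ (∏ i, p (v i)) * ∏ j, p (w j) :=
      mul_nonneg (Finset.prod_nonneg fun i _ => apply_nonneg p _)
        (Finset.prod_nonneg fun i _ => apply_nonneg p _)
    have h3 := factorial_growth hR hR1 n' m' k
    rw [map_smul_eq_mul, norm_div, norm_pow, RCLike.norm_natCast, div_eq_mul_inv, mul_assoc]
    refine mul_le_mul_of_nonneg_left ?_ (by positivity)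
    calc _ ≤ (k.factorial : ℝ)⁻¹ * ((((n' + 1).ascFactorial k * (m' + 1).ascFactorial k : ℕ) *
          ((n' + m').factorial : ℝ) ^ R) * ((∏ i, p (v i)) * ∏ j, p (w j))) :=
          mul_le_mul_of_nonneg_left h1 (by positivity)
      _ = ((k.factorial : ℝ)⁻¹ * (((n' + 1).ascFactorial k * (m' + 1).ascFactorial k : ℕ) *
          ((n' + m').factorial : ℝ) ^ R)) * ((∏ i, p (v i)) * ∏ j, p (w j)) := by ring
      _ ≤ _ := mul_le_mul_of_nonneg_right h3 h2
      _ = _ := by rw [hF]; ring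
  have hsum : weightedSeminorm p R (symmetrizer 𝒱 (starT 𝒱 Λ z (elem v) (elem w))) =
      q (∑ k ∈ Finset.range (min n m + 1),
        (z ^ k / (k.factorial : 𝕜)) • (P 𝒱 Λ ^ k) (elem v ⊗ₜ elem w)) := by
    rw [starT_apply, expP_eq_sum fun k hk => P_pow_elem_eq_zero v w hk]
    rfl
  rw [hsum]
  refine (seminorm_sum_le _ _ _).trans ((Finset.sum_le_sum hterm).trans ?_)
  have hz : ∑ k ∈ Finset.range (min n m + 1), ‖z‖ ^ k ≤ (1 + ‖z‖) ^ (n + m) :=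
    (sum_pow_le_one_add_pow (norm_nonneg z) _).trans
      (pow_le_pow_right₀ (by linarith [norm_nonneg z]) (by omega))
  rw [← Finset.sum_mul, mul_pow]
  calc _ ≤ (1 + ‖z‖) ^ (n + m) * (4 ^ (n + m) * F) :=
        mul_le_mul_of_nonneg_right hz (mul_nonneg (by positivity) hF0)
    _ = _ := by ring

theorem weightedSeminorm_starT_le {R : ℝ} (hR : 1 / 2 ≤ R) (hR1 : R < 1) (z : 𝕜)
    {p : Seminorm 𝕜 V} (hp : IsAdapted 𝒱 p) (hΛp : ∀ v w, ‖Λ v w‖ ≤ p v * p w)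
    {c : NNReal} (hc : (c : ℝ) = 4 * (1 + ‖z‖)) (a b : Tens 𝕜 V) :
    weightedSeminorm p R (symmetrizer 𝒱 (starT 𝒱 Λ z a b)) ≤
      weightedSeminorm (c • p) R a * weightedSeminorm (c • p) R b := by
  refine bilin_le_weightedSeminorm (q := (weightedSeminorm p R).comp (symmetrizer 𝒱))
    (B := starT 𝒱 Λ z) (fun n m v w => ?_) a b
  refine (weightedSeminorm_starT_elem_le hR hR1 z hp hΛp v w).trans_eq ?_
  have h : ∀ (n : ℕ) (v : Fin n → V), ∏ i, (c • p) (v i) = (4 * (1 + ‖z‖)) ^ n * ∏ i, p (v i) := by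
    intro n v
    simp only [smul_apply, NNReal.smul_def, smul_eq_mul, Finset.prod_mul_distrib, hc,
      Finset.prod_const, Finset.card_univ, Fintype.card_fin, mul_pow]
  rw [h, h, pow_add]
  ring

theorem weightedSeminorm_mono {p q : Seminorm 𝕜 V} (h : p ≤ q) (R : ℝ) :
    weightedSeminorm p R ≤ weightedSeminorm q R := by
  intro a
  refine (le_weightedSeminorm (p := q) (R := R) zero_le_one (fun n v => ?_) a).trans_eq (one_mul _)
  rw [one_mul]
  refine (weightedSeminorm_elem_le p R v).trans ?_
  refine mul_le_mul_of_nonneg_left ?_ (by positivity)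
  exact Finset.prod_le_prod (fun i _ => apply_nonneg p _) fun i _ => h _

variable [TopologicalSpace V]

/-- A jointly continuous bilinear form on a locally convex space is bounded by a continuous
seminorm. -/
theorem exists_seminorm_bilin_le [PolynormableSpace 𝕜 V] [IsTopologicalAddGroup V]
    (hΛc : Continuous fun x : V × V => Λ x.1 x.2) :
    ∃ r : Seminorm 𝕜 V, Continuous r ∧ ∀ v w, ‖Λ v w‖ ≤ r v * r w := by
  have hU : {x : V × V | ‖Λ x.1 x.2‖ < 1} ∈ nhds (0 : V × V) := by
    refine (isOpen_lt hΛc.norm continuous_const).mem_nhds ?_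
    simp
  rw [show (0 : V × V) = (0, 0) from rfl, mem_nhds_prod_iff] at hU
  obtain ⟨U, hU, W, hW, hUW⟩ := hU
  obtain ⟨s, ε, hε, hs⟩ := ((PolynormableSpace.withSeminorms 𝕜 V).mem_nhds_iff 0 _).mp
    (Filter.inter_mem hU hW)
  set r₀ : Seminorm 𝕜 V := s.sup fun p => (p : Seminorm 𝕜 V) with hr₀
  have hr₀c : Continuous r₀ := Seminorm.continuous_finsetSup fun p _ => p.2
  have hr₀U : ∀ v, r₀ v < ε → v ∈ U ∧ v ∈ W := fun v hv => hs (by rwa [Seminorm.mem_ball_zero])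
  set e : NNReal := ⟨ε, hε.le⟩⁻¹ with he
  have hr : ∀ v, (e • r₀) v = ε⁻¹ * r₀ v := fun v => rfl
  refine ⟨e • r₀, (hr₀c.const_smul e : _), fun v w => ?_⟩
  have hscale : ∀ (v : V) (t : ℝ), 0 < t → (e • r₀) v < t → r₀ ((t⁻¹ : 𝕜) • v) < ε := by
    intro v t ht hv
    rw [hr, inv_mul_lt_iff₀ hε] at hv
    rw [map_smul_eq_mul, norm_inv, RCLike.norm_ofReal, abs_of_pos ht, inv_mul_lt_iff₀ ht]
    linarith
  have hlt : ∀ s t : ℝ, 0 < s → 0 < t → (e • r₀) v < s → (e • r₀) w < t →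
      ‖Λ v w‖ ≤ s * t := by
    intro s t hs ht hv hw
    have h := hUW (Set.mk_mem_prod (hr₀U _ (hscale v s hs hv)).1 (hr₀U _ (hscale w t ht hw)).2)
    simp only [Set.mem_ofPred_eq, map_smul, LinearMap.smul_apply, smul_eq_mul, norm_mul, norm_inv,
      RCLike.norm_ofReal, abs_of_pos hs, abs_of_pos ht] at h
    rw [inv_mul_lt_iff₀ ht, inv_mul_lt_iff₀ hs] at h
    linarith
  have hlim : Filter.Tendsto (fun δ : ℝ => ((e • r₀) v + δ) * ((e • r₀) w + δ))
      (nhdsWithin 0 (Set.Ioi 0)) (nhds ((e • r₀) v * (e • r₀) w)) := by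
    have : Continuous fun δ : ℝ => ((e • r₀) v + δ) * ((e • r₀) w + δ) := by fun_prop
    simpa using (this.tendsto 0).mono_left nhdsWithin_le_nhds
  refine ge_of_tendsto hlim ?_
  filter_upwards [self_mem_nhdsWithin] with δ hδ
  have hδ' : 0 < δ := hδ
  exact hlt _ _ (add_pos_of_nonneg_of_pos (apply_nonneg _ _) hδ')
    (add_pos_of_nonneg_of_pos (apply_nonneg _ _) hδ') (by linarith) (by linarith)

/-- Continuous seminorms that are adapted to the grading and bound a given continuous form are
cofinal. -/
theorem exists_isAdapted [PolynormableSpace 𝕜 V] [IsTopologicalAddGroup V]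
    (hproj : ∀ i, Continuous (parityProj 𝒱 i)) (hΛc : Continuous fun x : V × V => Λ x.1 x.2)
    {p₀ : Seminorm 𝕜 V} (hp₀ : Continuous p₀) :
    ∃ p : Seminorm 𝕜 V, Continuous p ∧ p₀ ≤ p ∧ IsAdapted 𝒱 p ∧
      ∀ v w, ‖Λ v w‖ ≤ p v * p w := by
  obtain ⟨r, hrc, hr⟩ := exists_seminorm_bilin_le hΛc
  have hs : ∀ v, (∑ i, (p₀ + r).comp (parityProj 𝒱 i) : Seminorm 𝕜 V) v =
      ∑ i, (p₀ (parityProj 𝒱 i v) + r (parityProj 𝒱 i v)) := by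
    intro v
    simp
  have hp : ∀ v, p₀ v + r v ≤ ∑ i, (p₀ (parityProj 𝒱 i v) + r (parityProj 𝒱 i v)) := by
    intro v
    rw [Finset.sum_add_distrib]
    conv_lhs => rw [← sum_parityProj 𝒱 v]
    exact add_le_add (seminorm_sum_le _ _ _) (seminorm_sum_le _ _ _)
  refine ⟨∑ i, (p₀ + r).comp (parityProj 𝒱 i), ?_, fun v => ?_, fun v => ?_, fun v w => ?_⟩
  · rw [show ⇑(∑ i, (p₀ + r).comp (parityProj 𝒱 i) : Seminorm 𝕜 V) = _ from funext hs]
    exact continuous_finsetSum _ fun i _ =>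
      (hp₀.comp (hproj i)).add (hrc.comp (hproj i))
  · rw [hs]
    exact (le_add_of_nonneg_right (apply_nonneg r v)).trans (hp v)
  · rw [hs]
    refine Finset.sum_congr rfl fun i _ => ?_
    rw [hs, Finset.sum_eq_single i]
    · rw [parityProj_of_mem (parityProj_mem 𝒱 i v), if_pos rfl]
    · intro j _ hj
      rw [parityProj_of_mem (parityProj_mem 𝒱 i v), if_neg hj, map_zero, map_zero, add_zero]
    · simp
  · have h : ∀ v, r v ≤ (∑ i, (p₀ + r).comp (parityProj 𝒱 i) : Seminorm 𝕜 V) v := fun v => by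
      rw [hs]
      exact (le_add_of_nonneg_left (apply_nonneg p₀ v)).trans (hp v)
    exact (hr v w).trans (mul_le_mul (h v) (h w) (apply_nonneg _ _) (apply_nonneg _ _))

end StarEstimate

section WeylSpaceAlgebra

variable {𝕜 : Type*} [RCLike 𝕜] {V : Type*} [AddCommGroup V] [Module 𝕜 V]
variable {𝒱 : ZMod 2 → Submodule 𝕜 V} [DirectSum.Decomposition 𝒱] {R : ℝ}
variable {Λ : V →ₗ[𝕜] V →ₗ[𝕜] 𝕜}

/-! ### The star product on symmetric tensors -/

theorem WeylSpace.incl_injective : Function.Injective (WeylSpace.incl 𝒱 R) :=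
  Subtype.val_injective

variable (𝒱 R) in
/-- The symmetrizer as a map onto the symmetric tensors. -/
def WeylSpace.proj : Tens 𝕜 V →ₗ[𝕜] WeylSpace 𝒱 R := (symmetrizer 𝒱).rangeRestrict

theorem WeylSpace.incl_proj (x : Tens 𝕜 V) :
    WeylSpace.incl 𝒱 R (WeylSpace.proj 𝒱 R x) = symmetrizer 𝒱 x := rfl

theorem WeylSpace.incl_mem (a : WeylSpace 𝒱 R) : WeylSpace.incl 𝒱 R a ∈ symTens 𝒱 := a.2

theorem WeylSpace.proj_incl (a : WeylSpace 𝒱 R) :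
    WeylSpace.proj 𝒱 R (WeylSpace.incl 𝒱 R a) = a :=
  WeylSpace.incl_injective (mem_symTens_iff.mp a.2)

theorem WeylSpace.proj_surjective : Function.Surjective (WeylSpace.proj 𝒱 R) := fun a =>
  ⟨_, WeylSpace.proj_incl a⟩

theorem WeylSpace.proj_eq_iff {x y : Tens 𝕜 V} :
    WeylSpace.proj 𝒱 R x = WeylSpace.proj 𝒱 R y ↔ x - y ∈ symIdeal 𝒱 := by
  rw [← symmetrizer_eq_iff, ← WeylSpace.incl_injective.eq_iff, WeylSpace.incl_proj,
    WeylSpace.incl_proj]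

theorem WeylSpace.unit_eq_proj :
    (WeylSpace.unit 𝒱 : WeylSpace 𝒱 R) = WeylSpace.proj 𝒱 R 1 :=
  WeylSpace.incl_injective symmetrizer_one.symm

theorem WeylSpace.of_eq_proj (v : V) :
    (WeylSpace.of 𝒱 v : WeylSpace 𝒱 R) = WeylSpace.proj 𝒱 R (tensOf v) :=
  WeylSpace.incl_injective (symmetrizer_tensOf v).symm

variable (𝒱 R) in
theorem WeylSpace.of_neg (w : V) :
    (WeylSpace.of 𝒱 (-w) : WeylSpace 𝒱 R) = -WeylSpace.of 𝒱 w := by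
  rw [WeylSpace.of_eq_proj, WeylSpace.of_eq_proj, map_neg, map_neg]

variable (𝒱 R Λ) in
/-- The star product on symmetric tensors as a bilinear map. -/
def WeylSpace.starHom (z : 𝕜) : WeylSpace 𝒱 R →ₗ[𝕜] WeylSpace 𝒱 R →ₗ[𝕜] WeylSpace 𝒱 R :=
  ((starT 𝒱 Λ z).compl₁₂ (WeylSpace.incl 𝒱 R) (WeylSpace.incl 𝒱 R)).compr₂ (WeylSpace.proj 𝒱 R)

theorem WeylSpace.star_eq_starHom (z : 𝕜) (a b : WeylSpace 𝒱 R) :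
    WeylSpace.star 𝒱 Λ z a b = WeylSpace.starHom 𝒱 R Λ z a b := rfl

theorem expP_zero (x : Tens 𝕜 V ⊗[𝕜] Tens 𝕜 V) : expP 𝒱 Λ 0 x = x := by
  change ∑ᶠ k : ℕ, ((0 : 𝕜) ^ k / (k.factorial : 𝕜)) • (P 𝒱 Λ ^ k) x = x
  rw [finsum_eq_single _ 0]
  · simp
  · intro k hk
    simp [hk]

variable (Λ) in
theorem WeylSpace.sym_eq_starHom (a b : WeylSpace 𝒱 R) :
    WeylSpace.sym 𝒱 a b = WeylSpace.starHom 𝒱 R Λ 0 a b := by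
  rw [← WeylSpace.star_eq_starHom, WeylSpace.star, WeylSpace.sym]
  simp only [expP_zero]

/-- The star product on symmetric tensors is the quotient of the associative product `starT` on
all tensors. -/
theorem WeylSpace.starHom_proj (hΛ : IsEvenForm 𝒱 Λ) (z : 𝕜) (x y : Tens 𝕜 V) :
    WeylSpace.starHom 𝒱 R Λ z (WeylSpace.proj 𝒱 R x) (WeylSpace.proj 𝒱 R y) =
      WeylSpace.proj 𝒱 R (starT 𝒱 Λ z x y) := by
  change WeylSpace.proj 𝒱 R (starT 𝒱 Λ z (symmetrizer 𝒱 x) (symmetrizer 𝒱 y)) = _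
  rw [WeylSpace.proj_eq_iff]
  have h1 := starT_mem_symIdeal_left hΛ z (symmetrizer_sub_mem (𝒱 := 𝒱) x) (symmetrizer 𝒱 y)
  have h2 := starT_mem_symIdeal_right hΛ z x (symmetrizer_sub_mem (𝒱 := 𝒱) y)
  rw [map_sub, LinearMap.sub_apply] at h1
  rw [map_sub] at h2
  simpa using add_mem h1 h2

theorem WeylSpace.starHom_assoc (hΛ : IsEvenForm 𝒱 Λ) (z : 𝕜) (a b c : WeylSpace 𝒱 R) :
    WeylSpace.starHom 𝒱 R Λ z (WeylSpace.starHom 𝒱 R Λ z a b) c =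
      WeylSpace.starHom 𝒱 R Λ z a (WeylSpace.starHom 𝒱 R Λ z b c) := by
  obtain ⟨x, rfl⟩ := WeylSpace.proj_surjective a
  obtain ⟨y, rfl⟩ := WeylSpace.proj_surjective b
  obtain ⟨t, rfl⟩ := WeylSpace.proj_surjective c
  simp only [WeylSpace.starHom_proj hΛ, starT_assoc hΛ]

theorem WeylSpace.unit_starHom (z : 𝕜) (a : WeylSpace 𝒱 R) :
    WeylSpace.starHom 𝒱 R Λ z (WeylSpace.unit 𝒱) a = a := by
  change WeylSpace.proj 𝒱 R (starT 𝒱 Λ z 1 (WeylSpace.incl 𝒱 R a)) = a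
  rw [one_starT, WeylSpace.proj_incl]

theorem WeylSpace.starHom_unit (z : 𝕜) (a : WeylSpace 𝒱 R) :
    WeylSpace.starHom 𝒱 R Λ z a (WeylSpace.unit 𝒱) = a := by
  change WeylSpace.proj 𝒱 R (starT 𝒱 Λ z (WeylSpace.incl 𝒱 R a) 1) = a
  rw [starT_one, WeylSpace.proj_incl]

/-- The star algebra is generated by the homogeneous vectors. -/
theorem WeylSpace.mem_of_starHom_mem (hΛ : IsEvenForm 𝒱 Λ) (z : 𝕜)
    {J : Submodule 𝕜 (WeylSpace 𝒱 R)} (one : WeylSpace.unit 𝒱 ∈ J)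
    (hJ : ∀ i, ∀ v ∈ 𝒱 i, ∀ a ∈ J, WeylSpace.starHom 𝒱 R Λ z (WeylSpace.of 𝒱 v) a ∈ J)
    (a : WeylSpace 𝒱 R) : a ∈ J := by
  obtain ⟨x, rfl⟩ := WeylSpace.proj_surjective a
  refine mem_of_starT_mem (J := J.comap (WeylSpace.proj 𝒱 R)) hΛ z ?_ ?_ x
  · rwa [Submodule.mem_comap, ← WeylSpace.unit_eq_proj]
  · intro i v hv y hy
    rw [Submodule.mem_comap, ← WeylSpace.starHom_proj hΛ, ← WeylSpace.of_eq_proj]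
    exact hJ i v hv _ hy

variable (𝒱 R) in
/-- The translation on symmetric tensors as a linear map. -/
def WeylSpace.translateHom (φ : V →ₗ[𝕜] 𝕜) : WeylSpace 𝒱 R →ₗ[𝕜] WeylSpace 𝒱 R :=
  WeylSpace.proj 𝒱 R ∘ₗ (Weyl.translate φ).toLinearMap ∘ₗ WeylSpace.incl 𝒱 R

theorem WeylSpace.incl_translate {φ : V →ₗ[𝕜] 𝕜} (hφ : IsHomFunctional 𝒱 φ 0)
    (a : WeylSpace 𝒱 R) :
    WeylSpace.incl 𝒱 R (WeylSpace.translate 𝒱 φ a) =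
      Weyl.translate φ (WeylSpace.incl 𝒱 R a) :=
  mem_symTens_iff.mp (translate_mem_symTens hφ (WeylSpace.incl_mem a))

theorem WeylSpace.translateHom_proj {φ : V →ₗ[𝕜] 𝕜} (hφ : IsHomFunctional 𝒱 φ 0)
    (x : Tens 𝕜 V) :
    WeylSpace.translateHom 𝒱 R φ (WeylSpace.proj 𝒱 R x) =
      WeylSpace.proj 𝒱 R (Weyl.translate φ x) := by
  change WeylSpace.proj 𝒱 R (Weyl.translate φ (symmetrizer 𝒱 x)) = _
  rw [WeylSpace.proj_eq_iff, ← map_sub]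
  exact translate_mem_symIdeal hφ (symmetrizer_sub_mem x)

theorem WeylSpace.translateHom_unit {φ : V →ₗ[𝕜] 𝕜} (hφ : IsHomFunctional 𝒱 φ 0) :
    WeylSpace.translateHom 𝒱 R φ (WeylSpace.unit 𝒱) = WeylSpace.unit 𝒱 := by
  rw [WeylSpace.unit_eq_proj, WeylSpace.translateHom_proj hφ, map_one]

theorem WeylSpace.translateHom_of_starHom (hΛ : IsEvenForm 𝒱 Λ) (z : 𝕜) {φ : V →ₗ[𝕜] 𝕜}
    (hφ : IsHomFunctional 𝒱 φ 0) {i : ZMod 2} {v : V} (hv : v ∈ 𝒱 i) (a : WeylSpace 𝒱 R) :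
    WeylSpace.translateHom 𝒱 R φ (WeylSpace.starHom 𝒱 R Λ z (WeylSpace.of 𝒱 v) a) =
      WeylSpace.starHom 𝒱 R Λ z (WeylSpace.of 𝒱 v) (WeylSpace.translateHom 𝒱 R φ a) +
        φ v • WeylSpace.translateHom 𝒱 R φ a := by
  obtain ⟨x, rfl⟩ := WeylSpace.proj_surjective a
  simp only [WeylSpace.of_eq_proj, WeylSpace.translateHom_proj hφ, WeylSpace.starHom_proj hΛ,
    translate_tensOf_starT hΛ z hφ hv, map_add, map_smul]

/-- The canonical commutation relation with an even vector. -/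
theorem WeylSpace.of_starHom_of (hΛ : IsEvenForm 𝒱 Λ) (z : 𝕜) {w : V} (hw : w ∈ 𝒱 0)
    {i : ZMod 2} {v : V} (hv : v ∈ 𝒱 i) :
    WeylSpace.starHom 𝒱 R Λ z (WeylSpace.of 𝒱 w) (WeylSpace.of 𝒱 v) =
      WeylSpace.starHom 𝒱 R Λ z (WeylSpace.of 𝒱 v) (WeylSpace.of 𝒱 w) +
        (z * (Λ w v - Λ v w)) • WeylSpace.unit 𝒱 := by
  have h1 : ∀ {f : V →ₗ[𝕜] 𝕜} {j k : ZMod 2}, IsHomFunctional 𝒱 f j → ∀ {u}, u ∈ 𝒱 k →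
      contr 𝒱 f (tensOf u) = f u • (1 : Tens 𝕜 V) := by
    intro f j k hf u hu
    have := contr_tensOf_mul hf hu 1
    rwa [mul_one, contr_one, mul_zero, smul_zero, add_zero] at this
  rw [WeylSpace.of_eq_proj, WeylSpace.of_eq_proj, WeylSpace.unit_eq_proj,
    WeylSpace.starHom_proj hΛ, WeylSpace.starHom_proj hΛ, tensOf_starT hΛ z hw,
    tensOf_starT hΛ z hv, h1 (hΛ.isHomFunctional hw) hv, h1 (hΛ.isHomFunctional hv) hw,
    ← map_smul, ← map_add, WeylSpace.proj_eq_iff]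
  have h2 := gradedComm_mem_symIdeal hw hv 1
  rw [gradedComm, koszul_zero_left, one_smul, mul_one, mul_one] at h2
  convert h2 using 1
  module

theorem two_mul_smul_sharp_apply (z : 𝕜) {w : V} (hw : w ∈ 𝒱 0)
    {i : ZMod 2} {v : V} (hv : v ∈ 𝒱 i) :
    ((2 * z) • sharp 𝒱 Λ w) v = z * (Λ w v - Λ v w) := by
  have h : oppForm 𝒱 Λ w v = Λ v w := by
    simp only [oppForm, LinearMap.sum_apply, LinearMap.smul_apply, LinearMap.compl₁₂_apply,
      LinearMap.flip_apply, parityProj_of_mem hw, parityProj_of_mem hv]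
    rw [Finset.sum_eq_single 0, Finset.sum_eq_single i]
    · simp [koszul_zero_left]
    · intro j _ hj
      simp [hj]
    · simp
    · intro j _ hj
      simp [hj]
    · simp
  have h2 : (2 : 𝕜) ≠ 0 := two_ne_zero
  simp only [sharp, antisymmPart, LinearMap.smul_apply, LinearMap.sub_apply, h, smul_eq_mul]
  field_simp

/-- An even functional in the image of `♯` is the image of an even vector. -/
theorem exists_even_sharp_eq (hΛ : IsEvenForm 𝒱 Λ) {z : 𝕜} (hz : z ≠ 0) {φ : V →ₗ[𝕜] 𝕜}
    (hφ : IsHomFunctional 𝒱 φ 0) (h : φ ∈ LinearMap.range (sharp 𝒱 Λ)) :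
    ∃ w ∈ 𝒱 0, (2 * z) • sharp 𝒱 Λ w = φ := by
  obtain ⟨w, hw⟩ := h
  refine ⟨(2 * z)⁻¹ • parityProj 𝒱 0 w, Submodule.smul_mem _ _ (parityProj_mem 𝒱 0 w), ?_⟩
  rw [map_smul, smul_inv_smul₀ (mul_ne_zero two_ne_zero hz)]
  have hodd : ∀ {i j : ZMod 2}, i ≠ j → ∀ {u}, u ∈ 𝒱 i → ∀ {v}, v ∈ 𝒱 j →
      sharp 𝒱 Λ u v = 0 := by
    intro i j hij u hu v hv
    simp only [sharp, antisymmPart, oppForm, LinearMap.sum_apply, LinearMap.smul_apply,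
      LinearMap.compl₁₂_apply, LinearMap.flip_apply, LinearMap.sub_apply, parityProj_of_mem hu,
      parityProj_of_mem hv, hΛ i j hij u hu v hv]
    rw [Finset.sum_eq_zero, sub_zero, smul_zero]
    intro k _
    refine Finset.sum_eq_zero fun l _ => ?_
    by_cases hk : k = i
    · by_cases hl : l = j
      · rw [if_pos hk, if_pos hl, hΛ j i hij.symm v hv u hu, smul_zero]
      · rw [if_neg hl, map_zero, LinearMap.zero_apply, smul_zero]
    · rw [if_neg hk, map_zero, smul_zero]
  ext v
  rw [← sum_parityProj 𝒱 v, map_sum, map_sum]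
  refine Finset.sum_congr rfl fun j _ => ?_
  have hj := parityProj_mem 𝒱 j v
  rcases eq_or_ne 0 j with rfl | h0
  · rw [← hw]
    conv_rhs => rw [← sum_parityProj 𝒱 w]
    rw [map_sum, LinearMap.sum_apply, Finset.sum_eq_single 0]
    · exact fun k _ hk => hodd hk (parityProj_mem 𝒱 k w) hj
    · simp
  · rw [hφ j h0 _ hj, hodd h0 (parityProj_mem 𝒱 0 w) hj]

/-! ### Powers and divided powers -/

variable (𝒱 R Λ) in
/-- The powers `a ⋆ ⋯ ⋆ a`. -/
def WeylSpace.starPow (z : 𝕜) (a : WeylSpace 𝒱 R) (n : ℕ) : WeylSpace 𝒱 R :=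
  (WeylSpace.starHom 𝒱 R Λ z a ^ n) (WeylSpace.unit 𝒱)

theorem WeylSpace.starPow_zero (z : 𝕜) (a : WeylSpace 𝒱 R) :
    WeylSpace.starPow 𝒱 R Λ z a 0 = WeylSpace.unit 𝒱 := rfl

theorem WeylSpace.starPow_succ (z : 𝕜) (a : WeylSpace 𝒱 R) (n : ℕ) :
    WeylSpace.starPow 𝒱 R Λ z a (n + 1) =
      WeylSpace.starHom 𝒱 R Λ z a (WeylSpace.starPow 𝒱 R Λ z a n) := by
  rw [WeylSpace.starPow, pow_succ', Module.End.mul_apply, WeylSpace.starPow]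

theorem WeylSpace.starPow_add (hΛ : IsEvenForm 𝒱 Λ) (z : 𝕜) (a : WeylSpace 𝒱 R) (m n : ℕ) :
    WeylSpace.starPow 𝒱 R Λ z a (m + n) = WeylSpace.starHom 𝒱 R Λ z
      (WeylSpace.starPow 𝒱 R Λ z a m) (WeylSpace.starPow 𝒱 R Λ z a n) := by
  induction m with
  | zero => rw [zero_add, WeylSpace.starPow_zero, WeylSpace.unit_starHom]
  | succ m ih =>
    rw [Nat.succ_add, WeylSpace.starPow_succ, WeylSpace.starPow_succ, ih,
      WeylSpace.starHom_assoc hΛ]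

theorem WeylSpace.starPow_succ' (hΛ : IsEvenForm 𝒱 Λ) (z : 𝕜) (a : WeylSpace 𝒱 R) (n : ℕ) :
    WeylSpace.starPow 𝒱 R Λ z a (n + 1) =
      WeylSpace.starHom 𝒱 R Λ z (WeylSpace.starPow 𝒱 R Λ z a n) a := by
  rw [WeylSpace.starPow_add hΛ, WeylSpace.starPow_succ, WeylSpace.starPow_zero,
    WeylSpace.starHom_unit]

theorem WeylSpace.starPow_neg (z : 𝕜) (a : WeylSpace 𝒱 R) (n : ℕ) :
    WeylSpace.starPow 𝒱 R Λ z (-a) n = (-1 : 𝕜) ^ n • WeylSpace.starPow 𝒱 R Λ z a n := by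
  induction n with
  | zero => simp [WeylSpace.starPow_zero]
  | succ n ih =>
    rw [WeylSpace.starPow_succ, ih, WeylSpace.starPow_succ, map_neg, LinearMap.neg_apply,
      map_smul, pow_succ']
    module

/-- Commuting a vector past a power of an even vector. -/
theorem WeylSpace.starPow_starHom_of (hΛ : IsEvenForm 𝒱 Λ) (z : 𝕜) {w : V} (hw : w ∈ 𝒱 0)
    {i : ZMod 2} {v : V} (hv : v ∈ 𝒱 i) (n : ℕ) :
    WeylSpace.starHom 𝒱 R Λ z (WeylSpace.starPow 𝒱 R Λ z (WeylSpace.of 𝒱 w) (n + 1))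
        (WeylSpace.of 𝒱 v) =
      WeylSpace.starHom 𝒱 R Λ z (WeylSpace.of 𝒱 v)
        (WeylSpace.starPow 𝒱 R Λ z (WeylSpace.of 𝒱 w) (n + 1)) +
      (((n + 1 : ℕ) : 𝕜) * (z * (Λ w v - Λ v w))) •
        WeylSpace.starPow 𝒱 R Λ z (WeylSpace.of 𝒱 w) n := by
  induction n with
  | zero =>
    rw [WeylSpace.starPow_succ, WeylSpace.starPow_zero, WeylSpace.starHom_unit,
      WeylSpace.of_starHom_of hΛ z hw hv, Nat.cast_one, one_mul]
  | succ n ih =>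
    rw [WeylSpace.starPow_succ _ _ (n + 1), WeylSpace.starHom_assoc hΛ, ih, map_add,
      ← WeylSpace.starHom_assoc hΛ, WeylSpace.of_starHom_of hΛ z hw hv, map_smul,
      ← WeylSpace.starPow_succ, map_add, LinearMap.add_apply, map_smul, LinearMap.smul_apply,
      WeylSpace.unit_starHom, WeylSpace.starHom_assoc hΛ, Nat.cast_succ (n + 1)]
    module

variable (𝒱 R) in
/-- The divided power `wᵐ / m!` of a vector for the symmetric product. -/
def WeylSpace.dividedPow (w : V) (m : ℕ) : WeylSpace 𝒱 R :=
  (m.factorial : 𝕜)⁻¹ • WeylSpace.proj 𝒱 R (tensOf w ^ m)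

theorem WeylSpace.dividedPow_zero (w : V) :
    WeylSpace.dividedPow 𝒱 R w 0 = WeylSpace.unit 𝒱 := by
  rw [WeylSpace.dividedPow, WeylSpace.unit_eq_proj]
  simp

theorem WeylSpace.of_starHom_unit_eq_dividedPow (z : 𝕜) (w : V) :
    WeylSpace.starHom 𝒱 R Λ z (WeylSpace.of 𝒱 w) (WeylSpace.unit 𝒱) =
      WeylSpace.dividedPow 𝒱 R w 1 := by
  rw [WeylSpace.starHom_unit, WeylSpace.dividedPow, WeylSpace.of_eq_proj]
  simp

theorem WeylSpace.of_starHom_dividedPow (hΛ : IsEvenForm 𝒱 Λ) (z : 𝕜) {w : V} (hw : w ∈ 𝒱 0)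
    (m : ℕ) :
    WeylSpace.starHom 𝒱 R Λ z (WeylSpace.of 𝒱 w) (WeylSpace.dividedPow 𝒱 R w (m + 1)) =
      ((m + 1 + 1 : ℕ) : 𝕜) • WeylSpace.dividedPow 𝒱 R w (m + 1 + 1) +
        (z * Λ w w) • WeylSpace.dividedPow 𝒱 R w m := by
  have h1 : (m.factorial : 𝕜) ≠ 0 := Nat.cast_ne_zero.mpr m.factorial_ne_zero
  have h2 : ((m + 1 : ℕ) : 𝕜) ≠ 0 := Nat.cast_ne_zero.mpr m.succ_ne_zero
  have h3 : ((m + 1 + 1 : ℕ) : 𝕜) ≠ 0 := Nat.cast_ne_zero.mpr (m + 1).succ_ne_zero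
  simp only [WeylSpace.dividedPow, map_smul, WeylSpace.of_eq_proj, WeylSpace.starHom_proj hΛ,
    tensOf_starT hΛ z hw, contr_tensOf_pow (hΛ.isHomFunctional hw) hw, ← pow_succ', map_add,
    smul_add, smul_smul, Nat.factorial_succ (m + 1), Nat.factorial_succ m, Nat.cast_mul]
  congr 2 <;> field_simp

end WeylSpaceAlgebra

section CompletionTopology

variable {𝕜 : Type*} [RCLike 𝕜] {V : Type*} [AddCommGroup V] [Module 𝕜 V] [TopologicalSpace V]
variable {𝒱 : ZMod 2 → Submodule 𝕜 V} [DirectSum.Decomposition 𝒱] {R : ℝ}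

/-! ### Absolutely summable families in the completion -/

/-- A family of symmetric tensors is absolutely summable if it is summable for each of the
seminorms `p_R`. -/
def AbsSummable {ι : Type*} (f : ι → WeylSpace 𝒱 R) : Prop :=
  ∀ p, Summable fun i => WeylSpace.seminorms 𝒱 R p (f i)

theorem AbsSummable.of_le {ι : Type*} {f : ι → WeylSpace 𝒱 R}
    (h : ∀ p, ∃ g : ι → ℝ, Summable g ∧ ∀ i, WeylSpace.seminorms 𝒱 R p (f i) ≤ g i) :
    AbsSummable f := fun p => by
  obtain ⟨g, hg, hfg⟩ := h p
  exact Summable.of_nonneg_of_le (fun i => apply_nonneg _ _) hfg hg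

theorem AbsSummable.summable_comp {ι : Type*} {f : ι → WeylSpace 𝒱 R} (hf : AbsSummable f)
    {q : Seminorm 𝕜 (WeylSpace 𝒱 R)} (hq : Continuous q) : Summable fun i => q (f i) := by
  obtain ⟨s, C, -, h⟩ := Seminorm.bound_of_continuous (WeylSpace.withSeminorms 𝒱 R) q hq
  refine Summable.of_nonneg_of_le (fun i => apply_nonneg _ _) (fun i => ?_)
    ((summable_sum fun p (_ : p ∈ s) => hf p).mul_left (C : ℝ))
  refine (h (f i)).trans ?_
  change (C : ℝ) * (s.sup (WeylSpace.seminorms 𝒱 R)) (f i) ≤ _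
  refine mul_le_mul_of_nonneg_left ?_ C.2
  exact Seminorm.finset_sup_apply_le (Finset.sum_nonneg fun p _ => apply_nonneg _ _) fun p hp =>
    Finset.single_le_sum (f := fun p => WeylSpace.seminorms 𝒱 R p (f i))
      (fun p _ => apply_nonneg _ _) hp

variable (𝒱 R) in
/-- The inclusion into the completion as a linear map. -/
def coeHom : WeylSpace 𝒱 R →ₗ[𝕜] WeylCompletion 𝒱 R where
  toFun a := (a : WeylCompletion 𝒱 R)
  map_add' a b := UniformSpace.Completion.coe_add a b
  map_smul' c a := UniformSpace.Completion.coe_smul c a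

theorem coe_sum {ι : Type*} (s : Finset ι) (f : ι → WeylSpace 𝒱 R) :
    ((∑ i ∈ s, f i : WeylSpace 𝒱 R) : WeylCompletion 𝒱 R) =
      ∑ i ∈ s, (f i : WeylCompletion 𝒱 R) :=
  map_sum (coeHom 𝒱 R) f s

theorem AbsSummable.summable_coe {ι : Type*} {f : ι → WeylSpace 𝒱 R} (hf : AbsSummable f) :
    Summable fun i => (f i : WeylCompletion 𝒱 R) := by
  rw [summable_iff_vanishing]
  intro e he
  have he' : (fun a : WeylSpace 𝒱 R => (a : WeylCompletion 𝒱 R)) ⁻¹' e ∈ nhds 0 :=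
    (UniformSpace.Completion.continuous_coe (WeylSpace 𝒱 R)).continuousAt.preimage_mem_nhds
      (by rwa [UniformSpace.Completion.coe_zero])
  obtain ⟨s, ε, hε, hs⟩ := ((WeylSpace.withSeminorms 𝒱 R).mem_nhds_iff 0 _).mp he'
  have hc : Continuous (s.sup (WeylSpace.seminorms 𝒱 R) : Seminorm 𝕜 (WeylSpace 𝒱 R)) :=
    Seminorm.continuous_finsetSup fun p _ => (WeylSpace.withSeminorms 𝒱 R).continuous_seminorm p
  obtain ⟨t, ht⟩ := summable_iff_vanishing.mp (hf.summable_comp hc) (Set.Iio ε) (Iio_mem_nhds hε)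
  refine ⟨t, fun t' h' => ?_⟩
  rw [← coe_sum]
  refine hs ?_
  rw [Seminorm.mem_ball_zero]
  exact (seminorm_sum_le _ _ _).trans_lt (ht t' h')

theorem AbsSummable.convergesAbsolutely {f : ℕ → WeylSpace 𝒱 R} (hf : AbsSummable f) :
    ConvergesAbsolutely (𝕜 := 𝕜) (fun n => (f n : WeylCompletion 𝒱 R))
      (∑' n, (f n : WeylCompletion 𝒱 R)) := by
  refine ⟨hf.summable_coe.hasSum, fun q hq => ?_⟩
  exact hf.summable_comp (q := q.comp (coeHom 𝒱 R))
    (hq.comp (UniformSpace.Completion.continuous_coe _))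

theorem AbsSummable.sum_antidiagonal {f : ℕ × ℕ → WeylSpace 𝒱 R} (hf : AbsSummable f) :
    AbsSummable fun n => ∑ x ∈ Finset.HasAntidiagonal.antidiagonal n, f x := by
  refine AbsSummable.of_le fun p => ⟨fun n => ∑ x ∈ Finset.HasAntidiagonal.antidiagonal n,
    WeylSpace.seminorms 𝒱 R p (f x), ?_, fun n => seminorm_sum_le _ _ _⟩
  have h := Finset.HasAntidiagonal.sigmaAntidiagonalEquivProd.summable_iff.mpr (hf p)
  refine (h.sigma' fun n => (hasSum_fintype _).summable).congr fun n => ?_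
  rw [tsum_fintype]
  exact Finset.sum_coe_sort (Finset.HasAntidiagonal.antidiagonal n)
    fun x => WeylSpace.seminorms 𝒱 R p (f x)

omit [TopologicalSpace V] [DirectSum.Decomposition 𝒱] in
theorem hasSum_sum_antidiagonal {E : Type*} [AddCommGroup E] [TopologicalSpace E]
    [ContinuousAdd E] [RegularSpace E] {f : ℕ × ℕ → E} {a : E} (hf : HasSum f a) :
    HasSum (fun n => ∑ x ∈ Finset.HasAntidiagonal.antidiagonal n, f x) a := by
  have h := Finset.HasAntidiagonal.sigmaAntidiagonalEquivProd.hasSum_iff.mpr hf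
  refine h.sigma fun n => ?_
  have := hasSum_fintype fun x : Finset.HasAntidiagonal.antidiagonal n => f x
  rwa [Finset.sum_coe_sort (Finset.HasAntidiagonal.antidiagonal n) f] at this

/-! ### Extension of bounded bilinear maps to the completion -/

/-- A bilinear map on symmetric tensors is bounded if each seminorm `p_R` of its values is bounded
by the product of some seminorm `p'_R` of the arguments. -/
def IsBoundedBilin (B : WeylSpace 𝒱 R →ₗ[𝕜] WeylSpace 𝒱 R →ₗ[𝕜] WeylSpace 𝒱 R) : Prop :=
  ∀ p, ∃ p', ∀ a b, WeylSpace.seminorms 𝒱 R p (B a b) ≤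
    WeylSpace.seminorms 𝒱 R p' a * WeylSpace.seminorms 𝒱 R p' b

variable {B : WeylSpace 𝒱 R →ₗ[𝕜] WeylSpace 𝒱 R →ₗ[𝕜] WeylSpace 𝒱 R}

theorem IsBoundedBilin.continuous (hB : IsBoundedBilin B) :
    Continuous fun x : WeylSpace 𝒱 R × WeylSpace 𝒱 R => B x.1 x.2 := by
  have hlim : ∀ {ι : Type _} {l : Filter ι} {u v : ι → WeylSpace 𝒱 R},
      (∀ p, Filter.Tendsto (fun i => WeylSpace.seminorms 𝒱 R p (u i) *
        WeylSpace.seminorms 𝒱 R p (v i)) l (nhds 0)) →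
      Filter.Tendsto (fun i => B (u i) (v i)) l (nhds 0) := by
    intro ι l u v h
    rw [(WeylSpace.withSeminorms 𝒱 R).tendsto_nhds]
    intro p ε hε
    obtain ⟨p', hp'⟩ := hB p
    filter_upwards [(h p').eventually (gt_mem_nhds hε)] with i hi
    rw [sub_zero]
    exact (hp' _ _).trans_lt hi
  have hc := fun p => (WeylSpace.withSeminorms 𝒱 R).continuous_seminorm p
  let f : WeylSpace 𝒱 R →+ WeylSpace 𝒱 R →+ WeylSpace 𝒱 R :=
    AddMonoidHom.mk' (fun a => (B a).toAddMonoidHom) fun a b => by ext; simp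
  refine continuous_of_continuousAt_zero₂ f ?_ (fun a => ?_) (fun b => ?_)
  · change Filter.Tendsto (fun x : WeylSpace 𝒱 R × WeylSpace 𝒱 R => B x.1 x.2) _ (nhds (B 0 0))
    rw [map_zero]
    refine hlim fun p => ?_
    have h : Continuous fun x : WeylSpace 𝒱 R × WeylSpace 𝒱 R =>
        WeylSpace.seminorms 𝒱 R p x.1 * WeylSpace.seminorms 𝒱 R p x.2 :=
      ((hc p).comp continuous_fst).mul ((hc p).comp continuous_snd)
    simpa using h.tendsto (0, 0)
  · change Filter.Tendsto (fun x : WeylSpace 𝒱 R => B a x) _ (nhds (B a 0))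
    rw [map_zero]
    refine hlim fun p => ?_
    have h : Continuous fun x => WeylSpace.seminorms 𝒱 R p a * WeylSpace.seminorms 𝒱 R p x :=
      continuous_const.mul (hc p)
    simpa using h.tendsto 0
  · change Filter.Tendsto (fun x : WeylSpace 𝒱 R => B x b) _ (nhds (B 0 b))
    rw [map_zero, LinearMap.zero_apply]
    refine hlim fun p => ?_
    have h : Continuous fun x => WeylSpace.seminorms 𝒱 R p x * WeylSpace.seminorms 𝒱 R p b :=
      (hc p).mul continuous_const
    simpa using h.tendsto 0

theorem IsBoundedBilin.continuous_extendMul (hB : IsBoundedBilin B) :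
    Continuous fun x : WeylCompletion 𝒱 R × WeylCompletion 𝒱 R =>
      extendMul (fun a b => B a b) x.1 x.2 := by
  let i := UniformSpace.Completion.toCompl (α := WeylSpace 𝒱 R)
  have hi : IsDenseInducing i := UniformSpace.Completion.isDenseInducing_coe
  let φ : WeylSpace 𝒱 R →+ WeylSpace 𝒱 R →+ WeylCompletion 𝒱 R :=
    AddMonoidHom.mk' (fun a => i.comp (B a).toAddMonoidHom) fun a b => by ext; simp
  have hφ : Continuous fun x : WeylSpace 𝒱 R × WeylSpace 𝒱 R => φ x.1 x.2 :=
    (UniformSpace.Completion.continuous_coe _).comp hB.continuous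
  exact hi.extend_Z_bilin hi hφ

theorem IsBoundedBilin.extendMul_coe (hB : IsBoundedBilin B) (a b : WeylSpace 𝒱 R) :
    extendMul (fun a b => B a b) (a : WeylCompletion 𝒱 R) b = (B a b : WeylCompletion 𝒱 R) :=
  (UniformSpace.Completion.isDenseInducing_coe.prodMap
    UniformSpace.Completion.isDenseInducing_coe).extend_eq
    ((UniformSpace.Completion.continuous_coe _).comp hB.continuous) (a, b)

/-- A bounded bilinear map extends to a continuous bilinear map on the completion. -/
theorem IsBoundedBilin.isContinuousExtension (hB : IsBoundedBilin B) :
    IsContinuousExtension (𝕜 := 𝕜) (fun a b => B a b) (extendMul fun a b => B a b) := by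
  have he := hB.extendMul_coe
  have hc := hB.continuous_extendMul
  generalize extendMul (fun a b => B a b) = M at he hc
  have h1 : ∀ c : WeylCompletion 𝒱 R, Continuous fun a => M a c := fun c =>
    hc.comp (continuous_id.prodMk continuous_const)
  have h2 : ∀ c : WeylCompletion 𝒱 R, Continuous fun a => M c a := fun c =>
    hc.comp (continuous_const.prodMk continuous_id)
  refine ⟨he, hc, fun b => ⟨fun a a' => ?_, fun c a => ?_⟩, fun a => ⟨fun b b' => ?_,
    fun c b => ?_⟩⟩
  · induction a using UniformSpace.Completion.induction_on with
    | hp =>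
      exact isClosed_eq ((h1 b).comp (continuous_id.add continuous_const))
        ((h1 b).add continuous_const)
    | ih a =>
    induction a' using UniformSpace.Completion.induction_on with
    | hp =>
      exact isClosed_eq ((h1 b).comp (continuous_const.add continuous_id))
        (continuous_const.add (h1 b))
    | ih a' =>
    induction b using UniformSpace.Completion.induction_on with
    | hp => exact isClosed_eq (h2 _) ((h2 _).add (h2 _))
    | ih b =>
    rw [← UniformSpace.Completion.coe_add, he, he, he, map_add, LinearMap.add_apply,
      UniformSpace.Completion.coe_add]
  · induction a using UniformSpace.Completion.induction_on with
    | hp => exact isClosed_eq ((h1 b).comp (continuous_const_smul c)) ((h1 b).const_smul c)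
    | ih a =>
    induction b using UniformSpace.Completion.induction_on with
    | hp => exact isClosed_eq (h2 _) ((h2 _).const_smul c)
    | ih b =>
    rw [← UniformSpace.Completion.coe_smul, he, he, map_smul, LinearMap.smul_apply,
      UniformSpace.Completion.coe_smul]
  · induction b using UniformSpace.Completion.induction_on with
    | hp =>
      exact isClosed_eq ((h2 a).comp (continuous_id.add continuous_const))
        ((h2 a).add continuous_const)
    | ih b =>
    induction b' using UniformSpace.Completion.induction_on with
    | hp =>
      exact isClosed_eq ((h2 a).comp (continuous_const.add continuous_id))
        (continuous_const.add (h2 a))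
    | ih b' =>
    induction a using UniformSpace.Completion.induction_on with
    | hp => exact isClosed_eq (h1 _) ((h1 _).add (h1 _))
    | ih a =>
    rw [← UniformSpace.Completion.coe_add, he, he, he, map_add,
      UniformSpace.Completion.coe_add]
  · induction b using UniformSpace.Completion.induction_on with
    | hp => exact isClosed_eq ((h2 a).comp (continuous_const_smul c)) ((h2 a).const_smul c)
    | ih b =>
    induction a using UniformSpace.Completion.induction_on with
    | hp => exact isClosed_eq (h1 _) ((h1 _).const_smul c)
    | ih a =>
    rw [← UniformSpace.Completion.coe_smul, he, he, map_smul,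
      UniformSpace.Completion.coe_smul]

theorem IsBoundedBilin.absSummable (hB : IsBoundedBilin B) {ι κ : Type*} {f : ι → WeylSpace 𝒱 R}
    {g : κ → WeylSpace 𝒱 R} (hf : AbsSummable f) (hg : AbsSummable g) :
    AbsSummable fun x : ι × κ => B (f x.1) (g x.2) :=
  AbsSummable.of_le fun p => by
    obtain ⟨p', hp'⟩ := hB p
    exact ⟨_, (hf p').mul_of_nonneg (hg p') (fun _ => apply_nonneg _ _)
      (fun _ => apply_nonneg _ _), fun x => hp' _ _⟩

section Products

variable {m : WeylSpace 𝒱 R → WeylSpace 𝒱 R → WeylSpace 𝒱 R}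
  {M : WeylCompletion 𝒱 R → WeylCompletion 𝒱 R → WeylCompletion 𝒱 R}

/-- The left multiplications of a continuous bilinear extension. -/
def IsContinuousExtension.mulLeft (hM : IsContinuousExtension (𝕜 := 𝕜) m M)
    (a : WeylCompletion 𝒱 R) : WeylCompletion 𝒱 R →ₗ[𝕜] WeylCompletion 𝒱 R :=
  (hM.linear_right a).mk'

/-- The right multiplications of a continuous bilinear extension. -/
def IsContinuousExtension.mulRight (hM : IsContinuousExtension (𝕜 := 𝕜) m M)
    (b : WeylCompletion 𝒱 R) : WeylCompletion 𝒱 R →ₗ[𝕜] WeylCompletion 𝒱 R :=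
  (hM.linear_left b).mk'

theorem IsContinuousExtension.continuous₂ (hM : IsContinuousExtension (𝕜 := 𝕜) m M) {X : Type*}
    [TopologicalSpace X] {f g : X → WeylCompletion 𝒱 R} (hf : Continuous f) (hg : Continuous g) :
    Continuous fun x => M (f x) (g x) :=
  hM.continuous_mul.comp (hf.prodMk hg)

theorem IsContinuousExtension.hasSum_left (hM : IsContinuousExtension (𝕜 := 𝕜) m M) {ι : Type*}
    {f : ι → WeylCompletion 𝒱 R} {a : WeylCompletion 𝒱 R} (hf : HasSum f a)
    (b : WeylCompletion 𝒱 R) : HasSum (fun i => M (f i) b) (M a b) :=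
  hf.map (hM.mulRight b) (hM.continuous₂ continuous_id continuous_const)

theorem IsContinuousExtension.hasSum_right (hM : IsContinuousExtension (𝕜 := 𝕜) m M) {ι : Type*}
    {f : ι → WeylCompletion 𝒱 R} {a : WeylCompletion 𝒱 R} (hf : HasSum f a)
    (b : WeylCompletion 𝒱 R) : HasSum (fun i => M b (f i)) (M b a) :=
  hf.map (hM.mulLeft b) (hM.continuous₂ continuous_const continuous_id)

theorem IsContinuousExtension.hasSum_prod (hM : IsContinuousExtension (𝕜 := 𝕜) m M) {ι κ : Type*}
    {f : ι → WeylCompletion 𝒱 R} {g : κ → WeylCompletion 𝒱 R} {a b : WeylCompletion 𝒱 R}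
    (hf : HasSum f a) (hg : HasSum g b) (hfg : Summable fun x : ι × κ => M (f x.1) (g x.2)) :
    HasSum (fun x : ι × κ => M (f x.1) (g x.2)) (M a b) := by
  have h := hfg.hasSum.prod_fiberwise fun i => hM.hasSum_right hg (f i)
  rw [← h.unique (hM.hasSum_left hf b)]
  exact hfg.hasSum

theorem IsContinuousExtension.assoc (hM : IsContinuousExtension (𝕜 := 𝕜) m M)
    (hm : ∀ a b c, m (m a b) c = m a (m b c)) (a b c : WeylCompletion 𝒱 R) :
    M (M a b) c = M a (M b c) := by
  induction a, b, c using UniformSpace.Completion.induction_on₃ with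
  | hp =>
    exact isClosed_eq
      (hM.continuous₂ (hM.continuous₂ (by fun_prop) (by fun_prop)) (by fun_prop))
      (hM.continuous₂ (by fun_prop) (hM.continuous₂ (by fun_prop) (by fun_prop)))
  | ih a b c => simp only [hM.extends_mul, hm]

theorem IsContinuousExtension.unit_mul (hM : IsContinuousExtension (𝕜 := 𝕜) m M)
    (hm : ∀ a, m (WeylSpace.unit 𝒱) a = a) (a : WeylCompletion 𝒱 R) : M (unit 𝒱) a = a := by
  induction a using UniformSpace.Completion.induction_on with
  | hp => exact isClosed_eq (hM.continuous₂ continuous_const continuous_id) continuous_id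
  | ih a => rw [unit, hM.extends_mul, hm]

theorem IsContinuousExtension.mul_unit (hM : IsContinuousExtension (𝕜 := 𝕜) m M)
    (hm : ∀ a, m a (WeylSpace.unit 𝒱) = a) (a : WeylCompletion 𝒱 R) : M a (unit 𝒱) = a := by
  induction a using UniformSpace.Completion.induction_on with
  | hp => exact isClosed_eq (hM.continuous₂ continuous_id continuous_const) continuous_id
  | ih a => rw [unit, hM.extends_mul, hm]

end Products

/-- The star product is bounded for the seminorms `p_R`. -/
theorem isBoundedBilin_starHom [PolynormableSpace 𝕜 V] [IsTopologicalAddGroup V]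
    {Λ : V →ₗ[𝕜] V →ₗ[𝕜] 𝕜} (hproj : ∀ i, Continuous (parityProj 𝒱 i))
    (hΛc : Continuous fun x : V × V => Λ x.1 x.2) (hR : 1 / 2 ≤ R) (hR1 : R < 1) (z : 𝕜) :
    IsBoundedBilin (WeylSpace.starHom 𝒱 R Λ z) := by
  intro p₀
  obtain ⟨p, hpc, hp₀, hp, hΛp⟩ := exists_isAdapted hproj hΛc p₀.2
  let c : NNReal := ⟨4 * (1 + ‖z‖), by positivity⟩
  refine ⟨⟨c • p, (hpc.const_smul c : _)⟩, fun a b => ?_⟩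
  exact (weightedSeminorm_mono hp₀ R _).trans
    (weightedSeminorm_starT_le (c := c) hR hR1 z hp hΛp rfl _ _)

end CompletionTopology

section Exponentials

variable {𝕜 : Type*} [RCLike 𝕜] {V : Type*} [AddCommGroup V] [Module 𝕜 V]
variable {𝒱 : ZMod 2 → Submodule 𝕜 V} [DirectSum.Decomposition 𝒱] {R : ℝ}
variable {Λ : V →ₗ[𝕜] V →ₗ[𝕜] 𝕜}

/-! ### Powers as sums of divided powers -/

/-- The derivation rule for the degree `n = i + m`. -/
theorem smul_sum_antidiagonal {E : Type*} [AddCommGroup E] [Module 𝕜 E] (α : ℕ → 𝕜) (γ : ℕ → E)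
    (n : ℕ) :
    (n : 𝕜) • ∑ x ∈ Finset.HasAntidiagonal.antidiagonal n, α x.1 • γ x.2 =
      ∑ x ∈ Finset.HasAntidiagonal.antidiagonal n, ((x.1 : 𝕜) * α x.1) • γ x.2 +
        ∑ x ∈ Finset.HasAntidiagonal.antidiagonal n, α x.1 • (x.2 : 𝕜) • γ x.2 := by
  rw [Finset.smul_sum, ← Finset.sum_add_distrib]
  refine Finset.sum_congr rfl fun x hx => ?_
  rw [← Finset.HasAntidiagonal.mem_antidiagonal.mp hx]
  push_cast
  module

/-- The symmetric powers of `w + c`, written with divided powers. -/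
theorem WeylSpace.symPow_eq_sum (hΛ : IsEvenForm 𝒱 Λ) {w : V} (hw : w ∈ 𝒱 0) (c : 𝕜) (n : ℕ) :
    WeylSpace.starPow 𝒱 R Λ 0 (WeylSpace.of 𝒱 w + c • WeylSpace.unit 𝒱) n =
      (n.factorial : 𝕜) • ∑ x ∈ Finset.HasAntidiagonal.antidiagonal n,
        (c ^ x.1 / (x.1.factorial : 𝕜)) • WeylSpace.dividedPow 𝒱 R w x.2 := by
  set α : ℕ → 𝕜 := fun i => c ^ i / (i.factorial : 𝕜) with hα
  have hα1 : ∀ i, ((i + 1 : ℕ) : 𝕜) * α (i + 1) = c * α i := fun i => by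
    have h1 : (i.factorial : 𝕜) ≠ 0 := Nat.cast_ne_zero.mpr i.factorial_ne_zero
    have h2 : ((i + 1 : ℕ) : 𝕜) ≠ 0 := Nat.cast_ne_zero.mpr i.succ_ne_zero
    simp only [hα, Nat.factorial_succ, Nat.cast_mul, pow_succ]
    field_simp
  have hγ : ∀ m, WeylSpace.starHom 𝒱 R Λ 0 (WeylSpace.of 𝒱 w + c • WeylSpace.unit 𝒱)
      (WeylSpace.dividedPow 𝒱 R w m) = ((m + 1 : ℕ) : 𝕜) • WeylSpace.dividedPow 𝒱 R w (m + 1) +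
        c • WeylSpace.dividedPow 𝒱 R w m := by
    intro m
    rw [map_add, map_smul, LinearMap.add_apply, LinearMap.smul_apply, WeylSpace.unit_starHom]
    congr 1
    cases m with
    | zero =>
      rw [WeylSpace.dividedPow_zero, WeylSpace.of_starHom_unit_eq_dividedPow, zero_add,
        Nat.cast_one, one_smul]
    | succ m => rw [WeylSpace.of_starHom_dividedPow hΛ 0 hw, zero_mul, zero_smul, add_zero]
  induction n with
  | zero => simp [WeylSpace.starPow_zero, WeylSpace.dividedPow_zero]
  | succ n ih =>
    rw [WeylSpace.starPow_succ, ih, map_smul, map_sum, Nat.factorial_succ, mul_comm, Nat.cast_mul,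
      mul_smul]
    congr 1
    change _ = ((n + 1 : ℕ) : 𝕜) • ∑ x ∈ Finset.HasAntidiagonal.antidiagonal (n + 1),
      α x.1 • WeylSpace.dividedPow 𝒱 R w x.2
    rw [smul_sum_antidiagonal, Finset.Nat.sum_antidiagonal_succ, Finset.Nat.sum_antidiagonal_succ']
    simp only [Nat.cast_zero, zero_mul, zero_smul, smul_zero, zero_add, hα1, map_smul, hγ]
    change ∑ x ∈ Finset.HasAntidiagonal.antidiagonal n, α x.1 • _ = _
    rw [← Finset.sum_add_distrib]
    refine Finset.sum_congr rfl fun x _ => ?_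
    module

/-- The coefficients of the power series `exp (c t²)`. -/
def expSqCoeff (c : 𝕜) (i : ℕ) : 𝕜 := if Even i then c ^ (i / 2) / ((i / 2).factorial : 𝕜) else 0

theorem expSqCoeff_two_mul (c : 𝕜) (j : ℕ) :
    expSqCoeff c (2 * j) = c ^ j / (j.factorial : 𝕜) := by
  rw [expSqCoeff, if_pos (even_two_mul j), Nat.mul_div_cancel_left j two_pos]

theorem expSqCoeff_recurrence (c : 𝕜) (i : ℕ) :
    ((i + 1 + 1 : ℕ) : 𝕜) * expSqCoeff c (i + 1 + 1) = 2 * c * expSqCoeff c i := by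
  rcases Nat.even_or_odd' i with ⟨j, rfl | rfl⟩
  · have h1 : (j.factorial : 𝕜) ≠ 0 := Nat.cast_ne_zero.mpr j.factorial_ne_zero
    have h2 : ((j + 1 : ℕ) : 𝕜) ≠ 0 := Nat.cast_ne_zero.mpr j.succ_ne_zero
    rw [show 2 * j + 1 + 1 = 2 * (j + 1) by ring, expSqCoeff_two_mul, expSqCoeff_two_mul,
      Nat.factorial_succ, Nat.cast_mul, Nat.cast_mul, pow_succ]
    field_simp
    push_cast
    ring
  · rw [expSqCoeff, if_neg (by simp [parity_simps]), expSqCoeff, if_neg (by simp [parity_simps])]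
    simp

/-- The star powers of `w`, written with divided powers. The generating function of the left-hand
side divided by `n!` is `exp (t w + t² z Λ(w, w) / 2)`. -/
theorem WeylSpace.starPow_eq_sum (hΛ : IsEvenForm 𝒱 Λ) (z : 𝕜) {w : V} (hw : w ∈ 𝒱 0) (n : ℕ) :
    WeylSpace.starPow 𝒱 R Λ z (WeylSpace.of 𝒱 w) n =
      (n.factorial : 𝕜) • ∑ x ∈ Finset.HasAntidiagonal.antidiagonal n,
        expSqCoeff (z / 2 * Λ w w) x.1 • WeylSpace.dividedPow 𝒱 R w x.2 := by
  set α : ℕ → 𝕜 := expSqCoeff (z / 2 * Λ w w) with hα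
  have hα0 : α 0 = 1 := by simp [hα, expSqCoeff]
  have hα1 : α 1 = 0 := by simp [hα, expSqCoeff]
  have hα2 : ∀ i, ((i + 1 + 1 : ℕ) : 𝕜) * α (i + 1 + 1) = z * Λ w w * α i := fun i => by
    rw [hα, expSqCoeff_recurrence]
    ring
  induction n with
  | zero => simp [WeylSpace.starPow_zero, WeylSpace.dividedPow_zero, hα0]
  | succ n ih =>
    rw [WeylSpace.starPow_succ, ih, map_smul, map_sum, Nat.factorial_succ, mul_comm, Nat.cast_mul,
      mul_smul]
    congr 1
    rw [smul_sum_antidiagonal, Finset.Nat.sum_antidiagonal_succ, Finset.Nat.sum_antidiagonal_succ']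
    simp only [Nat.cast_zero, zero_mul, zero_smul, smul_zero, zero_add, map_smul]
    cases n with
    | zero =>
      simp [WeylSpace.dividedPow_zero, WeylSpace.of_starHom_unit_eq_dividedPow, hα1]
    | succ n =>
      rw [Finset.Nat.sum_antidiagonal_succ', Finset.Nat.sum_antidiagonal_succ,
        Finset.Nat.sum_antidiagonal_succ']
      simp only [WeylSpace.dividedPow_zero, WeylSpace.of_starHom_unit_eq_dividedPow,
        WeylSpace.of_starHom_dividedPow hΛ z hw, hα2, zero_add, hα1, mul_zero, zero_smul,
        Nat.cast_one, one_smul]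
      rw [add_left_comm, ← Finset.sum_add_distrib]
      congr 1
      refine Finset.sum_congr rfl fun x _ => ?_
      module

/-! ### The exponential series -/

theorem hasSum_pow_div_factorial (c : 𝕜) :
    HasSum (fun i : ℕ => c ^ i / (i.factorial : 𝕜)) (NormedSpace.exp c) :=
  NormedSpace.expSeries_div_hasSum_exp c

theorem summable_norm_pow_div_factorial (c : 𝕜) :
    Summable fun i : ℕ => ‖c ^ i / (i.factorial : 𝕜)‖ :=
  NormedSpace.norm_expSeries_div_summable c

theorem expSqCoeff_eq_zero (c : 𝕜) {i : ℕ} (hi : i ∉ Set.range fun j : ℕ => 2 * j) :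
    expSqCoeff c i = 0 :=
  if_neg fun ⟨j, hj⟩ => hi ⟨j, by rw [hj]; ring⟩

theorem hasSum_expSqCoeff (c : 𝕜) : HasSum (expSqCoeff c) (NormedSpace.exp c) := by
  rw [← (mul_right_injective₀ (two_ne_zero (α := ℕ))).hasSum_iff fun i hi =>
    expSqCoeff_eq_zero c hi]
  exact (hasSum_pow_div_factorial c).congr_fun fun j => (expSqCoeff_two_mul c j)

theorem summable_norm_expSqCoeff (c : 𝕜) : Summable fun i => ‖expSqCoeff c i‖ := by
  rw [← (mul_right_injective₀ (two_ne_zero (α := ℕ))).summable_iff fun i hi => by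
    rw [expSqCoeff_eq_zero c hi, norm_zero]]
  exact (summable_norm_pow_div_factorial c).congr fun j => by
    rw [Function.comp_apply, expSqCoeff_two_mul]

/-- The series that dominates the seminorms of the divided powers `wᵐ / m!`, with `x = p(w)`. It
is here that `R < 1` is needed. -/
theorem summable_pow_mul_factorial_rpow (x : ℝ) (hR1 : R < 1) :
    Summable fun m : ℕ => (m.factorial : ℝ)⁻¹ * ((m.factorial : ℝ) ^ R * x ^ m) := by
  have hlim : Filter.Tendsto (fun m : ℕ => |x| * ((m + 1 : ℕ) : ℝ) ^ (-(1 - R))) Filter.atTop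
      (nhds (|x| * 0)) :=
    (((tendsto_rpow_neg_atTop (sub_pos.mpr hR1)).comp tendsto_natCast_atTop_atTop).comp
      (Filter.tendsto_add_atTop_nat 1)).const_mul _
  rw [mul_zero] at hlim
  refine summable_of_ratio_norm_eventually_le (r := 1 / 2) (by norm_num) ?_
  filter_upwards [hlim.eventually (gt_mem_nhds one_half_pos)] with m hm
  have h0 : (0 : ℝ) < ((m + 1 : ℕ) : ℝ) := by positivity
  have h1 : (0 : ℝ) < (m.factorial : ℝ) := by positivity
  have h2 : ((m + 1 : ℕ) : ℝ)⁻¹ * ((m + 1 : ℕ) : ℝ) ^ R = ((m + 1 : ℕ) : ℝ) ^ (-(1 - R)) := by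
    rw [← Real.rpow_neg_one, ← Real.rpow_add h0]
    congr 1
    ring
  have h3 : (((m + 1).factorial : ℝ)⁻¹ * (((m + 1).factorial : ℝ) ^ R * x ^ (m + 1))) =
      (((m + 1 : ℕ) : ℝ) ^ (-(1 - R)) * x) *
        ((m.factorial : ℝ)⁻¹ * ((m.factorial : ℝ) ^ R * x ^ m)) := by
    rw [← h2, Nat.factorial_succ, Nat.cast_mul, mul_inv, Real.mul_rpow h0.le h1.le, pow_succ]
    ring
  rw [h3, norm_mul]
  refine mul_le_mul_of_nonneg_right ?_ (norm_nonneg _)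
  rw [norm_mul, Real.norm_eq_abs, Real.norm_eq_abs, abs_of_nonneg (by positivity), mul_comm]
  exact hm.le

variable [TopologicalSpace V]

theorem absSummable_dividedPow (hR1 : R < 1) {w : V} (hw : w ∈ 𝒱 0) :
    AbsSummable (WeylSpace.dividedPow 𝒱 R w) :=
  AbsSummable.of_le fun p => by
    refine ⟨_, summable_pow_mul_factorial_rpow (p.1 w) hR1, fun m => ?_⟩
    rw [WeylSpace.dividedPow, map_smul_eq_mul, norm_inv, RCLike.norm_natCast]
    refine mul_le_mul_of_nonneg_left ?_ (by positivity)
    change weightedSeminorm p.1 R (symmetrizer 𝒱 (tensOf w ^ m)) ≤ _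
    rw [mem_symTens_iff.mp (tensOf_pow_mem_symTens hw m), tensOf_pow_eq_elem]
    refine (weightedSeminorm_elem_le p.1 R _).trans_eq ?_
    rw [Finset.prod_const, Finset.card_univ, Fintype.card_fin]

/-- The summands of the Cauchy product of a scalar series with a series of symmetric tensors are
absolutely summable. -/
theorem absSummable_smul {α : ℕ → 𝕜} (hα : Summable fun i => ‖α i‖) {γ : ℕ → WeylSpace 𝒱 R}
    (hγ : AbsSummable γ) : AbsSummable fun x : ℕ × ℕ => α x.1 • γ x.2 :=
  AbsSummable.of_le fun p => ⟨_, hα.mul_of_nonneg (hγ p) (fun _ => norm_nonneg _)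
    (fun _ => apply_nonneg _ _), fun _ => (map_smul_eq_mul _ _ _).le⟩

theorem hasSum_coe_sum_antidiagonal_smul {α : ℕ → 𝕜} (hα : Summable fun i => ‖α i‖) {s : 𝕜}
    (hs : HasSum α s) {γ : ℕ → WeylSpace 𝒱 R} (hγ : AbsSummable γ) :
    HasSum (fun n => ((∑ x ∈ Finset.HasAntidiagonal.antidiagonal n, α x.1 • γ x.2 :
      WeylSpace 𝒱 R) : WeylCompletion 𝒱 R)) (s • ∑' m, (γ m : WeylCompletion 𝒱 R)) := by
  have h1 := (absSummable_smul hα hγ).summable_coe.hasSum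
  have h2 := ((Equiv.prodComm ℕ ℕ).hasSum_iff.mpr h1).prod_fiberwise
    (g := fun m => ((s • γ m : WeylSpace 𝒱 R) : WeylCompletion 𝒱 R)) fun m =>
    (hs.smul_const (γ m)).map (coeHom 𝒱 R) (UniformSpace.Completion.continuous_coe _)
  have h3 : HasSum (fun m => ((s • γ m : WeylSpace 𝒱 R) : WeylCompletion 𝒱 R))
      (s • ∑' m, (γ m : WeylCompletion 𝒱 R)) := by
    simp only [UniformSpace.Completion.coe_smul]
    exact hγ.summable_coe.hasSum.const_smul s
  rw [h2.unique h3] at h1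
  simpa only [coe_sum] using hasSum_sum_antidiagonal h1

end Exponentials

section InnerTranslations

variable {𝕜 : Type*} [RCLike 𝕜] {V : Type*} [AddCommGroup V] [Module 𝕜 V] [TopologicalSpace V]
variable {𝒱 : ZMod 2 → Submodule 𝕜 V} [DirectSum.Decomposition 𝒱] {R : ℝ}
variable {Λ : V →ₗ[𝕜] V →ₗ[𝕜] 𝕜}

/-! ### The star exponential in the completion -/

theorem IsBoundedBilin.isContinuousExtension_star {z : 𝕜}
    (hB : IsBoundedBilin (WeylSpace.starHom 𝒱 R Λ z)) :
    IsContinuousExtension (WeylSpace.star 𝒱 (R := R) Λ z) (starC 𝒱 Λ z) :=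
  hB.isContinuousExtension

variable (R Λ) in
omit [TopologicalSpace V] in
theorem sym_eq_star : WeylSpace.sym 𝒱 (R := R) = WeylSpace.star 𝒱 Λ 0 :=
  funext fun a => funext fun b => WeylSpace.sym_eq_starHom Λ a b

variable (R Λ) in
theorem symC_eq_starC : symC 𝒱 (R := R) = starC 𝒱 Λ 0 := by
  rw [symC, starC, sym_eq_star R Λ]

variable {z : 𝕜}

theorem powC_starC_coe (hΛ : IsEvenForm 𝒱 Λ)
    (hM : IsContinuousExtension (WeylSpace.star 𝒱 (R := R) Λ z) (starC 𝒱 Λ z))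
    (a : WeylSpace 𝒱 R) (n : ℕ) :
    powC (starC 𝒱 Λ z) (a : WeylCompletion 𝒱 R) n =
      (WeylSpace.starPow 𝒱 R Λ z a n : WeylCompletion 𝒱 R) := by
  induction n with
  | zero => rfl
  | succ n ih =>
    rw [powC, ih, hM.extends_mul, WeylSpace.star_eq_starHom, WeylSpace.starPow_succ' hΛ]

variable (𝒱 R Λ z) in
/-- The terms `aⁿ / n!` of the star exponential of a symmetric tensor. -/
def WeylSpace.starExpTerm (a : WeylSpace 𝒱 R) (n : ℕ) : WeylSpace 𝒱 R :=
  (n.factorial : 𝕜)⁻¹ • WeylSpace.starPow 𝒱 R Λ z a n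

theorem expTerm_starC_coe (hΛ : IsEvenForm 𝒱 Λ)
    (hM : IsContinuousExtension (WeylSpace.star 𝒱 (R := R) Λ z) (starC 𝒱 Λ z))
    (a : WeylSpace 𝒱 R) :
    expTerm (starC 𝒱 Λ z) (a : WeylCompletion 𝒱 R) =
      fun n => (WeylSpace.starExpTerm 𝒱 R Λ z a n : WeylCompletion 𝒱 R) :=
  funext fun n => by
    rw [expTerm, powC_starC_coe hΛ hM, WeylSpace.starExpTerm, UniformSpace.Completion.coe_smul]

omit [TopologicalSpace V] in
theorem WeylSpace.starExpTerm_of (hΛ : IsEvenForm 𝒱 Λ) {w : V} (hw : w ∈ 𝒱 0) :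
    WeylSpace.starExpTerm 𝒱 R Λ z (WeylSpace.of 𝒱 w) =
      fun n => ∑ x ∈ Finset.HasAntidiagonal.antidiagonal n,
        expSqCoeff (z / 2 * Λ w w) x.1 • WeylSpace.dividedPow 𝒱 R w x.2 :=
  funext fun n => by
    rw [WeylSpace.starExpTerm, WeylSpace.starPow_eq_sum hΛ z hw,
      inv_smul_smul₀ (Nat.cast_ne_zero.mpr n.factorial_ne_zero)]

omit [TopologicalSpace V] in
theorem WeylSpace.symExpTerm_of_add (hΛ : IsEvenForm 𝒱 Λ) {w : V} (hw : w ∈ 𝒱 0) (c : 𝕜) :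
    WeylSpace.starExpTerm 𝒱 R Λ 0 (WeylSpace.of 𝒱 w + c • WeylSpace.unit 𝒱) =
      fun n => ∑ x ∈ Finset.HasAntidiagonal.antidiagonal n,
        (c ^ x.1 / (x.1.factorial : 𝕜)) • WeylSpace.dividedPow 𝒱 R w x.2 :=
  funext fun n => by
    rw [WeylSpace.starExpTerm, WeylSpace.symPow_eq_sum hΛ hw,
      inv_smul_smul₀ (Nat.cast_ne_zero.mpr n.factorial_ne_zero)]

theorem absSummable_starExpTerm (hΛ : IsEvenForm 𝒱 Λ) (hR1 : R < 1) (z : 𝕜) {w : V}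
    (hw : w ∈ 𝒱 0) : AbsSummable (WeylSpace.starExpTerm 𝒱 R Λ z (WeylSpace.of 𝒱 w)) := by
  rw [WeylSpace.starExpTerm_of hΛ hw]
  exact (absSummable_smul (summable_norm_expSqCoeff _)
    (absSummable_dividedPow hR1 hw)).sum_antidiagonal

theorem of_add_smul_unit_eq_coe (w : V) (c : 𝕜) :
    of 𝒱 (R := R) w + c • unit 𝒱 =
      ((WeylSpace.of 𝒱 w + c • WeylSpace.unit 𝒱 : WeylSpace 𝒱 R) : WeylCompletion 𝒱 R) := by
  rw [UniformSpace.Completion.coe_add, UniformSpace.Completion.coe_smul]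
  rfl

theorem convergesAbsolutely_expTerm_starC (hΛ : IsEvenForm 𝒱 Λ) (hR1 : R < 1)
    (hM : IsContinuousExtension (WeylSpace.star 𝒱 (R := R) Λ z) (starC 𝒱 Λ z))
    {w : V} (hw : w ∈ 𝒱 0) :
    ConvergesAbsolutely (expTerm (starC 𝒱 Λ z) (of 𝒱 (R := R) w))
      (expC (starC 𝒱 Λ z) (of 𝒱 w)) := by
  rw [expC, of, expTerm_starC_coe hΛ hM]
  exact (absSummable_starExpTerm hΛ hR1 z hw).convergesAbsolutely

theorem convergesAbsolutely_expTerm_symC (hΛ : IsEvenForm 𝒱 Λ) (hR1 : R < 1)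
    (hM : IsContinuousExtension (WeylSpace.star 𝒱 (R := R) Λ 0) (starC 𝒱 Λ 0))
    {w : V} (hw : w ∈ 𝒱 0) (c : 𝕜) :
    ConvergesAbsolutely (expTerm (symC 𝒱) (of 𝒱 (R := R) w + c • unit 𝒱))
      (expC (symC 𝒱) (of 𝒱 w + c • unit 𝒱)) := by
  rw [expC, of_add_smul_unit_eq_coe, symC_eq_starC R Λ, expTerm_starC_coe hΛ hM,
    WeylSpace.symExpTerm_of_add hΛ hw]
  exact (absSummable_smul (summable_norm_pow_div_factorial _)
    (absSummable_dividedPow hR1 hw)).sum_antidiagonal.convergesAbsolutely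

/-- Both exponentials are the product of `exp (z Λ(w, w) / 2)` with the sum of the divided powers
of `w`. -/
theorem expC_starC_eq_expC_symC (hΛ : IsEvenForm 𝒱 Λ) (hR1 : R < 1)
    (hM : IsContinuousExtension (WeylSpace.star 𝒱 (R := R) Λ z) (starC 𝒱 Λ z))
    (hM0 : IsContinuousExtension (WeylSpace.star 𝒱 (R := R) Λ 0) (starC 𝒱 Λ 0))
    {w : V} (hw : w ∈ 𝒱 0) :
    expC (starC 𝒱 Λ z) (of 𝒱 (R := R) w) =
      expC (symC 𝒱) (of 𝒱 w + (z / 2 * Λ w w) • unit 𝒱) := by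
  rw [expC, expC, of_add_smul_unit_eq_coe, symC_eq_starC R Λ, expTerm_starC_coe hΛ hM0, of,
    expTerm_starC_coe hΛ hM, WeylSpace.symExpTerm_of_add hΛ hw, WeylSpace.starExpTerm_of hΛ hw]
  rw [(hasSum_coe_sum_antidiagonal_smul (summable_norm_expSqCoeff _) (hasSum_expSqCoeff _)
      (absSummable_dividedPow hR1 hw)).tsum_eq,
    (hasSum_coe_sum_antidiagonal_smul (summable_norm_pow_div_factorial _)
      (hasSum_pow_div_factorial _) (absSummable_dividedPow hR1 hw)).tsum_eq]

theorem hasSum_expC_starC (hΛ : IsEvenForm 𝒱 Λ) (hR1 : R < 1)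
    (hM : IsContinuousExtension (WeylSpace.star 𝒱 (R := R) Λ z) (starC 𝒱 Λ z))
    {w : V} (hw : w ∈ 𝒱 0) :
    HasSum (fun n => (WeylSpace.starExpTerm 𝒱 R Λ z (WeylSpace.of 𝒱 w) n : WeylCompletion 𝒱 R))
      (expC (starC 𝒱 Λ z) (of 𝒱 w)) := by
  have := (convergesAbsolutely_expTerm_starC hΛ hR1 hM hw).1
  rwa [of, expTerm_starC_coe hΛ hM] at this

/-! ### Translations as inner automorphisms -/

omit [TopologicalSpace V] in
/-- The binomial theorem for `(a - a)ⁿ`. -/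
theorem WeylSpace.sum_starExpTerm_neg (hΛ : IsEvenForm 𝒱 Λ) (a : WeylSpace 𝒱 R) (n : ℕ) :
    ∑ x ∈ Finset.HasAntidiagonal.antidiagonal n, WeylSpace.starHom 𝒱 R Λ z
      (WeylSpace.starExpTerm 𝒱 R Λ z a x.1) (WeylSpace.starExpTerm 𝒱 R Λ z (-a) x.2) =
      if n = 0 then WeylSpace.unit 𝒱 else 0 := by
  have hterm : ∀ x ∈ Finset.HasAntidiagonal.antidiagonal n, WeylSpace.starHom 𝒱 R Λ z
      (WeylSpace.starExpTerm 𝒱 R Λ z a x.1) (WeylSpace.starExpTerm 𝒱 R Λ z (-a) x.2) =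
      ((n.factorial : 𝕜)⁻¹ * (n.choose x.1 • ((1 : 𝕜) ^ x.1 * (-1 : 𝕜) ^ x.2))) •
        WeylSpace.starPow 𝒱 R Λ z a n := by
    intro x hx
    have hn := Finset.HasAntidiagonal.mem_antidiagonal.mp hx
    have hc : (n.choose x.1 : 𝕜) * (x.1.factorial * x.2.factorial) = n.factorial := by
      have := Nat.choose_mul_factorial_mul_factorial (Nat.le_add_right x.1 x.2)
      rw [Nat.add_sub_cancel_left, hn] at this
      rw [← mul_assoc]
      exact_mod_cast this
    have h1 : (x.1.factorial : 𝕜) ≠ 0 := Nat.cast_ne_zero.mpr x.1.factorial_ne_zero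
    have h2 : (x.2.factorial : 𝕜) ≠ 0 := Nat.cast_ne_zero.mpr x.2.factorial_ne_zero
    have h3 : (n.factorial : 𝕜) ≠ 0 := Nat.cast_ne_zero.mpr n.factorial_ne_zero
    rw [WeylSpace.starExpTerm, WeylSpace.starExpTerm, WeylSpace.starPow_neg, map_smul, map_smul,
      map_smul, LinearMap.smul_apply, ← WeylSpace.starPow_add hΛ, hn, smul_smul, smul_smul,
      one_pow, one_mul, nsmul_eq_mul]
    congr 1
    field_simp
    rw [← hc]
    ring
  rw [Finset.sum_congr rfl hterm, ← Finset.sum_smul, ← Finset.mul_sum,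
    ← (Commute.all (1 : 𝕜) (-1)).add_pow', add_neg_cancel]
  split_ifs with h
  · subst h
    simp [WeylSpace.starPow_zero]
  · rw [zero_pow h, mul_zero, zero_smul]

theorem expC_mul_expC_neg (hΛ : IsEvenForm 𝒱 Λ) (hR1 : R < 1)
    (hB : IsBoundedBilin (WeylSpace.starHom 𝒱 R Λ z)) {w : V} (hw : w ∈ 𝒱 0) :
    starC 𝒱 Λ z (expC (starC 𝒱 Λ z) (of 𝒱 (R := R) w)) (expC (starC 𝒱 Λ z) (of 𝒱 (-w))) =
      unit 𝒱 := by
  have hM := hB.isContinuousExtension_star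
  have hw' : -w ∈ 𝒱 0 := neg_mem hw
  have habs := hB.absSummable (absSummable_starExpTerm hΛ hR1 z hw)
    (absSummable_starExpTerm hΛ hR1 z hw')
  have hsum := hM.hasSum_prod (hasSum_expC_starC hΛ hR1 hM hw) (hasSum_expC_starC hΛ hR1 hM hw')
    (habs.summable_coe.congr fun x => (hM.extends_mul _ _).symm)
  have h1 := hasSum_sum_antidiagonal hsum
  refine h1.unique ?_
  have h2 : ∀ n, ∑ x ∈ Finset.HasAntidiagonal.antidiagonal n, starC 𝒱 Λ z
      (WeylSpace.starExpTerm 𝒱 R Λ z (WeylSpace.of 𝒱 w) x.1 : WeylCompletion 𝒱 R)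
      (WeylSpace.starExpTerm 𝒱 R Λ z (WeylSpace.of 𝒱 (-w)) x.2 : WeylCompletion 𝒱 R) =
      if n = 0 then unit 𝒱 else 0 := by
    intro n
    simp only [hM.extends_mul, ← coe_sum, WeylSpace.star_eq_starHom, WeylSpace.of_neg,
      WeylSpace.sum_starExpTerm_neg hΛ]
    split_ifs
    · rfl
    · exact UniformSpace.Completion.coe_zero
  simp only [h2]
  exact hasSum_ite_eq 0 (unit 𝒱)

/-- If `w` is even and `2 z w^♯ = φ`, then `Exp(w) ⋆ v = (v + φ(v)) ⋆ Exp(w)`. -/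
theorem expC_starC_of (hΛ : IsEvenForm 𝒱 Λ) (hR1 : R < 1)
    (hM : IsContinuousExtension (WeylSpace.star 𝒱 (R := R) Λ z) (starC 𝒱 Λ z))
    {w : V} (hw : w ∈ 𝒱 0) {φ : V →ₗ[𝕜] 𝕜} (hwφ : (2 * z) • sharp 𝒱 Λ w = φ)
    {i : ZMod 2} {v : V} (hv : v ∈ 𝒱 i) :
    starC 𝒱 Λ z (expC (starC 𝒱 Λ z) (of 𝒱 (R := R) w)) (of 𝒱 v) =
      starC 𝒱 Λ z (of 𝒱 v) (expC (starC 𝒱 Λ z) (of 𝒱 w)) +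
        φ v • expC (starC 𝒱 Λ z) (of 𝒱 w) := by
  set E := WeylSpace.starExpTerm 𝒱 R Λ z (WeylSpace.of 𝒱 w) with hE
  have hφ : φ v = z * (Λ w v - Λ v w) := by rw [← hwφ, two_mul_smul_sharp_apply z hw hv]
  have hu := hasSum_expC_starC hΛ hR1 hM hw
  have hl := hM.hasSum_left hu (of 𝒱 v)
  have hr := hM.hasSum_right hu (of 𝒱 v)
  have h0 : E 0 = WeylSpace.unit 𝒱 := by simp [hE, WeylSpace.starExpTerm, WeylSpace.starPow_zero]
  have hstep : ∀ n, WeylSpace.starHom 𝒱 R Λ z (E (n + 1)) (WeylSpace.of 𝒱 v) =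
      WeylSpace.starHom 𝒱 R Λ z (WeylSpace.of 𝒱 v) (E (n + 1)) + φ v • E n := by
    intro n
    have h1 : (n.factorial : 𝕜) ≠ 0 := Nat.cast_ne_zero.mpr n.factorial_ne_zero
    have h2 : ((n + 1 : ℕ) : 𝕜) ≠ 0 := Nat.cast_ne_zero.mpr n.succ_ne_zero
    simp only [hE, WeylSpace.starExpTerm, map_smul, LinearMap.smul_apply,
      WeylSpace.starPow_starHom_of hΛ z hw hv, smul_add, smul_smul, ← hφ]
    congr 2
    rw [Nat.factorial_succ, Nat.cast_mul]
    field_simp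
  -- The terms of the two series differ by a shift of the exponential series.
  have hd := hl.sub hr
  rw [← hasSum_nat_add_iff' 1, Finset.sum_range_one] at hd
  have h00 : starC 𝒱 Λ z (E 0 : WeylCompletion 𝒱 R) (of 𝒱 v) -
      starC 𝒱 Λ z (of 𝒱 v) (E 0 : WeylCompletion 𝒱 R) = 0 := by
    rw [of, hM.extends_mul, hM.extends_mul, WeylSpace.star_eq_starHom, WeylSpace.star_eq_starHom,
      h0, WeylSpace.unit_starHom, WeylSpace.starHom_unit, sub_self]
  rw [h00, sub_zero] at hd
  have hd' : HasSum (fun n => φ v • (E n : WeylCompletion 𝒱 R))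
      (φ v • expC (starC 𝒱 Λ z) (of 𝒱 w)) := hu.const_smul _
  have hEq : (fun n => starC 𝒱 Λ z (E (n + 1) : WeylCompletion 𝒱 R) (of 𝒱 v) -
      starC 𝒱 Λ z (of 𝒱 v) (E (n + 1) : WeylCompletion 𝒱 R)) =
      fun n => φ v • (E n : WeylCompletion 𝒱 R) := by
    funext n
    rw [of, hM.extends_mul, hM.extends_mul, WeylSpace.star_eq_starHom, WeylSpace.star_eq_starHom,
      hstep, UniformSpace.Completion.coe_add, UniformSpace.Completion.coe_smul, add_sub_cancel_left]
  rw [hEq] at hd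
  rw [hd'.unique hd, add_sub_cancel]

/-- The translation by `2 z w^♯` is the conjugation by the star exponential of `w`, on symmetric
tensors. -/
theorem conj_coe_eq_translate (hΛ : IsEvenForm 𝒱 Λ) (hR1 : R < 1)
    (hB : IsBoundedBilin (WeylSpace.starHom 𝒱 R Λ z)) {w : V} (hw : w ∈ 𝒱 0) {φ : V →ₗ[𝕜] 𝕜}
    (hφ : IsHomFunctional 𝒱 φ 0) (hwφ : (2 * z) • sharp 𝒱 Λ w = φ) (a : WeylSpace 𝒱 R) :
    starC 𝒱 Λ z (starC 𝒱 Λ z (expC (starC 𝒱 Λ z) (of 𝒱 w)) (a : WeylCompletion 𝒱 R))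
        (expC (starC 𝒱 Λ z) (of 𝒱 (-w))) =
      (WeylSpace.translate 𝒱 φ a : WeylCompletion 𝒱 R) := by
  have hM := hB.isContinuousExtension_star
  have hassoc := hM.assoc (WeylSpace.starHom_assoc hΛ z)
  have hunit := expC_mul_expC_neg hΛ hR1 hB hw
  have hcomm := fun {i} {v : V} (hv : v ∈ 𝒱 i) => expC_starC_of hΛ hR1 hM hw hwφ hv
  generalize expC (starC 𝒱 Λ z) (of 𝒱 (R := R) w) = u at *
  generalize expC (starC 𝒱 Λ z) (of 𝒱 (R := R) (-w)) = u' at *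
  let J : Submodule 𝕜 (WeylSpace 𝒱 R) := LinearMap.eqLocus
    (hM.mulRight u' ∘ₗ hM.mulLeft u ∘ₗ coeHom 𝒱 R)
    (coeHom 𝒱 R ∘ₗ WeylSpace.translateHom 𝒱 R φ)
  refine WeylSpace.mem_of_starHom_mem (J := J) hΛ z ?_ (fun i v hv a ha => ?_) a
  · change starC 𝒱 Λ z (starC 𝒱 Λ z u (unit 𝒱)) u' =
      (WeylSpace.translateHom 𝒱 R φ (WeylSpace.unit 𝒱) : WeylCompletion 𝒱 R)
    rw [hM.mul_unit (WeylSpace.starHom_unit z), hunit, WeylSpace.translateHom_unit hφ]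
    rfl
  · change starC 𝒱 Λ z (starC 𝒱 Λ z u (a : WeylCompletion 𝒱 R)) u' =
      (WeylSpace.translateHom 𝒱 R φ a : WeylCompletion 𝒱 R) at ha
    change starC 𝒱 Λ z (starC 𝒱 Λ z u
      (WeylSpace.starHom 𝒱 R Λ z (WeylSpace.of 𝒱 v) a : WeylCompletion 𝒱 R)) u' =
      (WeylSpace.translateHom 𝒱 R φ (WeylSpace.starHom 𝒱 R Λ z (WeylSpace.of 𝒱 v) a) :
        WeylCompletion 𝒱 R)
    rw [WeylSpace.translateHom_of_starHom hΛ z hφ hv, UniformSpace.Completion.coe_add,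
      UniformSpace.Completion.coe_smul, ← WeylSpace.star_eq_starHom, ← WeylSpace.star_eq_starHom,
      ← hM.extends_mul, ← hM.extends_mul, ← hassoc, ← of, hcomm hv, (hM.linear_left _).map_add,
      (hM.linear_left _).map_add, (hM.linear_left _).map_smul, (hM.linear_left _).map_smul,
      hassoc (of 𝒱 v), hassoc (of 𝒱 v), ha]

/-- The continuity of the translation is read off from its form as a conjugation; no estimate for
the translation itself is needed. -/
theorem uniformContinuous_translate (hΛ : IsEvenForm 𝒱 Λ) (hR1 : R < 1)
    (hB : IsBoundedBilin (WeylSpace.starHom 𝒱 R Λ z)) {w : V} (hw : w ∈ 𝒱 0) {φ : V →ₗ[𝕜] 𝕜}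
    (hφ : IsHomFunctional 𝒱 φ 0) (hwφ : (2 * z) • sharp 𝒱 Λ w = φ) :
    UniformContinuous (WeylSpace.translate 𝒱 (R := R) φ) := by
  have hM := hB.isContinuousExtension_star
  have h : Continuous (WeylSpace.translateHom 𝒱 R φ) := by
    rw [(UniformSpace.Completion.isUniformInducing_coe _).isInducing.continuous_iff]
    refine Continuous.congr ?_ (conj_coe_eq_translate hΛ hR1 hB hw hφ hwφ)
    exact hM.continuous₂ (hM.continuous₂ continuous_const
      (UniformSpace.Completion.continuous_coe _)) continuous_const
  exact uniformContinuous_addMonoidHom_of_continuous h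

theorem isConjugation_translateC (hΛ : IsEvenForm 𝒱 Λ) (hR1 : R < 1)
    (hB : IsBoundedBilin (WeylSpace.starHom 𝒱 R Λ z)) {w : V} (hw : w ∈ 𝒱 0) {φ : V →ₗ[𝕜] 𝕜}
    (hφ : IsHomFunctional 𝒱 φ 0) (hwφ : (2 * z) • sharp 𝒱 Λ w = φ) :
    IsConjugation (R := R) (starC 𝒱 Λ z) (expC (starC 𝒱 Λ z) (of 𝒱 w))
      (expC (starC 𝒱 Λ z) (of 𝒱 (-w))) (translateC 𝒱 φ) := by
  have hM := hB.isContinuousExtension_star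
  have huc := uniformContinuous_translate hΛ hR1 hB hw hφ hwφ
  have hconj : ∀ a, translateC 𝒱 (R := R) φ a = starC 𝒱 Λ z
      (starC 𝒱 Λ z (expC (starC 𝒱 Λ z) (of 𝒱 w)) a) (expC (starC 𝒱 Λ z) (of 𝒱 (-w))) := by
    intro a
    induction a using UniformSpace.Completion.induction_on with
    | hp =>
      exact isClosed_eq UniformSpace.Completion.continuous_map
        (hM.continuous₂ (hM.continuous₂ continuous_const continuous_id) continuous_const)
    | ih a =>
      rw [conj_coe_eq_translate hΛ hR1 hB hw hφ hwφ]
      exact UniformSpace.Completion.map_coe huc a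
  refine ⟨expC_mul_expC_neg hΛ hR1 hB hw, ?_, hconj, fun a => ?_⟩
  · simpa using expC_mul_expC_neg hΛ hR1 hB (neg_mem hw)
  · rw [hconj, hM.assoc (WeylSpace.starHom_assoc hΛ z)]

/-- The conjugation by an invertible element is a continuous automorphism. -/
theorem IsConjugation.isContinuousAut (hΛ : IsEvenForm 𝒱 Λ)
    (hM : IsContinuousExtension (WeylSpace.star 𝒱 (R := R) Λ z) (starC 𝒱 Λ z))
    {u u' : WeylCompletion 𝒱 R} {T : WeylCompletion 𝒱 R → WeylCompletion 𝒱 R}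
    (hT : IsConjugation (starC 𝒱 Λ z) u u' T) : IsContinuousAut (𝕜 := 𝕜) (starC 𝒱 Λ z) T := by
  have hassoc := hM.assoc (WeylSpace.starHom_assoc hΛ z)
  have h1 := hM.unit_mul (WeylSpace.unit_starHom z)
  have h2 := hM.mul_unit (WeylSpace.starHom_unit z)
  obtain ⟨huu', hu'u, hc, -⟩ := hT
  refine ⟨⟨fun a b => ?_, fun c a => ?_⟩, ?_, fun a b => ?_, ?_, ?_⟩
  · rw [hc, hc, hc, (hM.linear_right u).map_add, (hM.linear_left u').map_add]
  · rw [hc, hc, (hM.linear_right u).map_smul, (hM.linear_left u').map_smul]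
  · rw [hc, h2, huu']
  · rw [hc, hc, hc, hassoc _ u', ← hassoc u', ← hassoc u', hu'u, h1, ← hassoc, ← hassoc]
  · refine Function.bijective_iff_has_inverse.mpr
      ⟨fun a => starC 𝒱 Λ z (starC 𝒱 Λ z u' a) u, fun a => ?_, fun a => ?_⟩
    · simp only [hc]
      rw [hassoc, hassoc _ u' u, hu'u, h2, ← hassoc, hu'u, h1]
    · simp only [hc]
      rw [hassoc, hassoc _ u u', huu', h2, ← hassoc, huu', h1]
  · rw [funext hc]
    exact hM.continuous₂ (hM.continuous₂ continuous_const continuous_id) continuous_const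

end InnerTranslations

end Weyl

end

theorem mainTheorem7 {𝕜 : Type*} [RCLike 𝕜] {V : Type*} [AddCommGroup V] [Module 𝕜 V]
    [TopologicalSpace V] [IsTopologicalAddGroup V] [ContinuousSMul 𝕜 V] [PolynormableSpace 𝕜 V]
    [T2Space V]
    (𝒱 : ZMod 2 → Submodule 𝕜 V) [DirectSum.Decomposition 𝒱]
    (hproj : ∀ i, Continuous (Weyl.parityProj 𝒱 i))
    (Λ : V →ₗ[𝕜] V →ₗ[𝕜] 𝕜) (hΛ : Weyl.IsEvenForm 𝒱 Λ)
    (hΛc : Continuous fun x : V × V => Λ x.1 x.2)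
    (R : ℝ) (hR : 1 / 2 ≤ R) (hR1 : R < 1) (z : 𝕜) (hz : z ≠ 0) :
    -- the two products on the completion
    Weyl.IsContinuousExtension (Weyl.WeylSpace.sym 𝒱 (R := R)) (Weyl.symC 𝒱) ∧
    Weyl.IsContinuousExtension (Weyl.WeylSpace.star 𝒱 (R := R) Λ z) (Weyl.starC 𝒱 Λ z) ∧
    -- the star-exponential
    (∀ w ∈ 𝒱 0,
      Weyl.ConvergesAbsolutely
        (Weyl.expTerm (Weyl.symC 𝒱)
          (Weyl.of 𝒱 (R := R) w + (z / 2 * Λ w w) • Weyl.unit 𝒱))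
        (Weyl.expC (Weyl.symC 𝒱) (Weyl.of 𝒱 w + (z / 2 * Λ w w) • Weyl.unit 𝒱)) ∧
      Weyl.ConvergesAbsolutely
        (Weyl.expTerm (Weyl.starC 𝒱 Λ z) (Weyl.of 𝒱 (R := R) w))
        (Weyl.expC (Weyl.starC 𝒱 Λ z) (Weyl.of 𝒱 w)) ∧
      Weyl.expC (Weyl.starC 𝒱 Λ z) (Weyl.of 𝒱 (R := R) w) =
        Weyl.expC (Weyl.symC 𝒱) (Weyl.of 𝒱 w + (z / 2 * Λ w w) • Weyl.unit 𝒱)) ∧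
    -- the translations
    (∀ φ : V →L[𝕜] 𝕜, (∀ v ∈ 𝒱 1, φ v = 0) →
      (φ : V →ₗ[𝕜] 𝕜) ∈ LinearMap.range (Weyl.sharp 𝒱 Λ) →
      (∀ a : Weyl.WeylSpace 𝒱 R,
        Weyl.WeylSpace.incl 𝒱 R (Weyl.WeylSpace.translate 𝒱 (φ : V →ₗ[𝕜] 𝕜) a) =
          Weyl.translate (φ : V →ₗ[𝕜] 𝕜) (Weyl.WeylSpace.incl 𝒱 R a)) ∧
      (∀ a : Weyl.WeylSpace 𝒱 R,
        Weyl.translateC 𝒱 (φ : V →ₗ[𝕜] 𝕜) (a : Weyl.WeylCompletion 𝒱 R) =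
          (Weyl.WeylSpace.translate 𝒱 (φ : V →ₗ[𝕜] 𝕜) a : Weyl.WeylCompletion 𝒱 R)) ∧
      Weyl.IsContinuousAut (R := R) (Weyl.starC 𝒱 Λ z)
        (Weyl.translateC 𝒱 (φ : V →ₗ[𝕜] 𝕜)) ∧
      (∃ w ∈ 𝒱 0, (2 * z) • Weyl.sharp 𝒱 Λ w = (φ : V →ₗ[𝕜] 𝕜)) ∧
      ∀ w ∈ 𝒱 0, (2 * z) • Weyl.sharp 𝒱 Λ w = (φ : V →ₗ[𝕜] 𝕜) →
        Weyl.IsConjugation (R := R) (Weyl.starC 𝒱 Λ z)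
          (Weyl.expC (Weyl.starC 𝒱 Λ z) (Weyl.of 𝒱 w))
          (Weyl.expC (Weyl.starC 𝒱 Λ z) (Weyl.of 𝒱 (-w)))
          (Weyl.translateC 𝒱 (φ : V →ₗ[𝕜] 𝕜))) := by
  have hB : ∀ z, Weyl.IsBoundedBilin (Weyl.WeylSpace.starHom 𝒱 R Λ z) :=
    Weyl.isBoundedBilin_starHom hproj hΛc hR hR1
  have hM := fun z => (hB z).isContinuousExtension_star
  refine ⟨?_, hM z, fun w hw => ⟨?_, ?_, ?_⟩, fun φ hφ hφs => ?_⟩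
  · rw [Weyl.symC_eq_starC R Λ, Weyl.sym_eq_star R Λ]
    exact hM 0
  · exact Weyl.convergesAbsolutely_expTerm_symC hΛ hR1 (hM 0) hw _
  · exact Weyl.convergesAbsolutely_expTerm_starC hΛ hR1 (hM z) hw
  · exact Weyl.expC_starC_eq_expC_symC hΛ hR1 (hM z) (hM 0) hw
  · have hφ0 : Weyl.IsHomFunctional 𝒱 (φ : V →ₗ[𝕜] 𝕜) 0 := by
      intro j hj v hv
      obtain rfl : j = 1 := (show ∀ j : ZMod 2, 0 ≠ j → j = 1 by decide) j hj
      exact hφ v hv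
    obtain ⟨w, hw, hwφ⟩ := Weyl.exists_even_sharp_eq hΛ hz hφ0 hφs
    exact ⟨Weyl.WeylSpace.incl_translate hφ0,
      UniformSpace.Completion.map_coe
        (Weyl.uniformContinuous_translate hΛ hR1 (hB z) hw hφ0 hwφ),
      (Weyl.isConjugation_translateC hΛ hR1 (hB z) hw hφ0 hwφ).isContinuousAut hΛ (hM z),
      ⟨w, hw, hwφ⟩, fun w hw hwφ => Weyl.isConjugation_translateC hΛ hR1 (hB z) hw hφ0 hwφ⟩
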